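/- Let $n\ge 1$ and let $X$ be a relatively compact open subset with smooth boundary $M=\partial X$ in an $(n+1)$-dimensional complex manifold, with a smooth real defining function $\rho$ given on a neighbourhood of $\overline X$: $X=\{\rho<0\}$ and $d\rho\ne 0$ on $M$. Put $\theta=\frac{\sqrt{-1}}{2}(\bar\partial\rho-\partial\rho)$ and assume that $M$ is strictly pseudoconvex, i.e. the Levi form of $\theta|_M$ is positive definite. Assume that $\rho$ is a global approximate solution of the Monge–Ampère equation: every $p\in M$ has a holomorphic coordinate system around it in which $$\det\begin{pmatrix}\rho&\rho_{\bar j}\\ \rho_i&\rho_{i\bar j}\end{pmatrix}=-1+O(\rho^{n+2})\quad\text{near } p \text{ in } X .$$ Let $g$ be a hermitian metric on $X$ with $g=\partial\bar\partial\log(-1/\rho)$ near $M$. Near $M$ let $\xi$ be the unique $(1,0)$-vector field with $\rho_i\xi^i=1$, $\rho_{i\bar j}\xi^{\bar j}=r\rho_i$, where $r=\rho_{i\bar j}\xi^i\xi^{\bar j}$ is the transverse curvature of $\rho$. An admissible frame is a smooth $(1,0)$-frame $\{W_0=\xi,W_\alpha\}$ with $\{W_\alpha\}_{\alpha=1}^n$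 a frame of $\mathrm{Ker}\,\partial\rho$; let $\{\theta^0=\partial\rho,\theta^\alpha\}$ be its dual coframe and $h_{\alpha\bar\beta}=-\sqrt{-1}\,d\theta(W_\alpha,\overline{W_\beta})$. Such frames exist near every point of $M$. Let $\omega_\beta{}^\alpha$, $A^\alpha{}_{\bar\beta}$ be the Tanaka–Webster connection forms and torsion of $(M,\theta|_M)$, which exist and are determined on $M$ by $$d\theta^\alpha=\theta^\beta\wedge\omega_\beta{}^\alpha+A^\alpha{}_{\bar\beta}\,\theta\wedge\theta^{\bar\beta},\qquad dh_{\alpha\bar\beta}=\omega_\alpha{}^\gamma h_{\gamma\bar\beta}+h_{\alpha\bar\gamma}\overline{\omega_\beta{}^\gamma};$$ let $R_\alpha{}^\beta{}_{\gamma\bar\delta}$ be the coefficient of $\theta^\gamma\wedge\theta^{\bar\delta}$ in $d\omega_\alpha{}^\beta-\omega_\alpha{}^\gamma\wedge\omega_\gamma{}^\beta$, $\mathrm{Ric}_{\gamma\bar\delta}=R_\alpha{}^\alpha{}_{\gamma\bar\delta}$ and $\mathrm{Scal}=\mathrm{Ric}_\gamma{}^\gamma$. Indices are raised and lowered by $h$;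 indices after a comma, and lower indices on $\mathrm{Scal}$, denote Tanaka–Webster covariant derivatives. Let $\psi_i{}^j$ be the connection forms of the Chern connection of $g$, with $\nabla W_i=\psi_i{}^j\otimes W_j$. The renormalized connection and its curvature are $$\theta_i{}^j=\psi_i{}^j-\frac{1}{-\rho}\bigl(\delta_i{}^j\rho_k+\delta_k{}^j\rho_i\bigr)\theta^k,\qquad \Theta_i{}^j=d\theta_i{}^j-\theta_i{}^k\wedge\theta_k{}^j .$$ Then on $M$ $$r|_M=\frac{\mathrm{Scal}}{n(n+1)} .$$ Moreover, in every admissible frame, $\theta_i{}^j$ and $\Theta_i{}^j$ extend continuously up to $M$, and the restrictions (pull-backs) of the extensions to $M$ satisfy $$\theta_\beta{}^\alpha|_M=\omega_\beta{}^\alpha+\tfrac{\sqrt{-1}}{n(n+1)}\mathrm{Scal}\,\theta\,\delta_\beta{}^\alpha,$$ $$\theta_0{}^\alpha|_M=\tfrac{1}{n(n+1)}\mathrm{Scal}\,\theta^\alpha-\sqrt{-1}A^\alpha{}_{\bar\gamma}\theta^{\bar\gamma}+\tfrac{\sqrt{-1}}{n(n+1)}\mathrm{Scal}^\alpha\,\theta,$$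 $$\theta_\beta{}^0|_M=-h_{\beta\bar\gamma}\theta^{\bar\gamma},\qquad \theta_0{}^0|_M=\tfrac{\sqrt{-1}}{n(n+1)}\mathrm{Scal}\,\theta,$$ $$\Theta_\beta{}^\alpha|_M=S_\beta{}^\alpha{}_{\gamma\bar\mu}\theta^\gamma\wedge\theta^{\bar\mu}+V_\beta{}^\alpha{}_\gamma\theta^\gamma\wedge\theta-V^\alpha{}_{\beta\bar\gamma}\theta^{\bar\gamma}\wedge\theta-\sqrt{-1}A_{\beta\gamma}\theta^\gamma\wedge\theta^\alpha+\tfrac{\sqrt{-1}}{n(n+1)}\mathrm{Scal}_\beta\,\theta\wedge\theta^\alpha,$$ $$\Theta_\beta{}^0|_M=A_{\beta\gamma}\theta^\gamma\wedge\theta,$$ where $$S_{\beta\bar\alpha\gamma\bar\mu}=R_{\beta\bar\alpha\gamma\bar\mu}-\tfrac{\mathrm{Scal}}{n(n+1)}(h_{\beta\bar\alpha}h_{\gamma\bar\mu}+h_{\gamma\bar\alpha}h_{\beta\bar\mu}),$$ $$V_{\beta\bar\alpha\gamma}=A_{\beta\gamma,\bar\alpha}+\tfrac{\sqrt{-1}\,\mathrm{Scal}_\gamma}{n(n+1)}h_{\beta\bar\alpha}+\tfrac{\sqrt{-1}\,\mathrm{Scal}_\beta}{n(n+1)}h_{\gamma\bar\alpha},\qquad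 V_{\bar\alpha\beta\bar\gamma}=\overline{V_{\alpha\bar\beta\gamma}} .$$ Finally, $S$ is the Chern–Moser pseudoconformal curvature tensor: $$S_{\beta\bar\alpha\gamma\bar\mu}=R_{\beta\bar\alpha\gamma\bar\mu}-\tfrac{1}{n+2}\bigl(h_{\beta\bar\alpha}\mathrm{Ric}_{\gamma\bar\mu}+h_{\gamma\bar\alpha}\mathrm{Ric}_{\beta\bar\mu}+\mathrm{Ric}_{\beta\bar\alpha}h_{\gamma\bar\mu}+\mathrm{Ric}_{\gamma\bar\alpha}h_{\beta\bar\mu}\bigr)+\tfrac{\mathrm{Scal}}{(n+1)(n+2)}\bigl(h_{\beta\bar\alpha}h_{\gamma\bar\mu}+h_{\gamma\bar\alpha}h_{\beta\bar\mu}\bigr).$$ -/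

import Mathlib

open scoped Manifold ContDiff Topology Matrix ComplexConjugate

noncomputable section

namespace RenormBoundary

/-! ### Forms, Wirtinger derivatives and wedge products on `ℂ^{n+1}`

A (complex valued) 1-form is a function `z v ↦ α z v` of a point and a real tangent vector, a 2-form
a function `z v w ↦ β z v w`.  A vector `v : ℂ^{n+1}` stands for the real tangent vector
`v^i ∂_i + conj` as well as for the `(1,0)`-vector `V = v^i ∂_i = (v - i J v) / 2`. -/

/-- The model space `ℂ^{n+1}`. -/
abbrev Cn (n : ℕ) : Type := Fin (n + 1) → ℂ

variable {n : ℕ}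

/-- The coordinate vector `∂_i`. -/
def stdVec (i : Fin (n + 1)) : Cn n := Pi.single i 1

/-- Value of the complex linear extension of a covector `a` on the `(1,0)`-vector `V = v^i ∂_i`. -/
def eval10 (a : Cn n → ℂ) (v : Cn n) : ℂ := (a v - Complex.I * a (Complex.I • v)) / 2

/-- Value of the complex linear extension of a covector `a` on the `(0,1)`-vector `conj V`. -/
def eval01 (a : Cn n → ℂ) (v : Cn n) : ℂ := (a v + Complex.I * a (Complex.I • v)) / 2

/-- Value of the complex bilinear extension of `b` on `(V, conj W)`. -/
def eval11 (b : Cn n → Cn n → ℂ) (v w : Cn n) : ℂ :=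
  eval10 (fun v' => eval01 (b v') w) v

/-- The form `∂f`; its value on `v` is also the derivative of `f` along `v^i ∂_i`. -/
def del (f : Cn n → ℂ) (z v : Cn n) : ℂ := eval10 (fun x => fderiv ℝ f z x) v

/-- The form `∂̄f`; its value on `v` is also the derivative of `f` along `conj (v^i ∂_i)`. -/
def delbar (f : Cn n → ℂ) (z v : Cn n) : ℂ := eval01 (fun x => fderiv ℝ f z x) v

/-- Exterior derivative of a 1-form: `dα(v, w) = v(α(w)) - w(α(v))` for constant `v`, `w`. -/
def extD (α : Cn n → Cn n → ℂ) (z v w : Cn n) : ℂ :=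
  fderiv ℝ (fun y => α y w) z v - fderiv ℝ (fun y => α y v) z w

/-- Wedge product of 1-forms. -/
def wedge (α β : Cn n → Cn n → ℂ) (z v w : Cn n) : ℂ := α z v * β z w - α z w * β z v

/-- The complex conjugate of a 1-form. -/
def conjForm (α : Cn n → Cn n → ℂ) (z v : Cn n) : ℂ := conj (α z v)

/-! ### A real function `u` in holomorphic coordinates -/

/-- `u` as a complex valued function. -/
def cx (u : Cn n → ℝ) (z : Cn n) : ℂ := (u z : ℂ)

/-- The matrix `u_{i j̄} = ∂²u / ∂z^i ∂z̄^j`. -/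
def hess (u : Cn n → ℝ) (z : Cn n) : Matrix (Fin (n + 1)) (Fin (n + 1)) ℂ :=
  Matrix.of fun i j => del (fun y => delbar (cx u) y (stdVec j)) z (stdVec i)

/-- The Monge-Ampère operator
`J[u] = det ((u, u_{j̄}), (u_i, u_{i j̄}))`. -/
def mongeAmpere (u : Cn n → ℝ) (z : Cn n) : ℂ :=
  (Matrix.fromBlocks (Matrix.of fun _ _ : Unit => cx u z)
    (Matrix.of fun (_ : Unit) j => delbar (cx u) z (stdVec j))
    (Matrix.of fun i (_ : Unit) => del (cx u) z (stdVec i))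
    (hess u z)).det

/-- The contact form `θ = (i/2)(∂̄u - ∂u)`. -/
def contactForm (u : Cn n → ℝ) (z v : Cn n) : ℂ :=
  Complex.I / 2 * (delbar (cx u) z v - del (cx u) z v)

/-- `(V, W) ↦ u_{i j̄} V^i conj(W^j)`, which is `-i dθ(V, conj W)` since `dθ = i ∂∂̄u`. -/
def leviForm (u : Cn n → ℝ) (z v w : Cn n) : ℂ :=
  ∑ i, ∑ j, hess u z i j * v i * conj (w j)

/-- The tangent space at `z` of the level set of `u` through `z`. -/
def Tangent (u : Cn n → ℝ) (z : Cn n) : Set (Cn n) := {v | fderiv ℝ u z v = 0}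

/-! ### Frames

A frame is `W : Fin (n+1) → ℂ^{n+1} → ℂ^{n+1}`, with `W 0 = ξ`; the Greek index `α : Fin n`
corresponds to the index `α.succ`. -/

/-- The transverse curvature `r = u_{i j̄} ξ^i conj(ξ^j)`, with `ξ = W 0`. -/
def transverseCurvature (u : Cn n → ℝ) (W : Fin (n + 1) → Cn n → Cn n) (z : Cn n) : ℂ :=
  leviForm u z (W 0 z) (W 0 z)

/-- `W` is a smooth `(1,0)`-frame `{ξ, W_α}` on the open set `V` such that
`u_i ξ^i = 1`, `u_{i j̄} conj(ξ^j) = r u_i` and `{W_α}` is a frame of `Ker ∂u`. -/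
structure IsAdmissibleFrame (u : Cn n → ℝ) (V : Set (Cn n))
    (W : Fin (n + 1) → Cn n → Cn n) : Prop where
  isOpen : IsOpen V
  smooth : ∀ a, ContDiffOn ℝ ∞ (W a) V
  linearIndependent : ∀ z ∈ V, LinearIndependent ℂ (fun a => W a z)
  xi_normalized : ∀ z ∈ V, del (cx u) z (W 0 z) = 1
  xi_orthogonal : ∀ z ∈ V, ∀ i,
    ∑ j, hess u z i j * conj (W 0 z j) = transverseCurvature u W z * del (cx u) z (stdVec i)
  ker : ∀ z ∈ V, ∀ α : Fin n, del (cx u) z (W α.succ z) = 0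

/-- The matrix whose `a`-th row holds the components of `W_a`. -/
def frameMatrix (W : Fin (n + 1) → Cn n → Cn n) (z : Cn n) :
    Matrix (Fin (n + 1)) (Fin (n + 1)) ℂ :=
  Matrix.of fun a i => W a z i

/-- The dual coframe of `(1,0)`-forms: `v = ∑ a, θ^a(v) W_a`. -/
def coframe (W : Fin (n + 1) → Cn n → Cn n) (a : Fin (n + 1)) (z v : Cn n) : ℂ :=
  ∑ i, v i * (frameMatrix W z)⁻¹ i a

/-- The Levi form in the frame: the matrix `h_{α β̄}`. -/
def levi (u : Cn n → ℝ) (W : Fin (n + 1) → Cn n → Cn n) (z : Cn n) : Matrix (Fin n) (Fin n) ℂ :=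
  Matrix.of fun α β => leviForm u z (W α.succ z) (W β.succ z)

/-- The inverse Levi form `h^{α β̄}`, with `h_{γ β̄} h^{α β̄} = δ_γ^α`. -/
def leviInv (u : Cn n → ℝ) (W : Fin (n + 1) → Cn n → Cn n) (z : Cn n) (α β : Fin n) : ℂ :=
  (levi u W z)⁻¹ β α

/-! ### The Tanaka-Webster connection of a hypersurface

`M` is a piece of a level set of `u`.  Forms and functions on `M` are represented by forms and
functions that are smooth near `M`; only their restrictions to `M` matter below. -/

/-- `ω_α^β` are the Tanaka-Webster connection forms and `A^α_{β̄}` is the torsion on `M` of the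
contact form `θ|_M` in the frame `W`: on `TM`,
`dθ^α = θ^β ∧ ω_β^α + A^α_{β̄} θ ∧ θ^{β̄}` and `dh_{αβ̄} = ω_α^γ h_{γβ̄} + h_{αγ̄} conj(ω_β^γ)`. -/
structure IsTanakaWebster (u : Cn n → ℝ) (M : Set (Cn n)) (W : Fin (n + 1) → Cn n → Cn n)
    (om : Fin n → Fin n → Cn n → (Cn n →L[ℝ] ℂ)) (A : Fin n → Fin n → Cn n → ℂ) : Prop where
  smooth_connection : ∀ α β, ∀ z ∈ M, ContDiffAt ℝ ∞ (om α β) z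
  smooth_torsion : ∀ α β, ∀ z ∈ M, ContDiffAt ℝ ∞ (A α β) z
  structure_eq : ∀ α, ∀ z ∈ M, ∀ v ∈ Tangent u z, ∀ w ∈ Tangent u z,
    extD (coframe W α.succ) z v w =
      ∑ β : Fin n, wedge (coframe W β.succ) (fun y x => om β α y x) z v w +
      ∑ β : Fin n, A α β z * wedge (contactForm u) (conjForm (coframe W β.succ)) z v w
  metric_eq : ∀ α β, ∀ z ∈ M, ∀ v ∈ Tangent u z,
    fderiv ℝ (fun y => levi u W y α β) z v =
      ∑ γ, om α γ z v * levi u W z γ β + ∑ γ, levi u W z α γ * conj (om β γ z v)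

section Curvature

variable (u : Cn n → ℝ) (W : Fin (n + 1) → Cn n → Cn n)
  (om : Fin n → Fin n → Cn n → (Cn n →L[ℝ] ℂ)) (A : Fin n → Fin n → Cn n → ℂ)

/-- Curvature forms `Ω_α^β = dω_α^β - ω_α^γ ∧ ω_γ^β`. -/
def twCurvatureForm (α β : Fin n) (z v w : Cn n) : ℂ :=
  extD (fun y x => om α β y x) z v w
    - ∑ γ, wedge (fun y x => om α γ y x) (fun y x => om γ β y x) z v w

/-- `R_α^β_{γ δ̄}`: the coefficient of `θ^γ ∧ θ^{δ̄}` in `Ω_α^β`. -/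
def curvUp (α β γ δ : Fin n) (z : Cn n) : ℂ :=
  eval11 (twCurvatureForm om α β z) (W γ.succ z) (W δ.succ z)

/-- The Tanaka-Webster curvature `R_{α β̄ γ δ̄}`. -/
def curv (α β γ δ : Fin n) (z : Cn n) : ℂ :=
  ∑ ν, curvUp W om α ν γ δ z * levi u W z ν β

/-- `Ric_{γ δ̄} = R_α^α_{γ δ̄}`. -/
def ric (γ δ : Fin n) (z : Cn n) : ℂ := ∑ α, curvUp W om α α γ δ z

/-- `Scal = h^{γ δ̄} Ric_{γ δ̄}`. -/
def scal (z : Cn n) : ℂ := ∑ γ, ∑ δ, leviInv u W z γ δ * ric W om γ δ z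

/-- `Scal_γ`, the derivative along `W_γ`. -/
def dScal (γ : Fin n) (z : Cn n) : ℂ := del (scal u W om) z (W γ.succ z)

/-- `Scal^α = h^{α β̄} Scal_{β̄}`. -/
def dScalUp (α : Fin n) (z : Cn n) : ℂ :=
  ∑ β : Fin n, leviInv u W z α β * delbar (scal u W om) z (W β.succ z)

/-- `A_{α β} = h_{α γ̄} A^{γ̄}_β`, with `A^{γ̄}_β = conj(A^γ_{β̄})`. -/
def torsion (α β : Fin n) (z : Cn n) : ℂ := ∑ γ, levi u W z α γ * conj (A γ β z)

/-- `A_{α β, γ̄}`: the component along `W_{γ̄}` of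
`∇A_{α β} = dA_{α β} - ω_α^ν A_{ν β} - ω_β^ν A_{α ν}`. -/
def dTorsion (α β γ : Fin n) (z : Cn n) : ℂ :=
  delbar (torsion u W A α β) z (W γ.succ z)
    - ∑ ν, eval01 (fun x => om α ν z x) (W γ.succ z) * torsion u W A ν β z
    - ∑ ν, eval01 (fun x => om β ν z x) (W γ.succ z) * torsion u W A α ν z

/-- `S_{β ᾱ γ μ̄} = R_{β ᾱ γ μ̄} - Scal/(n(n+1)) (h_{β ᾱ} h_{γ μ̄} + h_{γ ᾱ} h_{β μ̄})`. -/
def tensorS (β α γ μ : Fin n) (z : Cn n) : ℂ :=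
  curv u W om β α γ μ z - scal u W om z / ((n : ℂ) * (n + 1)) *
    (levi u W z β α * levi u W z γ μ + levi u W z γ α * levi u W z β μ)

/-- `S_β^α_{γ μ̄}`. -/
def tensorSUp (β α γ μ : Fin n) (z : Cn n) : ℂ :=
  ∑ ν, leviInv u W z α ν * tensorS u W om β ν γ μ z

/-- `V_{β ᾱ γ} = A_{β γ, ᾱ} + i Scal_γ/(n(n+1)) h_{β ᾱ} + i Scal_β/(n(n+1)) h_{γ ᾱ}`. -/
def tensorV (β α γ : Fin n) (z : Cn n) : ℂ :=
  dTorsion u W om A β γ α z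
    + Complex.I * dScal u W om γ z / ((n : ℂ) * (n + 1)) * levi u W z β α
    + Complex.I * dScal u W om β z / ((n : ℂ) * (n + 1)) * levi u W z γ α

/-- `V_β^α_γ = h^{α ν̄} V_{β ν̄ γ}`. -/
def tensorVUp (β α γ : Fin n) (z : Cn n) : ℂ := ∑ ν, leviInv u W z α ν * tensorV u W om A β ν γ z

/-- `V^α_{β γ̄} = h^{α ν̄} V_{ν̄ β γ̄}`, with `V_{ν̄ β γ̄} = conj(V_{ν β̄ γ})`. -/
def tensorVUpBar (α β γ : Fin n) (z : Cn n) : ℂ := ∑ ν, leviInv u W z α ν * conj (tensorV u W om A ν β γ z)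

/-- The Chern-Moser pseudoconformal curvature tensor in Webster's form, that is, the totally
trace-free part of `R_{β ᾱ γ μ̄}`. -/
def chernMoser (β α γ μ : Fin n) (z : Cn n) : ℂ :=
  curv u W om β α γ μ z
    - 1 / ((n : ℂ) + 2) *
      (levi u W z β α * ric W om γ μ z + levi u W z γ α * ric W om β μ z
        + ric W om β α z * levi u W z γ μ + ric W om γ α z * levi u W z β μ)
    + scal u W om z / (((n : ℂ) + 1) * (n + 2)) *
      (levi u W z β α * levi u W z γ μ + levi u W z γ α * levi u W z β μ)

end Curvature

/-! ### The renormalized connection -/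

section Renormalized

variable (u : Cn n → ℝ) (G : Cn n → Matrix (Fin (n + 1)) (Fin (n + 1)) ℂ)
  (W : Fin (n + 1) → Cn n → Cn n)

/-- Connection forms `ψ_a^b` in the frame `W` (`∇W_a = ψ_a^b ⊗ W_b`) of the Chern connection of the
hermitian metric `g_{i j̄} = G i j`, whose matrix in the coordinate frame is `∂G · G⁻¹`. -/
def chernConnection (a b : Fin (n + 1)) (z v : Cn n) : ℂ :=
  (((Matrix.of fun a i => fderiv ℝ (fun y => W a y i) z v) +
    frameMatrix W z * ((Matrix.of fun i j => del (fun y => G y i j) z v) * (G z)⁻¹)) *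
    (frameMatrix W z)⁻¹) a b

/-- `Y_a^b = (1/(-u)) (δ_a^b u_k + δ_k^b u_a) θ^k`, with `u_k` the component of `∂u` along `W_k`. -/
def singularPart (a b : Fin (n + 1)) (z v : Cn n) : ℂ :=
  1 / (-cx u z) * ∑ k, ((if a = b then 1 else 0) * del (cx u) z (W k z)
    + (if k = b then 1 else 0) * del (cx u) z (W a z)) * coframe W k z v

/-- The renormalized connection `θ_a^b = ψ_a^b - Y_a^b`. -/
def renormConnection (a b : Fin (n + 1)) (z v : Cn n) : ℂ :=
  chernConnection G W a b z v - singularPart u W a b z v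

/-- Its curvature `Θ_a^b = dθ_a^b - θ_a^c ∧ θ_c^b`. -/
def renormCurvature (a b : Fin (n + 1)) (z v w : Cn n) : ℂ :=
  extD (renormConnection u G W a b) z v w
    - ∑ c, wedge (renormConnection u G W a c) (renormConnection u G W c b) z v w

end Renormalized

/-! ### Complex manifolds with boundary

`N` is a complex manifold of dimension `n + 1`, an open neighbourhood of the closure of
`X = {ρ < 0}`. -/

section Manifold

variable {N : Type*} [TopologicalSpace N] [ChartedSpace (Cn n) N]

/-- Local holomorphic coordinate systems. -/
def IsHolChart (φ : OpenPartialHomeomorph N (Cn n)) : Prop :=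
  φ ∈ IsManifold.maximalAtlas 𝓘(ℂ, Cn n) ω N

/-- The interior `X = {ρ < 0}`. -/
def inside (ρ : N → ℝ) : Set N := {x | ρ x < 0}

/-- The boundary `M = ∂X`. -/
def bdry (ρ : N → ℝ) : Set N := frontier (inside ρ)

/-- `ρ` is a defining function of `X = {ρ < 0}`, and the closure of `X` is compact. -/
structure IsDefiningFunction (ρ : N → ℝ) : Prop where
  smooth : ContMDiff 𝓘(ℝ, Cn n) 𝓘(ℝ, ℝ) ∞ ρ
  compact : IsCompact (closure (inside ρ))
  deriv_ne_zero : ∀ p ∈ bdry ρ, mfderiv 𝓘(ℝ, Cn n) 𝓘(ℝ, ℝ) ρ p ≠ 0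

/-- The Levi form of `(i/2)(∂̄ρ - ∂ρ)|_M` is positive definite on `T^{1,0}M = Ker ∂ρ`. -/
def IsStrictlyPseudoconvex (ρ : N → ℝ) : Prop :=
  ∀ φ : OpenPartialHomeomorph N (Cn n), IsHolChart φ → ∀ z ∈ φ.target, φ.symm z ∈ bdry ρ →
    ∀ v : Cn n, v ≠ 0 → del (cx (ρ ∘ φ.symm)) z v = 0 →
      0 < (leviForm (ρ ∘ φ.symm) z v v).re

/-- Global approximate solution of the Monge-Ampère equation: near each point of `M`,
`J[ρ] = -1 + O(ρ^{n+2})` in some local holomorphic coordinates. -/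
def IsGlobalApproxSolution (ρ : N → ℝ) : Prop :=
  ∀ p ∈ bdry ρ, ∃ φ : OpenPartialHomeomorph N (Cn n), IsHolChart φ ∧ p ∈ φ.source ∧
    (fun z => mongeAmpere (ρ ∘ φ.symm) z + 1)
      =O[𝓝[{z | (ρ ∘ φ.symm) z < 0}] (φ p)] (fun z => (ρ ∘ φ.symm) z ^ (n + 2))

/-- The matrix `g_{i j̄} = g(∂_i, ∂_j)` of a family of sesquilinear forms in coordinates. -/
def chartMetric
    (g : ∀ x : N, TangentSpace 𝓘(ℂ, Cn n) x →ₗ[ℂ] TangentSpace 𝓘(ℂ, Cn n) x →ₗ⋆[ℂ] ℂ)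
    (φ : OpenPartialHomeomorph N (Cn n)) (z : Cn n) : Matrix (Fin (n + 1)) (Fin (n + 1)) ℂ :=
  Matrix.of fun i j =>
    g (φ.symm z) (mfderiv 𝓘(ℂ, Cn n) 𝓘(ℂ, Cn n) φ.symm z (stdVec i))
      (mfderiv 𝓘(ℂ, Cn n) 𝓘(ℂ, Cn n) φ.symm z (stdVec j))

/-- `g` is a hermitian metric on `X = {ρ < 0}` with `g = ∂∂̄ log(-1/ρ)` near `M`. -/
structure IsAdaptedMetric (ρ : N → ℝ)
    (g : ∀ x : N, TangentSpace 𝓘(ℂ, Cn n) x →ₗ[ℂ] TangentSpace 𝓘(ℂ, Cn n) x →ₗ⋆[ℂ] ℂ) :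
    Prop where
  hermitian : ∀ x ∈ inside ρ, ∀ v w, g x v w = conj (g x w v)
  pos : ∀ x ∈ inside ρ, ∀ v, v ≠ 0 → 0 < (g x v v).re
  smooth : ∀ φ : OpenPartialHomeomorph N (Cn n), IsHolChart φ → ∀ i j,
    ContDiffOn ℝ ∞ (fun z => chartMetric g φ z i j) (φ.target ∩ φ.symm ⁻¹' inside ρ)
  near_bdry : ∃ O : Set N, IsOpen O ∧ bdry ρ ⊆ O ∧
    ∀ φ : OpenPartialHomeomorph N (Cn n), IsHolChart φ →
      ∀ z ∈ φ.target, φ.symm z ∈ O ∩ inside ρ →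
        chartMetric g φ z = hess (fun y => Real.log (-1 / (ρ ∘ φ.symm) y)) z

end Manifold

end RenormBoundary

end

open RenormBoundary

/-! In holomorphic coordinates let H be the bordered Hessian of u = ρ, the matrix whose determinant
is J[u]. It is an indefinite hermitian form on (trivial line) ⊕ T^{1,0}. Strict pseudoconvexity
makes it nondegenerate on M, so its Chern connection K = ∂H · H⁻¹ is smooth across M. Everything in
the theorem is read off from K and its curvature.

Row i of H is ∂_i of row 0. Hence row 0 of ∂_x H is x · H, and row 0 of K is (0, x). Writing out ∂g
· g⁻¹ for g = ∂∂̄ log(-1/ρ) and eliminating the derivatives of the Hessian through ∂H = K H shows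
that it equals the T^{1,0} block of K plus the singular part Y (`mapDer_del_hess_log`). So near M
the renormalized connection is that block, called `conn` (`IsRegularFrame.renormConnection_eq`), and
this gives the extension to M.

In an admissible frame H has rows (u, 1, 0), (1, r, 0), (0, 0, h). Compatibility dH = K H + (K H)*
at the constant entries expresses the components of `conn` carrying an index 0 through r, h, the
coframe and one further object, the component `gam` of K into the trivial line, which is symmetric.
Row 0 of the curvature equation is the torsion-free structure equation dθ^b = θ^a ∧ θ_a^b. On M,
where u = 0 and ∂u = iθ, these identities become the Tanaka-Webster equations for θ_β^α - i r θ
δ_β^α, with torsion made from `gam`. Uniqueness (`IsRegularFrame.tanakaWebster_unique`) then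
identifies any given ω and A with these.

The curvature of K comes from a form sesquilinear in the two directions (`curvature_connH`). It
kills the trivial line, has the Bianchi symmetry (`curvH_symm`), and its trace is ∂∂̄ log J up to
sign. A holomorphic change of coordinates multiplies J by |f|² with f holomorphic, so in every chart
J = -|f|² + O(u²) near M on the side u < 0. Therefore the trace vanishes on M when the (0,1)
direction is complex tangential (`mongeAmpere_mul_eq_of_le`). Comparing the curvatures of ω and K
gives R = (curvature of K) + r (h h + h h); its trace is Ric = (n+1) r h, whence Scal = n(n+1) r
(`IsBoundaryData.ric_eq`, `IsBoundaryData.scal_eq`).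

It follows that S is the curvature of K along Ker ∂ρ, and that V is, up to a factor -i, the
component with one direction ξ, found by differentiating `gam` in (0,1) directions. The term gam ∧
θ^α supplies the A and Scal_β terms of Θ_β^α. That S is the Chern-Moser tensor is arithmetic once
Ric is known. -/

namespace RenormBoundary

variable {n : ℕ}

/-! ### Derivations at a point -/

/-- `δ` is a derivation at `z` of the differentiable complex valued functions. -/
structure IsDer (z : Cn n) (δ : (Cn n → ℂ) → ℂ) : Prop where
  add : ∀ f g, DifferentiableAt ℝ f z → DifferentiableAt ℝ g z →
    δ (fun y => f y + g y) = δ f + δ g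
  mul : ∀ f g, DifferentiableAt ℝ f z → DifferentiableAt ℝ g z →
    δ (fun y => f y * g y) = δ f * g z + f z * δ g
  const : ∀ c : ℂ, δ (fun _ => c) = 0
  congr : ∀ f g : Cn n → ℂ, f =ᶠ[𝓝 z] g → δ f = δ g

theorem isDer_fderiv (z v : Cn n) : IsDer z (fun f => fderiv ℝ f z v) where
  add f g hf hg := by rw [fderiv_fun_add hf hg]; rfl
  mul f g hf hg := by
    rw [fderiv_fun_mul hf hg]
    simp only [add_apply, smul_apply, smul_eq_mul]; ring
  const c := by simp
  congr f g h := by rw [h.fderiv_eq]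

theorem isDer_del (z v : Cn n) : IsDer z (fun f => del f z v) where
  add f g hf hg := by
    simp only [del, eval10, (isDer_fderiv z _).add f g hf hg]; ring
  mul f g hf hg := by
    simp only [del, eval10, (isDer_fderiv z _).mul f g hf hg]; ring
  const c := by simp [del, eval10]
  congr f g h := by simp only [del, h.fderiv_eq]

theorem isDer_delbar (z v : Cn n) : IsDer z (fun f => delbar f z v) where
  add f g hf hg := by
    simp only [delbar, eval01, (isDer_fderiv z _).add f g hf hg]; ring
  mul f g hf hg := by
    simp only [delbar, eval01, (isDer_fderiv z _).mul f g hf hg]; ring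
  const c := by simp [delbar, eval01]
  congr f g h := by simp only [delbar, h.fderiv_eq]

namespace IsDer

variable {z : Cn n} {δ : (Cn n → ℂ) → ℂ}

theorem sum (h : IsDer z δ) {ι : Type*} (s : Finset ι) (f : ι → Cn n → ℂ)
    (hf : ∀ i ∈ s, DifferentiableAt ℝ (f i) z) :
    δ (fun y => ∑ i ∈ s, f i y) = ∑ i ∈ s, δ (f i) := by
  classical
  induction s using Finset.induction_on with
  | empty => simpa using h.const 0
  | insert a s ha ih =>
    simp only [Finset.sum_insert ha]
    rw [h.add _ _ (hf a (by simp)) (DifferentiableAt.fun_sum fun i hi => hf i (by simp [hi])),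
      ih fun i hi => hf i (by simp [hi])]

theorem const_mul (h : IsDer z δ) (c : ℂ) {f : Cn n → ℂ} (hf : DifferentiableAt ℝ f z) :
    δ (fun y => c * f y) = c * δ f := by
  rw [h.mul _ _ (differentiableAt_const c) hf, h.const]; ring

theorem neg (h : IsDer z δ) {f : Cn n → ℂ} (hf : DifferentiableAt ℝ f z) :
    δ (fun y => - f y) = - δ f := by
  simpa using h.const_mul (-1) hf

theorem sub (h : IsDer z δ) {f g : Cn n → ℂ} (hf : DifferentiableAt ℝ f z)
    (hg : DifferentiableAt ℝ g z) : δ (fun y => f y - g y) = δ f - δ g := by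
  simpa [sub_eq_add_neg, h.neg hg] using h.add f (fun y => - g y) hf hg.fun_neg

theorem _root_.RenormBoundary.differentiableAt_prod {ι : Type*} {s : Finset ι} {f : ι → Cn n → ℂ}
    (hf : ∀ i ∈ s, DifferentiableAt ℝ (f i) z) :
    DifferentiableAt ℝ (fun y => ∏ i ∈ s, f i y) z := by
  classical
  induction s using Finset.induction_on with
  | empty => simp
  | insert a s ha ih =>
    simp only [Finset.prod_insert ha]
    exact (hf a (by simp)).fun_mul (ih fun i hi => hf i (by simp [hi]))

theorem prod (h : IsDer z δ) {ι : Type*} [DecidableEq ι] (s : Finset ι) (f : ι → Cn n → ℂ)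
    (hf : ∀ i ∈ s, DifferentiableAt ℝ (f i) z) :
    δ (fun y => ∏ i ∈ s, f i y) = ∑ i ∈ s, δ (f i) * ∏ j ∈ s.erase i, f j z := by
  induction s using Finset.induction_on with
  | empty => simpa using h.const 1
  | insert a s ha ih =>
    simp only [Finset.prod_insert ha, Finset.sum_insert ha, Finset.erase_insert ha]
    rw [h.mul _ _ (hf a (by simp)) (differentiableAt_prod fun i hi => hf i (by simp [hi])),
      ih fun i hi => hf i (by simp [hi]), Finset.mul_sum]
    congr 1
    refine Finset.sum_congr rfl fun i hi => ?_
    have : a ≠ i := fun e => ha (e ▸ hi)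
    rw [Finset.erase_insert_of_ne this, Finset.prod_insert (by simp [ha])]
    ring

end IsDer

/-- Entrywise application of a functional to a matrix valued function. -/
def mapDer {ι κ : Type*} (δ : (Cn n → ℂ) → ℂ) (A : Cn n → Matrix ι κ ℂ) : Matrix ι κ ℂ :=
  Matrix.of fun i j => δ (fun y => A y i j)

section MapDer

variable {ι κ τ : Type*} {z : Cn n} {δ : (Cn n → ℂ) → ℂ}

/-- Entrywise differentiability of a matrix valued function. -/
def EntryDiffAt (A : Cn n → Matrix ι κ ℂ) (z : Cn n) : Prop :=
  ∀ i j, DifferentiableAt ℝ (fun y => A y i j) z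

theorem mapDer_mul [Fintype κ] (h : IsDer z δ) {A : Cn n → Matrix ι κ ℂ} {B : Cn n → Matrix κ τ ℂ}
    (hA : EntryDiffAt A z) (hB : EntryDiffAt B z) :
    mapDer δ (fun y => A y * B y) = mapDer δ A * B z + A z * mapDer δ B := by
  ext i j
  simp only [mapDer, Matrix.of_apply, Matrix.add_apply, Matrix.mul_apply]
  rw [h.sum _ (fun k y => A y i k * B y k j) fun k _ => (hA i k).fun_mul (hB k j), ← Finset.sum_add_distrib]
  exact Finset.sum_congr rfl fun k _ => h.mul _ _ (hA i k) (hB k j)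

theorem mapDer_add (h : IsDer z δ) {A B : Cn n → Matrix ι κ ℂ}
    (hA : EntryDiffAt A z) (hB : EntryDiffAt B z) :
    mapDer δ (fun y => A y + B y) = mapDer δ A + mapDer δ B := by
  ext i j
  exact h.add _ _ (hA i j) (hB i j)

theorem mapDer_const (h : IsDer z δ) (A : Matrix ι κ ℂ) : mapDer δ (fun _ => A) = 0 := by
  ext i j
  exact h.const _

theorem mapDer_congr (h : IsDer z δ) {A B : Cn n → Matrix ι κ ℂ} (hAB : A =ᶠ[𝓝 z] B) :
    mapDer δ A = mapDer δ B := by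
  ext i j
  exact h.congr _ _ (hAB.mono fun y hy => by simp only [hy])

/-- Differentiate A A⁻¹ = 1, an identity that has to hold on a neighbourhood of z. -/
theorem mapDer_inv [Fintype ι] [DecidableEq ι] (h : IsDer z δ) {A : Cn n → Matrix ι ι ℂ}
    (hA : EntryDiffAt A z) (hA' : EntryDiffAt (fun y => (A y)⁻¹) z)
    (hdet : ∀ᶠ y in 𝓝 z, IsUnit (A y).det) :
    mapDer δ (fun y => (A y)⁻¹) = -((A z)⁻¹ * mapDer δ A * (A z)⁻¹) := by
  have h1 : mapDer δ (fun y => A y * (A y)⁻¹) = 0 := by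
    rw [mapDer_congr h (B := fun _ => 1) (hdet.mono fun y hy => Matrix.mul_nonsing_inv _ hy),
      mapDer_const h]
  rw [mapDer_mul h hA hA'] at h1
  have h2 : A z * mapDer δ (fun y => (A y)⁻¹) = -(mapDer δ A * (A z)⁻¹) :=
    eq_neg_of_add_eq_zero_right h1
  calc mapDer δ (fun y => (A y)⁻¹)
      = (A z)⁻¹ * (A z * mapDer δ (fun y => (A y)⁻¹)) := by
        rw [← Matrix.mul_assoc, Matrix.nonsing_inv_mul _ hdet.self_of_nhds, Matrix.one_mul]
    _ = _ := by rw [h2, Matrix.mul_neg, Matrix.mul_assoc]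

/-- Jacobi's formula. -/
theorem IsDer.det [Fintype ι] [DecidableEq ι] (h : IsDer z δ) {A : Cn n → Matrix ι ι ℂ}
    (hA : EntryDiffAt A z) :
    δ (fun y => (A y).det) = ((A z).adjugate * mapDer δ A).trace := by
  have hp : ∀ σ : Equiv.Perm ι, DifferentiableAt ℝ (fun y => ∏ i, A y (σ i) i) z := fun σ =>
    differentiableAt_prod fun i _ => hA _ _
  simp only [Matrix.det_apply']
  rw [h.sum _ _ fun σ _ => (differentiableAt_const _).fun_mul (hp σ)]
  -- By Leibniz, differentiating the factor of column i yields the Leibniz sum of the determinant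
  -- with column i replaced by its derivative. Cramer's rule then produces the adjugate.
  have h1 : ∀ σ : Equiv.Perm ι, δ (fun y => ((Equiv.Perm.sign σ : ℤ) : ℂ) * ∏ i, A y (σ i) i) =
      ∑ i, ((Equiv.Perm.sign σ : ℤ) : ℂ) *
        ∏ j, (A z).updateCol i (fun k => mapDer δ A k i) (σ j) j := fun σ => by
    rw [h.const_mul _ (hp σ), h.prod _ _ fun i _ => hA _ _, Finset.mul_sum]
    refine Finset.sum_congr rfl fun i _ => ?_
    rw [← Finset.mul_prod_erase _ _ (Finset.mem_univ i), Matrix.updateCol_self]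
    congr 2
    refine Finset.prod_congr rfl fun j hj => ?_
    rw [Matrix.updateCol_ne (Finset.ne_of_mem_erase hj)]
  rw [Finset.sum_congr rfl fun σ _ => h1 σ, Finset.sum_comm]
  simp only [← Matrix.det_apply', Matrix.trace, Matrix.diag_apply]
  refine Finset.sum_congr rfl fun i _ => ?_
  rw [← Matrix.cramer_apply, Matrix.cramer_eq_adjugate_mulVec]
  rfl

end MapDer

/-! ### Types of covectors -/

section Eval

variable {a b : Cn n → ℂ}

theorem eval10_add_eval01 (a : Cn n → ℂ) (v : Cn n) : eval10 a v + eval01 a v = a v := by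
  simp only [eval10, eval01]; ring

theorem I_smul_I_smul (v : Cn n) : Complex.I • Complex.I • v = -v := by
  rw [smul_smul, Complex.I_mul_I, neg_one_smul]

theorem real_add_I_smul (c : ℂ) (v : Cn n) : c • v = c.re • v + c.im • (Complex.I • v) := by
  ext i
  simp only [Pi.add_apply, Pi.smul_apply, smul_eq_mul, Complex.real_smul]
  conv_lhs => rw [← Complex.re_add_im c]
  ring

theorem IsLinearMap.apply_complex_smul (ha : IsLinearMap ℝ a) (c : ℂ) (v : Cn n) :
    a (c • v) = c.re * a v + c.im * a (Complex.I • v) := by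
  rw [real_add_I_smul, ha.map_add, ha.map_smul, ha.map_smul, Complex.real_smul, Complex.real_smul]

theorem isLinearMap_eval10 (ha : IsLinearMap ℝ a) : IsLinearMap ℂ (eval10 a) where
  map_add v w := by simp only [eval10, smul_add, ha.map_add]; ring
  map_smul c v := by
    simp only [eval10, smul_eq_mul]
    rw [smul_comm Complex.I c v, IsLinearMap.apply_complex_smul ha c v,
      IsLinearMap.apply_complex_smul ha c (Complex.I • v), I_smul_I_smul, ha.map_neg]
    conv_rhs => rw [← Complex.re_add_im c]
    linear_combination (c.im * a (Complex.I • v) / 2) * Complex.I_mul_I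

theorem eval10_of_linear (ha : IsLinearMap ℂ a) (v : Cn n) : eval10 a v = a v := by
  simp only [eval10, ha.map_smul, smul_eq_mul]
  linear_combination (-a v / 2) * Complex.I_mul_I

theorem eval01_of_linear (ha : IsLinearMap ℂ a) (v : Cn n) : eval01 a v = 0 := by
  simp only [eval01, ha.map_smul, smul_eq_mul]
  linear_combination (a v / 2) * Complex.I_mul_I

theorem eval10_conj (a : Cn n → ℂ) (v : Cn n) :
    eval10 (fun x => conj (a x)) v = conj (eval01 a v) := by
  simp only [eval10, eval01, map_div₀, map_add, map_mul, Complex.conj_I, map_ofNat]; ring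

theorem eval01_conj (a : Cn n → ℂ) (v : Cn n) :
    eval01 (fun x => conj (a x)) v = conj (eval10 a v) := by
  simp only [eval10, eval01, map_div₀, map_sub, map_mul, Complex.conj_I, map_ofNat]; ring

theorem eval10_fun_add (v : Cn n) :
    eval10 (fun x => a x + b x) v = eval10 a v + eval10 b v := by
  simp only [eval10]; ring

theorem eval01_fun_add (v : Cn n) :
    eval01 (fun x => a x + b x) v = eval01 a v + eval01 b v := by
  simp only [eval01]; ring

theorem eval10_fun_const_mul (c : ℂ) (v : Cn n) :
    eval10 (fun x => c * a x) v = c * eval10 a v := by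
  simp only [eval10]; ring

theorem eval10_fun_sum {ι : Type*} (s : Finset ι) (f : ι → Cn n → ℂ) (v : Cn n) :
    eval10 (fun x => ∑ i ∈ s, f i x) v = ∑ i ∈ s, eval10 (f i) v := by
  simp only [eval10, Finset.mul_sum, ← Finset.sum_sub_distrib, Finset.sum_div]

theorem eval11_mul (a b : Cn n → ℂ) (v w : Cn n) :
    eval11 (fun x y => a x * b y) v w = eval10 a v * eval01 b w := by
  simp only [eval11, eval10, eval01]; ring

theorem eval11_mul' (a b : Cn n → ℂ) (v w : Cn n) :
    eval11 (fun x y => a y * b x) v w = eval01 a w * eval10 b v := by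
  simp only [eval11, eval10, eval01]; ring

theorem eval11_add (f g : Cn n → Cn n → ℂ) (v w : Cn n) :
    eval11 (fun x y => f x y + g x y) v w = eval11 f v w + eval11 g v w := by
  simp only [eval11, eval10, eval01]; ring

theorem eval11_sub (f g : Cn n → Cn n → ℂ) (v w : Cn n) :
    eval11 (fun x y => f x y - g x y) v w = eval11 f v w - eval11 g v w := by
  simp only [eval11, eval10, eval01]; ring

theorem eval11_const_mul (c : ℂ) (f : Cn n → Cn n → ℂ) (v w : Cn n) :
    eval11 (fun x y => c * f x y) v w = c * eval11 f v w := by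
  simp only [eval11, eval10, eval01]; ring

/-- `eval11` only sees the values on the complex lines spanned by its arguments. -/
theorem eval11_congr {f g : Cn n → Cn n → ℂ} {v w : Cn n}
    (h : ∀ x ∈ ({v, Complex.I • v} : Set (Cn n)), ∀ y ∈ ({w, Complex.I • w} : Set (Cn n)),
      f x y = g x y) : eval11 f v w = eval11 g v w := by
  simp only [eval11, eval10, eval01, h v (by simp) w (by simp),
    h v (by simp) (Complex.I • w) (by simp), h (Complex.I • v) (by simp) w (by simp),
    h (Complex.I • v) (by simp) (Complex.I • w) (by simp)]

end Eval

/-! ### Wirtinger derivatives -/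

section Wirtinger

variable {f : Cn n → ℂ} {z : Cn n}

theorem isLinearMap_fderiv (f : Cn n → ℂ) (z : Cn n) :
    IsLinearMap ℝ (fun x => fderiv ℝ f z x) :=
  ⟨map_add _, map_smul _⟩

theorem isLinearMap_del (f : Cn n → ℂ) (z : Cn n) : IsLinearMap ℂ (del f z) :=
  isLinearMap_eval10 (isLinearMap_fderiv f z)

theorem fderiv_eq_del_add_delbar (f : Cn n → ℂ) (z v : Cn n) :
    fderiv ℝ f z v = del f z v + delbar f z v :=
  (eval10_add_eval01 _ v).symm

theorem fderiv_conj (f : Cn n → ℂ) (z v : Cn n) :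
    fderiv ℝ (fun y => conj (f y)) z v = conj (fderiv ℝ f z v) := by
  have h := Complex.conjCLE.comp_fderiv (f := f) (x := z)
  have h2 : (Complex.conjCLE ∘ f) = fun y => conj (f y) := by ext y; simp
  rw [h2] at h
  rw [h]; simp

theorem del_conj (f : Cn n → ℂ) (z v : Cn n) :
    del (fun y => conj (f y)) z v = conj (delbar f z v) := by
  rw [delbar, ← eval10_conj, del]
  simp only [fderiv_conj]

theorem delbar_conj (f : Cn n → ℂ) (z v : Cn n) :
    delbar (fun y => conj (f y)) z v = conj (del f z v) := by
  rw [del, ← eval01_conj, delbar]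
  simp only [fderiv_conj]

theorem del_eq_sum (f : Cn n → ℂ) (z v : Cn n) :
    del f z v = ∑ i, v i * del f z (stdVec i) := by
  have hv : v = ∑ i, v i • stdVec i := by
    ext j; simp [stdVec, Pi.single_apply]
  have := map_sum (isLinearMap_del f z).mk' (fun i => v i • stdVec i) Finset.univ
  simp only [IsLinearMap.mk'_apply, (isLinearMap_del f z).map_smul, smul_eq_mul] at this
  rw [← this, ← hv]

theorem delbar_eq_sum (f : Cn n → ℂ) (z v : Cn n) :
    delbar f z v = ∑ i, conj (v i) * delbar f z (stdVec i) := by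
  have := del_eq_sum (fun y => conj (f y)) z v
  simp only [del_conj] at this
  have h := congrArg conj this
  simpa using h

theorem contDiffAt_fderiv_apply (hf : ContDiffAt ℝ ∞ f z) (v : Cn n) :
    ContDiffAt ℝ ∞ (fun y => fderiv ℝ f y v) z :=
  (hf.fderiv_right (m := ∞) (by simp)).clm_apply contDiffAt_const

theorem contDiffAt_del (hf : ContDiffAt ℝ ∞ f z) (v : Cn n) :
    ContDiffAt ℝ ∞ (fun y => del f y v) z :=
  ((contDiffAt_fderiv_apply hf v).sub
    (contDiffAt_const.mul (contDiffAt_fderiv_apply hf _))).div_const 2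

theorem contDiffAt_delbar (hf : ContDiffAt ℝ ∞ f z) (v : Cn n) :
    ContDiffAt ℝ ∞ (fun y => delbar f y v) z :=
  ((contDiffAt_fderiv_apply hf v).add
    (contDiffAt_const.mul (contDiffAt_fderiv_apply hf _))).div_const 2

theorem ContDiffAt.diffAt (hf : ContDiffAt ℝ ∞ f z) : DifferentiableAt ℝ f z :=
  hf.differentiableAt (by simp)

theorem fderiv_fderiv_comm (hf : ContDiffAt ℝ ∞ f z) (v w : Cn n) :
    fderiv ℝ (fun y => fderiv ℝ f y v) z w = fderiv ℝ (fun y => fderiv ℝ f y w) z v := by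
  have hd : DifferentiableAt ℝ (fderiv ℝ f) z :=
    (hf.fderiv_right (m := ∞) (by simp)).differentiableAt (by simp)
  have h : ∀ v w, fderiv ℝ (fun y => fderiv ℝ f y v) z w = fderiv ℝ (fderiv ℝ f) z w v :=
    fun v w => by rw [fderiv_clm_apply hd (differentiableAt_const v)]; simp
  have hs : IsSymmSndFDerivAt ℝ f z :=
    hf.isSymmSndFDerivAt (by
    rw [minSmoothness_of_isRCLikeNormedField]; exact WithTop.coe_le_coe.2 (le_top : (2 : ℕ∞) ≤ ⊤))
  rw [h, h, hs.eq]

theorem fderiv_del (hf : ContDiffAt ℝ ∞ f z) (v w : Cn n) :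
    fderiv ℝ (fun y => del f y v) z w = (fderiv ℝ (fun y => fderiv ℝ f y v) z w
      - Complex.I * fderiv ℝ (fun y => fderiv ℝ f y (Complex.I • v)) z w) / 2 := by
  have h := isDer_fderiv z w
  have h1 := (contDiffAt_fderiv_apply hf v).diffAt
  have h2 := (contDiffAt_fderiv_apply hf (Complex.I • v)).diffAt
  have : (fun y => del f y v) = fun y => (1 / 2 : ℂ) * (fderiv ℝ f y v
      - Complex.I * fderiv ℝ f y (Complex.I • v)) := by
    ext y; simp only [del, eval10]; ring
  rw [this, h.const_mul _ (h1.fun_sub ((differentiableAt_const _).fun_mul h2)),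
    h.sub h1 ((differentiableAt_const _).fun_mul h2), h.const_mul _ h2]
  ring

theorem fderiv_delbar (hf : ContDiffAt ℝ ∞ f z) (v w : Cn n) :
    fderiv ℝ (fun y => delbar f y v) z w = (fderiv ℝ (fun y => fderiv ℝ f y v) z w
      + Complex.I * fderiv ℝ (fun y => fderiv ℝ f y (Complex.I • v)) z w) / 2 := by
  have h := isDer_fderiv z w
  have h1 := (contDiffAt_fderiv_apply hf v).diffAt
  have h2 := (contDiffAt_fderiv_apply hf (Complex.I • v)).diffAt
  have : (fun y => delbar f y v) = fun y => (1 / 2 : ℂ) * (fderiv ℝ f y v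
      + Complex.I * fderiv ℝ f y (Complex.I • v)) := by
    ext y; simp only [delbar, eval01]; ring
  rw [this, h.const_mul _ (h1.fun_add ((differentiableAt_const _).fun_mul h2)),
    h.add _ _ h1 ((differentiableAt_const _).fun_mul h2), h.const_mul _ h2]
  ring

theorem del_del_comm (hf : ContDiffAt ℝ ∞ f z) (v w : Cn n) :
    del (fun y => del f y v) z w = del (fun y => del f y w) z v := by
  simp only [del.eq_1 (fun y => del f y v), del.eq_1 (fun y => del f y w), eval10, fderiv_del hf]
  rw [fderiv_fderiv_comm hf v w, fderiv_fderiv_comm hf (Complex.I • v) w,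
    fderiv_fderiv_comm hf v (Complex.I • w), fderiv_fderiv_comm hf (Complex.I • v) (Complex.I • w)]
  ring

/-- Both sides expand into the real second derivatives along v, iv and w, iw, which Schwarz's
theorem matches pairwise. -/
theorem delbar_del_comm (hf : ContDiffAt ℝ ∞ f z) (v w : Cn n) :
    delbar (fun y => del f y v) z w = del (fun y => delbar f y w) z v := by
  simp only [delbar.eq_1 (fun y => del f y v), del.eq_1 (fun y => delbar f y w), eval10, eval01,
    fderiv_del hf, fderiv_delbar hf]
  rw [fderiv_fderiv_comm hf v w, fderiv_fderiv_comm hf (Complex.I • v) w,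
    fderiv_fderiv_comm hf v (Complex.I • w), fderiv_fderiv_comm hf (Complex.I • v) (Complex.I • w)]
  ring

end Wirtinger

/-! ### Smooth matrix valued functions -/

section EntrySmooth

variable {ι κ τ : Type*} {z : Cn n}

/-- Entrywise smoothness of a matrix valued function. -/
def EntrySmoothAt (A : Cn n → Matrix ι κ ℂ) (z : Cn n) : Prop :=
  ∀ i j, ContDiffAt ℝ ∞ (fun y => A y i j) z

namespace EntrySmoothAt

theorem diffAt {A : Cn n → Matrix ι κ ℂ} (h : EntrySmoothAt A z) : EntryDiffAt A z :=
  fun i j => ContDiffAt.diffAt (h i j)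

theorem mul [Fintype κ] {A : Cn n → Matrix ι κ ℂ} {B : Cn n → Matrix κ τ ℂ}
    (hA : EntrySmoothAt A z) (hB : EntrySmoothAt B z) :
    EntrySmoothAt (fun y => A y * B y) z := fun i j => by
  simp only [Matrix.mul_apply]
  exact ContDiffAt.sum fun k _ => (hA i k).mul (hB k j)

theorem add {A B : Cn n → Matrix ι κ ℂ}
    (hA : EntrySmoothAt A z) (hB : EntrySmoothAt B z) :
    EntrySmoothAt (fun y => A y + B y) z := fun i j => (hA i j).add (hB i j)

theorem det [Fintype ι] [DecidableEq ι] {A : Cn n → Matrix ι ι ℂ} (hA : EntrySmoothAt A z) :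
    ContDiffAt ℝ ∞ (fun y => (A y).det) z := by
  simp only [Matrix.det_apply']
  exact ContDiffAt.sum fun σ _ => contDiffAt_const.mul (contDiffAt_prod fun i _ => hA _ _)

theorem inv [Fintype ι] [DecidableEq ι] {A : Cn n → Matrix ι ι ℂ} (hA : EntrySmoothAt A z)
    (hdet : IsUnit (A z).det) : EntrySmoothAt (fun y => (A y)⁻¹) z := fun i j => by
  simp only [Matrix.inv_def, Matrix.smul_apply, Matrix.adjugate_apply, Ring.inverse_eq_inv',
    smul_eq_mul]
  refine (hA.det.inv hdet.ne_zero).mul (EntrySmoothAt.det fun k l => ?_)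
  by_cases h : k = j
  · subst h; simpa using contDiffAt_const
  · simpa [Matrix.updateRow_ne h] using hA k l

theorem fderiv {A : Cn n → Matrix ι κ ℂ} (hA : EntrySmoothAt A z) (v : Cn n) :
    EntrySmoothAt (fun y => mapDer (fun f => fderiv ℝ f y v) A) z :=
  fun i j => contDiffAt_fderiv_apply (hA i j) v

theorem del {A : Cn n → Matrix ι κ ℂ} (hA : EntrySmoothAt A z) (v : Cn n) :
    EntrySmoothAt (fun y => mapDer (fun f => del f y v) A) z :=
  fun i j => contDiffAt_del (hA i j) v

theorem conjTranspose {A : Cn n → Matrix ι κ ℂ} (hA : EntrySmoothAt A z) :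
    EntrySmoothAt (fun y => (A y)ᴴ) z := fun i j =>
  Complex.conjCLE.contDiff.contDiffAt.comp z (hA j i)

end EntrySmoothAt

theorem mapDer_fderiv_eq (A : Cn n → Matrix ι κ ℂ) (z v : Cn n) :
    mapDer (fun f => fderiv ℝ f z v) A =
      mapDer (fun f => del f z v) A + mapDer (fun f => delbar f z v) A := by
  ext i j
  exact fderiv_eq_del_add_delbar _ z v

end EntrySmooth

/-! ### The bordered complex Hessian -/

/-- The index set of the bordered Hessian. -/
abbrev Idx (n : ℕ) : Type := Unit ⊕ Fin (n + 1)

/-- The bordered complex Hessian `((u, u_{j̄}), (u_i, u_{i j̄}))`. -/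
noncomputable def bordered (u : Cn n → ℝ) (z : Cn n) : Matrix (Idx n) (Idx n) ℂ :=
  Matrix.fromBlocks (Matrix.of fun _ _ : Unit => cx u z)
    (Matrix.of fun (_ : Unit) j => delbar (cx u) z (stdVec j))
    (Matrix.of fun i (_ : Unit) => del (cx u) z (stdVec i))
    (hess u z)

/-- Extension of a vector by zero to the bordered index set. -/
def emb (v : Cn n) : Idx n → ℂ := Sum.elim 0 v

/-- `∂_x` of the bordered Hessian. -/
noncomputable def delH (u : Cn n → ℝ) (z x : Cn n) : Matrix (Idx n) (Idx n) ℂ :=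
  mapDer (fun f => del f z x) (bordered u)

/-- `∂_{x̄}` of the bordered Hessian. -/
noncomputable def delbarH (u : Cn n → ℝ) (z x : Cn n) : Matrix (Idx n) (Idx n) ℂ :=
  mapDer (fun f => delbar f z x) (bordered u)

/-- The connection matrix `∂H · H⁻¹` of the bordered Hessian. -/
noncomputable def connH (u : Cn n → ℝ) (z x : Cn n) : Matrix (Idx n) (Idx n) ℂ :=
  delH u z x * (bordered u z)⁻¹

/-- `∂_{ȳ} ∂_x` of the bordered Hessian. -/
noncomputable def mixedH (u : Cn n → ℝ) (z x y : Cn n) : Matrix (Idx n) (Idx n) ℂ :=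
  mapDer (fun f => delbar f z y) (fun w => delH u w x)

/-- The curvature of the bordered Hessian, with both indices down. -/
noncomputable def curvH (u : Cn n → ℝ) (z x y : Cn n) : Matrix (Idx n) (Idx n) ℂ :=
  delH u z x * (bordered u z)⁻¹ * delbarH u z y - mixedH u z x y

variable {u : Cn n → ℝ} {z : Cn n}

theorem mongeAmpere_eq_det (u : Cn n → ℝ) (z : Cn n) : mongeAmpere u z = (bordered u z).det := rfl

/-- This is what distinguishes the bordered Hessian from a general hermitian matrix: its lower rows
are the derivatives of its top row. The special shape of the connection and the symmetries of its
curvature come from here. -/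
theorem bordered_inr (u : Cn n → ℝ) (z : Cn n) (i : Fin (n + 1)) (B : Idx n) :
    bordered u z (Sum.inr i) B = del (fun y => bordered u y (Sum.inl ()) B) z (stdVec i) := by
  rcases B with _ | _ <;> rfl

theorem contDiffAt_cx (hu : ContDiffAt ℝ ∞ u z) : ContDiffAt ℝ ∞ (cx u) z :=
  Complex.ofRealCLM.contDiff.contDiffAt.comp z hu

theorem smooth_bordered_inl (hu : ContDiffAt ℝ ∞ u z) (B : Idx n) :
    ContDiffAt ℝ ∞ (fun y => bordered u y (Sum.inl ()) B) z := by
  rcases B with _ | j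
  · exact contDiffAt_cx hu
  · exact contDiffAt_delbar (contDiffAt_cx hu) _

theorem smooth_bordered (hu : ContDiffAt ℝ ∞ u z) : EntrySmoothAt (bordered u) z := by
  rintro (_ | i) B
  · exact smooth_bordered_inl hu B
  · simp only [bordered_inr]
    exact contDiffAt_del (smooth_bordered_inl hu B) _

theorem conj_cx (u : Cn n → ℝ) : (fun y => conj (cx u y)) = cx u := by
  ext y; simp [cx]

theorem conj_del_cx (u : Cn n → ℝ) (z v : Cn n) : conj (del (cx u) z v) = delbar (cx u) z v := by
  rw [← delbar_conj, conj_cx]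

theorem bordered_conjTranspose (hu : ContDiffAt ℝ ∞ u z) : (bordered u z)ᴴ = bordered u z := by
  ext (_ | i) (_ | j)
  · simp [bordered, cx]
  · exact conj_del_cx u z _
  · change conj (delbar (cx u) z (stdVec i)) = del (cx u) z (stdVec i)
    rw [← conj_del_cx, Complex.conj_conj]
  · change conj (del (fun y => delbar (cx u) y (stdVec i)) z (stdVec j)) =
      del (fun y => delbar (cx u) y (stdVec j)) z (stdVec i)
    rw [← delbar_conj, ← delbar_del_comm (contDiffAt_cx hu)]
    congr 1
    ext y
    rw [← conj_del_cx, Complex.conj_conj]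

theorem conj_bordered (hu : ContDiffAt ℝ ∞ u z) (A B : Idx n) :
    conj (bordered u z A B) = bordered u z B A :=
  congrFun (congrFun (bordered_conjTranspose hu) B) A

section

variable (hu : ∀ᶠ y in 𝓝 z, ContDiffAt ℝ ∞ u y)
include hu

theorem delbarH_eq (x : Cn n) : delbarH u z x = (delH u z x)ᴴ := by
  ext A B
  change delbar (fun y => bordered u y A B) z x = conj (del (fun y => bordered u y B A) z x)
  rw [← delbar_conj]
  exact (isDer_delbar z x).congr _ _ (hu.mono fun y hy => (conj_bordered hy B A).symm)

theorem delH_eq (x : Cn n) : delH u z x = (delbarH u z x)ᴴ := by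
  rw [delbarH_eq hu, Matrix.conjTranspose_conjTranspose]

theorem mixedH_conjTranspose (x y : Cn n) : (mixedH u z x y)ᴴ = mixedH u z y x := by
  ext A B
  change conj (delbar (fun w => del (fun w' => bordered u w' B A) w x) z y) =
    delbar (fun w => del (fun w' => bordered u w' A B) w y) z x
  rw [← del_conj, delbar_del_comm (smooth_bordered hu.self_of_nhds A B)]
  refine (isDer_del z y).congr _ _ (hu.eventually_nhds.mono fun w hw => ?_)
  simp only [← delbar_conj]
  exact (isDer_delbar w x).congr _ _ (hw.mono fun y hy => conj_bordered hy B A)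

/-- H is hermitian because u is real, so ∂_x H and ∂̄_x H are adjoint to each other; both terms of
`curvH` are exchanged with their counterparts when x and y are swapped. -/
theorem curvH_conjTranspose (x y : Cn n) : (curvH u z x y)ᴴ = curvH u z y x := by
  simp only [curvH, Matrix.conjTranspose_sub, Matrix.conjTranspose_mul, mixedH_conjTranspose hu,
    Matrix.conjTranspose_nonsing_inv, bordered_conjTranspose hu.self_of_nhds, ← delH_eq hu,
    ← delbarH_eq hu, Matrix.mul_assoc]

end

theorem isLinearMap_delH (u : Cn n → ℝ) (z : Cn n) : IsLinearMap ℂ (delH u z) where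
  map_add v w := by ext A B; exact (isLinearMap_del _ _).map_add v w
  map_smul c v := by ext A B; exact (isLinearMap_del _ _).map_smul c v

theorem isLinearMap_connH (u : Cn n → ℝ) (z : Cn n) : IsLinearMap ℂ (connH u z) where
  map_add v w := by simp only [connH, (isLinearMap_delH u z).map_add, Matrix.add_mul]
  map_smul c v := by simp only [connH, (isLinearMap_delH u z).map_smul, Matrix.smul_mul]

/-- Expand ∂_x in coordinate derivatives: those of the top row are the lower rows. -/
theorem delH_inl (u : Cn n → ℝ) (z x : Cn n) (B : Idx n) :
    delH u z x (Sum.inl ()) B = (emb x ᵥ* bordered u z) B := by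
  change del (fun y => bordered u y (Sum.inl ()) B) z x = _
  rw [del_eq_sum]
  simp [Matrix.vecMul, dotProduct, emb, Fintype.sum_sum_type, bordered_inr]

theorem smooth_delH (hu : ContDiffAt ℝ ∞ u z) (x : Cn n) :
    EntrySmoothAt (fun y => delH u y x) z :=
  (smooth_bordered hu).del x

theorem emb_vecMul_delH (hu : ContDiffAt ℝ ∞ u z) (v x : Cn n) (B : Idx n) :
    (emb v ᵥ* delH u z x) B = del (fun y => del (fun w => bordered u w (Sum.inl ()) B) y v) z x := by
  have h1 : (fun y => del (fun w => bordered u w (Sum.inl ()) B) y v) =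
      fun y => ∑ i, v i * bordered u y (Sum.inr i) B := by
    ext y; rw [del_eq_sum]; simp only [bordered_inr]
  rw [h1, (isDer_del z x).sum _ _ fun i _ =>
    (differentiableAt_const _).fun_mul ((smooth_bordered hu).diffAt _ _)]
  simp only [Matrix.vecMul, dotProduct, emb, Fintype.sum_sum_type, Sum.elim_inl, Sum.elim_inr,
    Pi.zero_apply, zero_mul, Finset.sum_const_zero, zero_add]
  exact Finset.sum_congr rfl fun i _ =>
    ((isDer_del z x).const_mul _ ((smooth_bordered hu).diffAt _ _)).symm

/-- By `emb_vecMul_delH` each side is a second (1,0)-derivative of the top row, along v and x, and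
these commute. -/
theorem delH_symm (hu : ContDiffAt ℝ ∞ u z) (v x : Cn n) :
    emb v ᵥ* delH u z x = emb x ᵥ* delH u z v := by
  ext B
  rw [emb_vecMul_delH hu, emb_vecMul_delH hu, del_del_comm (smooth_bordered_inl hu B)]

theorem vecMul_mixedH (hu : ContDiffAt ℝ ∞ u z) (c : Idx n → ℂ) (x y : Cn n) (B : Idx n) :
    (c ᵥ* mixedH u z x y) B = delbar (fun w => (c ᵥ* delH u w x) B) z y := by
  simp only [Matrix.vecMul, dotProduct]
  rw [(isDer_delbar z y).sum _ _ fun i _ =>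
    (differentiableAt_const _).fun_mul ((smooth_delH hu x).diffAt _ _)]
  exact Finset.sum_congr rfl fun i _ =>
    ((isDer_delbar z y).const_mul _ ((smooth_delH hu x).diffAt _ _)).symm

theorem isLinearMap_mixedH (hu : ContDiffAt ℝ ∞ u z) (y : Cn n) :
    IsLinearMap ℂ (fun x => mixedH u z x y) where
  map_add v w := by
    ext A B
    change delbar (fun q => delH u q (v + w) A B) z y = _
    simp only [(isLinearMap_delH u _).map_add]
    exact (isDer_delbar z y).add _ _ ((smooth_delH hu v).diffAt _ _) ((smooth_delH hu w).diffAt _ _)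
  map_smul c v := by
    ext A B
    change delbar (fun q => delH u q (c • v) A B) z y = _
    simp only [(isLinearMap_delH u _).map_smul]
    exact (isDer_delbar z y).const_mul c ((smooth_delH hu v).diffAt _ _)

theorem isLinearMap_curvH (hu : ContDiffAt ℝ ∞ u z) (y : Cn n) :
    IsLinearMap ℂ (fun x => curvH u z x y) where
  map_add v w := by
    simp only [curvH, (isLinearMap_delH u z).map_add, (isLinearMap_mixedH hu y).map_add,
      Matrix.add_mul]; abel
  map_smul c v := by
    simp only [curvH, (isLinearMap_delH u z).map_smul, (isLinearMap_mixedH hu y).map_smul,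
      Matrix.smul_mul, smul_sub]

/-- Since the top row of ∂_x H is x · H, the factor H⁻¹ cancels in the quadratic term, and both
terms of `curvH` have top row x · ∂̄_y H. -/
theorem curvH_inl (hu : ContDiffAt ℝ ∞ u z) (hdet : IsUnit (bordered u z).det) (x y : Cn n)
    (B : Idx n) : curvH u z x y (Sum.inl ()) B = 0 := by
  have h1 : ∀ w, delH u w x (Sum.inl ()) = emb x ᵥ* bordered u w := fun w => by
    ext B; exact delH_inl u w x B
  have h2 : mixedH u z x y (Sum.inl ()) B = (emb x ᵥ* delbarH u z y) B := by
    change delbar (fun w => delH u w x (Sum.inl ()) B) z y = _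
    simp only [h1, Matrix.vecMul, dotProduct]
    rw [(isDer_delbar z y).sum _ _ fun i _ =>
      (differentiableAt_const _).fun_mul ((smooth_bordered hu).diffAt _ _)]
    exact Finset.sum_congr rfl fun i _ =>
      (isDer_delbar z y).const_mul _ ((smooth_bordered hu).diffAt _ _)
  have h3 : (delH u z x * (bordered u z)⁻¹ * delbarH u z y) (Sum.inl ()) =
      emb x ᵥ* delbarH u z y := by
    rw [Matrix.mul_apply_eq_vecMul, Matrix.mul_apply_eq_vecMul, h1,
      Matrix.vecMul_vecMul (emb x), Matrix.mul_nonsing_inv _ hdet, Matrix.vecMul_one]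
  simp only [curvH, Matrix.sub_apply, h2, h3, sub_self]

/-! ### Symmetry, type and trace of the curvature of the bordered Hessian -/

section

variable (hu : ∀ᶠ y in 𝓝 z, ContDiffAt ℝ ∞ u y)
include hu

/-- First Bianchi identity: `delH_symm` applied in the quadratic term, and its ∂̄_y derivative in
the mixed term. -/
theorem curvH_symm (v x y : Cn n) : emb v ᵥ* curvH u z x y = emb x ᵥ* curvH u z v y := by
  ext B
  simp only [curvH, Matrix.vecMul_sub, Pi.sub_apply, vecMul_mixedH hu.self_of_nhds,
    ← Matrix.vecMul_vecMul, delH_symm hu.self_of_nhds v x]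
  congr 1
  exact (isDer_delbar z y).congr _ _ (hu.mono fun w hw => congrFun (delH_symm hw v x) B)

theorem eventually_isUnit_det (hdet : IsUnit (bordered u z).det) :
    ∀ᶠ y in 𝓝 z, IsUnit (bordered u y).det := by
  simp only [isUnit_iff_ne_zero] at hdet ⊢
  exact (smooth_bordered hu.self_of_nhds).det.continuousAt.eventually_ne hdet

theorem mapDer_delbar_connH (hdet : IsUnit (bordered u z).det) (x y : Cn n) :
    mapDer (fun f => delbar f z y) (fun w => connH u w x) =
      -(curvH u z x y * (bordered u z)⁻¹) := by
  have hs := smooth_bordered hu.self_of_nhds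
  simp only [connH]
  rw [mapDer_mul (isDer_delbar z y) (smooth_delH hu.self_of_nhds x).diffAt (hs.inv hdet).diffAt,
    mapDer_inv (isDer_delbar z y) hs.diffAt (hs.inv hdet).diffAt (eventually_isUnit_det hu hdet)]
  change mixedH u z x y * _ + _ * -(_ * delbarH u z y * _) = _
  simp only [curvH]
  noncomm_ring

theorem mapDer_del_connH (hdet : IsUnit (bordered u z).det) (x y : Cn n) :
    mapDer (fun f => del f z x) (fun w => connH u w y) =
      mapDer (fun f => del f z x) (fun w => delH u w y) * (bordered u z)⁻¹
        - connH u z y * connH u z x := by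
  have hs := smooth_bordered hu.self_of_nhds
  simp only [connH]
  rw [mapDer_mul (isDer_del z x) (smooth_delH hu.self_of_nhds y).diffAt (hs.inv hdet).diffAt,
    mapDer_inv (isDer_del z x) hs.diffAt (hs.inv hdet).diffAt (eventually_isUnit_det hu hdet)]
  change _ + _ * -(_ * delH u z x * _) = _
  noncomm_ring

/-- The curvature of `connH` is of type `(1,1)` and given by `curvH`. -/
theorem curvature_connH (hdet : IsUnit (bordered u z).det) (x y : Cn n) :
    mapDer (fun f => fderiv ℝ f z x) (fun w => connH u w y)
      - mapDer (fun f => fderiv ℝ f z y) (fun w => connH u w x)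
      - (connH u z x * connH u z y - connH u z y * connH u z x) =
    (curvH u z x y - curvH u z y x) * (bordered u z)⁻¹ := by
  have h : mapDer (fun f => del f z x) (fun w => delH u w y) =
      mapDer (fun f => del f z y) (fun w => delH u w x) := by
    ext A B
    exact del_del_comm (smooth_bordered hu.self_of_nhds A B) y x
  rw [mapDer_fderiv_eq, mapDer_fderiv_eq, mapDer_delbar_connH hu hdet, mapDer_delbar_connH hu hdet,
    mapDer_del_connH hu hdet, mapDer_del_connH hu hdet, h]
  noncomm_ring

/-- Jacobi's formula gives tr(∂H · H⁻¹) = ∂ log det H, stated here without dividing by the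
determinant. -/
theorem trace_connH (hdet : IsUnit (bordered u z).det) (x : Cn n) :
    mongeAmpere u z * (connH u z x).trace = del (mongeAmpere u) z x := by
  have h := (isDer_del z x).det (smooth_bordered hu.self_of_nhds).diffAt
  change del (fun y => (bordered u y).det) z x = _ at h
  change (bordered u z).det * _ = del (fun y => (bordered u y).det) z x
  rw [h, connH, Matrix.trace_mul_comm, Matrix.inv_def, Matrix.smul_mul, Matrix.trace_smul, smul_eq_mul,
    ← mul_assoc, Ring.mul_inverse_cancel _ hdet, one_mul]
  rfl

/-- If `∂∂̄ log |J|` vanishes on `(x, y)` then so does the trace of the curvature of `connH`. -/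
theorem trace_curvH (hdet : IsUnit (bordered u z).det) (x y : Cn n)
    (hJ : mongeAmpere u z * delbar (fun w => del (mongeAmpere u) w x) z y =
      del (mongeAmpere u) z x * delbar (mongeAmpere u) z y) :
    (curvH u z x y * (bordered u z)⁻¹).trace = 0 := by
  have hs := smooth_bordered hu.self_of_nhds
  have hK : EntrySmoothAt (fun w => connH u w x) z :=
    (smooth_delH hu.self_of_nhds x).mul (hs.inv hdet)
  have htr : DifferentiableAt ℝ (fun w => (connH u w x).trace) z := by
    simp only [Matrix.trace, Matrix.diag_apply]
    exact DifferentiableAt.fun_sum fun i _ => hK.diffAt i i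
  have hdelta := isDer_delbar z y
  have h1 : delbar (fun w => (connH u w x).trace) z y = -(curvH u z x y * (bordered u z)⁻¹).trace := by
    rw [← Matrix.trace_neg, ← mapDer_delbar_connH hu hdet]
    simp only [Matrix.trace, Matrix.diag_apply]
    rw [hdelta.sum _ _ fun i _ => hK.diffAt i i]
    rfl
  have h2 : delbar (fun w => mongeAmpere u w * (connH u w x).trace) z y =
      delbar (fun w => del (mongeAmpere u) w x) z y :=
    hdelta.congr _ _ ((hu.eventually_nhds.and (eventually_isUnit_det hu hdet)).mono
      fun w hw => trace_connH hw.1 hw.2 x)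
  rw [hdelta.mul (mongeAmpere u) _ (ContDiffAt.diffAt hs.det) htr, h1] at h2
  have hne : mongeAmpere u z ≠ 0 := hdet.ne_zero
  have h3 := trace_connH hu hdet x
  -- The hypothesis `hJ` is J² ∂∂̄ log J = 0 with denominators cleared, so the trace is obtained
  -- multiplied by J².
  have h4 : mongeAmpere u z * mongeAmpere u z * (curvH u z x y * (bordered u z)⁻¹).trace = 0 := by
    linear_combination -mongeAmpere u z * h2 - hJ + delbar (mongeAmpere u) z y * h3
  simpa [hne] using h4

end

/-! ### Change of frame -/

/-- The functional `f ↦ df(x)` at `z`. -/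
noncomputable abbrev fd (z x : Cn n) : (Cn n → ℂ) → ℂ := fun f => fderiv ℝ f z x

theorem mapDer_fderiv_comm {ι κ : Type*} {A : Cn n → Matrix ι κ ℂ} {z : Cn n}
    (hA : EntrySmoothAt A z) (x y : Cn n) :
    mapDer (fd z x) (fun w => mapDer (fd w y) A) = mapDer (fd z y) (fun w => mapDer (fd w x) A) := by
  ext i j
  exact fderiv_fderiv_comm (hA i j) y x

theorem mapDer_fd_conjTranspose {ι κ : Type*} (A : Cn n → Matrix ι κ ℂ) (z x : Cn n) :
    mapDer (fd z x) (fun w => (A w)ᴴ) = (mapDer (fd z x) A)ᴴ := by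
  ext i j
  exact fderiv_conj _ z x

/-- The connection matrix `K` in the frame `F`. -/
noncomputable def gauge {ι : Type*} [Fintype ι] [DecidableEq ι] (F : Cn n → Matrix ι ι ℂ)
    (K : Cn n → Cn n → Matrix ι ι ℂ) (z x : Cn n) : Matrix ι ι ℂ :=
  (mapDer (fd z x) F + F z * K z x) * (F z)⁻¹

section Gauge

variable {ι : Type*} [Fintype ι] [DecidableEq ι] {F : Cn n → Matrix ι ι ℂ}
  {K : Cn n → Cn n → Matrix ι ι ℂ} {z : Cn n}

theorem EntrySmoothAt.gauge (hF : EntrySmoothAt F z) (hdet : IsUnit (F z).det) {x : Cn n}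
    (hK : EntrySmoothAt (fun w => K w x) z) :
    EntrySmoothAt (fun w => RenormBoundary.gauge F K w x) z :=
  ((hF.fderiv x).add (hF.mul hK)).mul (hF.inv hdet)

theorem mapDer_gauge (hF : EntrySmoothAt F z) (hdet : ∀ᶠ w in 𝓝 z, IsUnit (F w).det) (x y : Cn n)
    (hy : EntrySmoothAt (fun w => K w y) z) :
    mapDer (fd z x) (fun w => gauge F K w y) =
      (mapDer (fd z x) (fun w => mapDer (fd w y) F) + (mapDer (fd z x) F * K z y
        + F z * mapDer (fd z x) (fun w => K w y))) * (F z)⁻¹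
      - gauge F K z y * (mapDer (fd z x) F * (F z)⁻¹) := by
  have hd := isDer_fderiv z x
  have hi := (hF.inv hdet.self_of_nhds).diffAt
  simp only [gauge]
  rw [mapDer_mul hd ((hF.fderiv y).add (hF.mul hy)).diffAt hi,
    mapDer_add hd (hF.fderiv y).diffAt (hF.mul hy).diffAt, mapDer_mul hd hF.diffAt hy.diffAt,
    mapDer_inv hd hF.diffAt hi hdet]
  noncomm_ring

/-- Curvature is a tensor: the second derivatives of F cancel by symmetry, and the terms with dF ·
F⁻¹ cancel against those in the wedge product. -/
theorem curvature_gauge (hF : EntrySmoothAt F z) (hdet : ∀ᶠ w in 𝓝 z, IsUnit (F w).det)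
    (x y : Cn n) (hx : EntrySmoothAt (fun w => K w x) z) (hy : EntrySmoothAt (fun w => K w y) z) :
    mapDer (fd z x) (fun w => gauge F K w y) - mapDer (fd z y) (fun w => gauge F K w x)
      - (gauge F K z x * gauge F K z y - gauge F K z y * gauge F K z x) =
    F z * (mapDer (fd z x) (fun w => K w y) - mapDer (fd z y) (fun w => K w x)
      - (K z x * K z y - K z y * K z x)) * (F z)⁻¹ := by
  rw [mapDer_gauge hF hdet x y hy, mapDer_gauge hF hdet y x hx, mapDer_fderiv_comm hF x y]
  have h : ∀ x y, gauge F K z x * gauge F K z y =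
      gauge F K z x * (mapDer (fd z y) F * (F z)⁻¹)
        + (mapDer (fd z x) F + F z * K z x) * K z y * (F z)⁻¹ := fun x y => by
    -- The identity K' F = dF + F K rewrites the products of transformed connections in the form
    -- that occurs in `mapDer_gauge`.
    have h1 : gauge F K z x * F z = mapDer (fd z x) F + F z * K z x := by
      rw [gauge, Matrix.mul_assoc, Matrix.nonsing_inv_mul _ hdet.self_of_nhds, Matrix.mul_one]
    rw [← h1]
    conv_lhs => rw [gauge.eq_1 F K z y]
    noncomm_ring
  rw [h x y, h y x]
  noncomm_ring

end Gauge

/-! ### The bordered Hessian in an admissible frame -/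

/-- The frame `W`, extended by a trivial line. -/
noncomputable def extFrame (W : Fin (n + 1) → Cn n → Cn n) (z : Cn n) : Matrix (Idx n) (Idx n) ℂ :=
  Matrix.fromBlocks 1 0 0 (frameMatrix W z)

/-- The bordered Hessian in the frame `W`. -/
noncomputable def extMetric (u : Cn n → ℝ) (W : Fin (n + 1) → Cn n → Cn n) (z : Cn n) :
    Matrix (Idx n) (Idx n) ℂ :=
  extFrame W z * bordered u z * (extFrame W z)ᴴ

/-- The connection of the bordered Hessian in the frame `W`. -/
noncomputable def extConn (u : Cn n → ℝ) (W : Fin (n + 1) → Cn n → Cn n) (z x : Cn n) :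
    Matrix (Idx n) (Idx n) ℂ :=
  gauge (extFrame W) (connH u) z x

/-- The smooth extension of the renormalized connection across the boundary. -/
noncomputable def conn (u : Cn n → ℝ) (W : Fin (n + 1) → Cn n → Cn n) (a b : Fin (n + 1))
    (z x : Cn n) : ℂ :=
  extConn u W z x (Sum.inr a) (Sum.inr b)

/-- The component of `extConn` in the trivial direction. -/
noncomputable def gam (u : Cn n → ℝ) (W : Fin (n + 1) → Cn n → Cn n) (a : Fin (n + 1))
    (z x : Cn n) : ℂ :=
  extConn u W z x (Sum.inr a) (Sum.inl ())

/-- The curvature `curvH` in the frame `W`. -/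
noncomputable def frameCurv (u : Cn n → ℝ) (W : Fin (n + 1) → Cn n → Cn n) (z x y : Cn n) :
    Matrix (Idx n) (Idx n) ℂ :=
  extFrame W z * curvH u z x y * (extFrame W z)ᴴ

/-- The curvature `curvH` in the frame `W`, with the second index raised. -/
noncomputable def frameCurvUp (u : Cn n → ℝ) (W : Fin (n + 1) → Cn n → Cn n) (z x y : Cn n) :
    Matrix (Idx n) (Idx n) ℂ :=
  extFrame W z * (curvH u z x y * (bordered u z)⁻¹) * (extFrame W z)⁻¹

/-- An admissible frame on an open set where `u` is smooth and its bordered Hessian is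
nonsingular. -/
structure IsRegularFrame (u : Cn n → ℝ) (U : Set (Cn n)) (W : Fin (n + 1) → Cn n → Cn n) : Prop
    extends IsAdmissibleFrame u U W where
  smooth_fun : ∀ z ∈ U, ContDiffAt ℝ ∞ u z
  det_ne_zero : ∀ z ∈ U, mongeAmpere u z ≠ 0

section

variable {u : Cn n → ℝ} {V : Set (Cn n)} {W : Fin (n + 1) → Cn n → Cn n} {z : Cn n}
  (h : IsAdmissibleFrame u V W) (hz : z ∈ V)
include h hz

theorem IsAdmissibleFrame.smooth_frame : EntrySmoothAt (frameMatrix W) z := fun a i =>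
  (contDiffAt_pi.1 ((h.smooth a).contDiffAt (h.isOpen.mem_nhds hz))) i

theorem IsAdmissibleFrame.isUnit_det_frame : IsUnit (frameMatrix W z).det := by
  rw [← Matrix.isUnit_iff_isUnit_det, ← Matrix.linearIndependent_rows_iff_isUnit]
  exact h.linearIndependent z hz

end

theorem leviForm_eq_sum (u : Cn n → ℝ) (z v w : Cn n) :
    leviForm u z v w = ∑ i, v i * ∑ j, hess u z i j * conj (w j) := by
  simp only [leviForm, Finset.mul_sum]
  exact Finset.sum_congr rfl fun i _ => Finset.sum_congr rfl fun j _ => by ring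

theorem extMetric_inl_inl (u : Cn n → ℝ) (W : Fin (n + 1) → Cn n → Cn n) (z : Cn n) :
    extMetric u W z (Sum.inl ()) (Sum.inl ()) = cx u z := by
  simp [extMetric, extFrame, bordered, Matrix.fromBlocks_multiply, Matrix.fromBlocks_conjTranspose]

theorem extMetric_inr_inl (u : Cn n → ℝ) (W : Fin (n + 1) → Cn n → Cn n) (z : Cn n)
    (a : Fin (n + 1)) :
    extMetric u W z (Sum.inr a) (Sum.inl ()) = del (cx u) z (W a z) := by
  rw [del_eq_sum]
  simp [extMetric, extFrame, bordered, Matrix.fromBlocks_multiply, Matrix.fromBlocks_conjTranspose,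
    Matrix.mul_apply, frameMatrix]

theorem extMetric_inl_inr (u : Cn n → ℝ) (W : Fin (n + 1) → Cn n → Cn n) (z : Cn n)
    (a : Fin (n + 1)) :
    extMetric u W z (Sum.inl ()) (Sum.inr a) = conj (del (cx u) z (W a z)) := by
  rw [conj_del_cx, delbar_eq_sum]
  simp [extMetric, extFrame, bordered, Matrix.fromBlocks_multiply, Matrix.fromBlocks_conjTranspose,
    Matrix.mul_apply, frameMatrix, mul_comm]

theorem extMetric_inr_inr (u : Cn n → ℝ) (W : Fin (n + 1) → Cn n → Cn n) (z : Cn n)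
    (a b : Fin (n + 1)) :
    extMetric u W z (Sum.inr a) (Sum.inr b) = leviForm u z (W a z) (W b z) := by
  rw [leviForm_eq_sum, extMetric, Matrix.mul_assoc]
  simp [extFrame, bordered, Matrix.fromBlocks_multiply, Matrix.fromBlocks_conjTranspose,
    Matrix.mul_apply, frameMatrix]

theorem extFrame_inr (W : Fin (n + 1) → Cn n → Cn n) (z : Cn n)
    (a : Fin (n + 1)) : extFrame W z (Sum.inr a) = emb (W a z) := by
  ext (_ | j) <;> simp [extFrame, emb, frameMatrix]

theorem mapDer_extFrame {W : Fin (n + 1) → Cn n → Cn n} {z : Cn n}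
    {δ : (Cn n → ℂ) → ℂ} (hδ : IsDer z δ) :
    mapDer δ (extFrame W) = Matrix.fromBlocks 0 0 0 (mapDer δ (frameMatrix W)) := by
  ext (_ | a) (_ | i)
  · exact hδ.const _
  · exact hδ.const _
  · exact hδ.const _
  · rfl

/-! ### Connection, curvature and metric compatibility of the bordered Hessian in a frame -/

namespace IsRegularFrame

variable {u : Cn n → ℝ} {U : Set (Cn n)} {W : Fin (n + 1) → Cn n → Cn n} {z : Cn n}
  (h : IsRegularFrame u U W) (hz : z ∈ U)
include h hz

theorem eventually_mem : ∀ᶠ y in 𝓝 z, y ∈ U := h.isOpen.mem_nhds hz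

theorem eventually_smooth : ∀ᶠ y in 𝓝 z, ContDiffAt ℝ ∞ u y :=
  (h.eventually_mem hz).mono h.smooth_fun

theorem isUnit_det_bordered : IsUnit (bordered u z).det :=
  isUnit_iff_ne_zero.2 (h.det_ne_zero z hz)

theorem smooth_extFrame : EntrySmoothAt (extFrame W) z := by
  rintro (_ | a) (_ | i)
  · exact contDiffAt_const
  · exact contDiffAt_const
  · exact contDiffAt_const
  · exact h.smooth_frame hz a i

theorem isUnit_det_extFrame : IsUnit (extFrame W z).det := by
  rw [extFrame, Matrix.det_fromBlocks_zero₁₂, Matrix.det_one, one_mul]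
  exact h.isUnit_det_frame hz

theorem eventually_isUnit_det_extFrame : ∀ᶠ y in 𝓝 z, IsUnit (extFrame W y).det :=
  (h.eventually_mem hz).mono fun _ hy => h.isUnit_det_extFrame hy

theorem extFrame_inv : (extFrame W z)⁻¹ = Matrix.fromBlocks 1 0 0 (frameMatrix W z)⁻¹ := by
  apply Matrix.inv_eq_right_inv
  rw [extFrame, Matrix.fromBlocks_multiply]
  simp [Matrix.mul_nonsing_inv _ (h.isUnit_det_frame hz)]

theorem smooth_connH (x : Cn n) : EntrySmoothAt (fun w => connH u w x) z :=
  (smooth_delH (h.smooth_fun z hz) x).mul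
    ((smooth_bordered (h.smooth_fun z hz)).inv (h.isUnit_det_bordered hz))

theorem smooth_extConn (x : Cn n) : EntrySmoothAt (fun w => extConn u W w x) z :=
  (h.smooth_extFrame hz).gauge (h.isUnit_det_extFrame hz) (h.smooth_connH hz x)

theorem smooth_conn (a b : Fin (n + 1)) (x : Cn n) :
    ContDiffAt ℝ ∞ (fun w => conn u W a b w x) z :=
  h.smooth_extConn hz x _ _

theorem smooth_gam (a : Fin (n + 1)) (x : Cn n) :
    ContDiffAt ℝ ∞ (fun w => gam u W a w x) z :=
  h.smooth_extConn hz x _ _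

/-- The top row of ∂_x H is x · H, and H⁻¹ removes H. The derivative of the trivial direction is
therefore the tautological T^{1,0}-valued form, which in the frame becomes the coframe. -/
theorem connH_inl (x : Cn n) : connH u z x (Sum.inl ()) = emb x := by
  have h1 : delH u z x (Sum.inl ()) = emb x ᵥ* bordered u z := by
    ext B; exact delH_inl u z x B
  rw [connH, Matrix.mul_apply_eq_vecMul, h1, Matrix.vecMul_vecMul,
    Matrix.mul_nonsing_inv _ (h.isUnit_det_bordered hz), Matrix.vecMul_one]

theorem extConn_eq (x : Cn n) : extConn u W z x = Matrix.fromBlocks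
    (connH u z x).toBlocks₁₁ ((connH u z x).toBlocks₁₂ * (frameMatrix W z)⁻¹)
    (frameMatrix W z * (connH u z x).toBlocks₂₁)
    ((mapDer (fd z x) (frameMatrix W) + frameMatrix W z * (connH u z x).toBlocks₂₂) *
      (frameMatrix W z)⁻¹) := by
  rw [extConn, gauge, h.extFrame_inv hz, mapDer_extFrame (isDer_fderiv z x), extFrame,
    ← Matrix.fromBlocks_toBlocks (connH u z x)]
  simp [Matrix.fromBlocks_multiply, Matrix.fromBlocks_add]

theorem extConn_inl_inl (x : Cn n) : extConn u W z x (Sum.inl ()) (Sum.inl ()) = 0 := by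
  rw [h.extConn_eq hz, Matrix.fromBlocks_apply₁₁]
  exact congrFun (h.connH_inl hz x) _

theorem extConn_inl_inr (x : Cn n) (b : Fin (n + 1)) :
    extConn u W z x (Sum.inl ()) (Sum.inr b) = coframe W b z x := by
  rw [h.extConn_eq hz, Matrix.fromBlocks_apply₁₂, Matrix.mul_apply]
  refine Finset.sum_congr rfl fun i _ => ?_
  rw [show (connH u z x).toBlocks₁₂ () i = x i from congrFun (h.connH_inl hz x) (Sum.inr i)]

theorem conn_eq (a b : Fin (n + 1)) (x : Cn n) : conn u W a b z x =
    ((mapDer (fd z x) (frameMatrix W) + frameMatrix W z * (connH u z x).toBlocks₂₂) *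
      (frameMatrix W z)⁻¹) a b := by
  rw [conn, h.extConn_eq hz, Matrix.fromBlocks_apply₂₂]

theorem gam_eq (a : Fin (n + 1)) (x : Cn n) :
    gam u W a z x = ∑ i, W a z i * connH u z x (Sum.inr i) (Sum.inl ()) := by
  rw [gam, h.extConn_eq hz, Matrix.fromBlocks_apply₂₁, Matrix.mul_apply]
  rfl

theorem curvature_extConn (x y : Cn n) :
    mapDer (fd z x) (fun w => extConn u W w y) - mapDer (fd z y) (fun w => extConn u W w x)
      - (extConn u W z x * extConn u W z y - extConn u W z y * extConn u W z x) =
    frameCurvUp u W z x y - frameCurvUp u W z y x := by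
  simp only [extConn]
  rw [curvature_gauge (h.smooth_extFrame hz) (h.eventually_isUnit_det_extFrame hz) x y
    (h.smooth_connH hz x) (h.smooth_connH hz y),
    curvature_connH (h.eventually_smooth hz) (h.isUnit_det_bordered hz)]
  simp only [frameCurvUp]
  noncomm_ring

theorem frameCurvUp_mul_extMetric (x y : Cn n) :
    frameCurvUp u W z x y * extMetric u W z = frameCurv u W z x y := by
  have h1 := Matrix.nonsing_inv_mul _ (h.isUnit_det_extFrame hz)
  have h2 := Matrix.nonsing_inv_mul _ (h.isUnit_det_bordered hz)
  calc _ = extFrame W z * curvH u z x y * ((bordered u z)⁻¹ *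
        ((extFrame W z)⁻¹ * extFrame W z) * bordered u z) * (extFrame W z)ᴴ := by
          simp only [frameCurvUp, extMetric]; noncomm_ring
    _ = _ := by rw [h1, Matrix.mul_one, h2, Matrix.mul_one, frameCurv]

theorem frameCurvUp_inl (x y : Cn n) (B : Idx n) : frameCurvUp u W z x y (Sum.inl ()) B = 0 := by
  have h1 : extFrame W z (Sum.inl ()) = Pi.single (Sum.inl ()) 1 := by
    ext (_ | j) <;> simp [extFrame]
  have h2 : curvH u z x y (Sum.inl ()) = 0 := by
    ext B; exact curvH_inl (h.smooth_fun z hz) (h.isUnit_det_bordered hz) x y B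
  rw [frameCurvUp, Matrix.mul_apply_eq_vecMul, Matrix.mul_apply_eq_vecMul, h1,
    Matrix.single_one_vecMul]
  change (((curvH u z x y * (bordered u z)⁻¹) (Sum.inl ())) ᵥ* _) B = 0
  rw [Matrix.mul_apply_eq_vecMul, h2]
  simp

theorem frameCurv_conjTranspose (x y : Cn n) : (frameCurv u W z x y)ᴴ = frameCurv u W z y x := by
  simp only [frameCurv, Matrix.conjTranspose_mul, Matrix.conjTranspose_conjTranspose,
    curvH_conjTranspose (h.eventually_smooth hz), Matrix.mul_assoc]

theorem frameCurv_inl (x y : Cn n) (B : Idx n) : frameCurv u W z x y (Sum.inl ()) B = 0 := by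
  rw [← h.frameCurvUp_mul_extMetric hz, Matrix.mul_apply]
  simp [h.frameCurvUp_inl hz]

/-- The vanishing row becomes a vanishing column by hermitian symmetry; this needs both indices
down, since `frameCurvUp` is not hermitian. -/
theorem frameCurv_inl_right (x y : Cn n) (A : Idx n) :
    frameCurv u W z x y A (Sum.inl ()) = 0 := by
  rw [← h.frameCurv_conjTranspose hz, Matrix.conjTranspose_apply, h.frameCurv_inl hz, star_zero]

theorem frameCurv_symm (a b : Fin (n + 1)) (y : Cn n) (B : Idx n) :
    frameCurv u W z (W a z) y (Sum.inr b) B = frameCurv u W z (W b z) y (Sum.inr a) B := by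
  simp only [frameCurv]
  rw [Matrix.mul_apply_eq_vecMul, Matrix.mul_apply_eq_vecMul, extFrame_inr,
    Matrix.mul_apply_eq_vecMul _ _ (Sum.inr a), Matrix.mul_apply_eq_vecMul _ _ (Sum.inr a),
    extFrame_inr, curvH_symm (h.eventually_smooth hz)]

theorem frameCurv_symm_right (a b : Fin (n + 1)) (x : Cn n) (A : Idx n) :
    frameCurv u W z x (W a z) A (Sum.inr b) = frameCurv u W z x (W b z) A (Sum.inr a) := by
  rw [← h.frameCurv_conjTranspose hz, Matrix.conjTranspose_apply, h.frameCurv_symm hz a b,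
    ← Matrix.conjTranspose_apply, h.frameCurv_conjTranspose hz]

theorem isLinearMap_frameCurv (y : Cn n) : IsLinearMap ℂ (fun x => frameCurv u W z x y) where
  map_add v w := by
    simp only [frameCurv, (isLinearMap_curvH (h.smooth_fun z hz) y).map_add, Matrix.mul_add,
      Matrix.add_mul]
  map_smul c v := by
    simp only [frameCurv, (isLinearMap_curvH (h.smooth_fun z hz) y).map_smul, Matrix.mul_smul,
      Matrix.smul_mul]

/-- A Chern connection is metric: ∂H = K H and ∂̄H = (K H)*, and the derivatives of the frame are
absorbed by the gauge term. -/
theorem mapDer_extMetric (x : Cn n) :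
    mapDer (fd z x) (extMetric u W) =
      extConn u W z x * extMetric u W z + (extConn u W z x * extMetric u W z)ᴴ := by
  have hd := isDer_fderiv z x
  have hF := h.smooth_extFrame hz
  have hH := smooth_bordered (h.smooth_fun z hz)
  have h1 : mapDer (fd z x) (bordered u) =
      connH u z x * bordered u z + (connH u z x * bordered u z)ᴴ := by
    have : connH u z x * bordered u z = delH u z x := by
      rw [connH, Matrix.mul_assoc, Matrix.nonsing_inv_mul _ (h.isUnit_det_bordered hz),
        Matrix.mul_one]
    rw [this, ← delbarH_eq (h.eventually_smooth hz), mapDer_fderiv_eq]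
    rfl
  have h2 : extConn u W z x * extMetric u W z =
      mapDer (fd z x) (extFrame W) * bordered u z * (extFrame W z)ᴴ
        + extFrame W z * (connH u z x * bordered u z) * (extFrame W z)ᴴ := by
    calc _ = (mapDer (fd z x) (extFrame W) + extFrame W z * connH u z x) *
          ((extFrame W z)⁻¹ * extFrame W z) * bordered u z * (extFrame W z)ᴴ := by
            simp only [extConn, extMetric, gauge]; noncomm_ring
      _ = _ := by
        rw [Matrix.nonsing_inv_mul _ (h.isUnit_det_extFrame hz)]; noncomm_ring
  rw [h2]
  change mapDer (fd z x) (fun w => extFrame W w * bordered u w * (extFrame W w)ᴴ) = _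
  rw [mapDer_mul hd (hF.mul hH).diffAt hF.conjTranspose.diffAt, mapDer_mul hd hF.diffAt hH.diffAt,
    mapDer_fd_conjTranspose, h1]
  simp only [Matrix.conjTranspose_add, Matrix.conjTranspose_mul, Matrix.conjTranspose_conjTranspose,
    bordered_conjTranspose (h.smooth_fun z hz)]
  noncomm_ring

end IsRegularFrame

/-! ### The structure equations in an admissible frame -/

theorem sum_idx (f : Idx n → ℂ) : ∑ A, f A = f (Sum.inl ()) + ∑ a, f (Sum.inr a) := by
  rw [Fintype.sum_sum_type, Fintype.sum_unique]

/-- The symmetric form `gam_a(W_c)`; on the boundary it is `-i` times the torsion. -/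
noncomputable def gamMat (u : Cn n → ℝ) (W : Fin (n + 1) → Cn n → Cn n) (z : Cn n) :
    Matrix (Fin (n + 1)) (Fin (n + 1)) ℂ :=
  Matrix.of fun a c => gam u W a z (W c z)

theorem fderiv_cx {u : Cn n → ℝ} {z : Cn n} (hu : ContDiffAt ℝ ∞ u z) (v : Cn n) :
    fderiv ℝ (cx u) z v = fderiv ℝ u z v := by
  have hd : DifferentiableAt ℝ u z := hu.differentiableAt (by simp)
  have h : HasFDerivAt (cx u) (Complex.ofRealCLM ∘L fderiv ℝ u z) z :=
    Complex.ofRealCLM.hasFDerivAt.comp z hd.hasFDerivAt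
  rw [h.fderiv]; rfl

theorem isLinearMap_coframe (W : Fin (n + 1) → Cn n → Cn n) (a : Fin (n + 1)) (z : Cn n) :
    IsLinearMap ℂ (coframe W a z) where
  map_add v w := by simp only [coframe, Pi.add_apply, add_mul, Finset.sum_add_distrib]
  map_smul c v := by
    simp only [coframe, Pi.smul_apply, smul_eq_mul, Finset.mul_sum, mul_assoc]

theorem isLinearMap_real {a : Cn n → ℂ} (ha : IsLinearMap ℂ a) : IsLinearMap ℝ a where
  map_add := ha.map_add
  map_smul c v := by
    have := ha.map_smul (c : ℂ) v
    simpa using this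

theorem conj_contactForm (u : Cn n → ℝ) (z v : Cn n) :
    conj (contactForm u z v) = contactForm u z v := by
  simp only [contactForm, ← conj_del_cx, map_mul, map_div₀, map_sub, Complex.conj_I, map_ofNat,
    Complex.conj_conj]
  ring

/-- On a tangent vector ∂u + ∂̄u = du = 0, so θ = -i ∂u. This turns every θ^0 into iθ on M. -/
theorem del_cx_of_tangent {u : Cn n → ℝ} {z v : Cn n} (hu : ContDiffAt ℝ ∞ u z)
    (hv : v ∈ Tangent u z) : del (cx u) z v = Complex.I * contactForm u z v := by
  have h := fderiv_eq_del_add_delbar (cx u) z v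
  rw [fderiv_cx hu, show fderiv ℝ u z v = 0 from hv] at h
  simp only [contactForm]
  push_cast at h
  linear_combination (-1/2 : ℂ) * h + (-(delbar (cx u) z v - del (cx u) z v) / 2) * Complex.I_mul_I

theorem mem_tangent_of_del_eq_zero {u : Cn n → ℝ} {z v : Cn n} (hu : ContDiffAt ℝ ∞ u z)
    (hv : del (cx u) z v = 0) : v ∈ Tangent u z := by
  have h := fderiv_eq_del_add_delbar (cx u) z v
  rw [fderiv_cx hu, ← conj_del_cx, hv, map_zero, add_zero] at h
  exact_mod_cast h

theorem contactForm_of_del_eq_zero {u : Cn n → ℝ} {z v : Cn n} (hv : del (cx u) z v = 0) :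
    contactForm u z v = 0 := by
  simp [contactForm, ← conj_del_cx, hv]

theorem conj_leviForm {u : Cn n → ℝ} {z : Cn n} (hu : ContDiffAt ℝ ∞ u z) (v w : Cn n) :
    conj (leviForm u z v w) = leviForm u z w v := by
  have hh : ∀ i j, conj (hess u z i j) = hess u z j i := fun i j =>
    conj_bordered hu (Sum.inr i) (Sum.inr j)
  simp only [leviForm, map_sum, map_mul, hh, Complex.conj_conj]
  rw [Finset.sum_comm]
  exact Finset.sum_congr rfl fun i _ => Finset.sum_congr rfl fun j _ => by ring

namespace IsRegularFrame

variable {u : Cn n → ℝ} {U : Set (Cn n)} {W : Fin (n + 1) → Cn n → Cn n} {z : Cn n}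
  (h : IsRegularFrame u U W) (hz : z ∈ U)
include h hz

theorem coframe_frame (a b : Fin (n + 1)) : coframe W a z (W b z) = if b = a then 1 else 0 := by
  have := congrFun (congrFun (Matrix.mul_nonsing_inv _ (h.isUnit_det_frame hz)) b) a
  rw [Matrix.one_apply] at this
  exact this

theorem sum_coframe_smul (v : Cn n) : ∑ a, coframe W a z v • W a z = v := by
  have h1 : v ᵥ* (frameMatrix W z)⁻¹ ᵥ* frameMatrix W z = v := by
    rw [Matrix.vecMul_vecMul, Matrix.nonsing_inv_mul _ (h.isUnit_det_frame hz), Matrix.vecMul_one]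
  ext i
  have h2 := congrFun h1 i
  simp only [Finset.sum_apply, Pi.smul_apply, smul_eq_mul]
  exact h2

/-- Both are complex linear and have the same values on the frame vectors. -/
theorem coframe_zero (v : Cn n) : coframe W 0 z v = del (cx u) z v := by
  have hl := isLinearMap_del (cx u) z
  conv_rhs => rw [← h.sum_coframe_smul hz v]
  have := map_sum hl.mk' (fun a => coframe W a z v • W a z) Finset.univ
  simp only [IsLinearMap.mk'_apply] at this
  rw [this, Fin.sum_univ_succ]
  simp [hl.map_smul, h.xi_normalized z hz, h.ker z hz]

theorem leviForm_succ_zero (β : Fin n) : leviForm u z (W β.succ z) (W 0 z) = 0 := by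
  rw [leviForm_eq_sum]
  have h1 : ∀ i, W β.succ z i * ∑ j, hess u z i j * conj (W 0 z j) =
      transverseCurvature u W z * (W β.succ z i * del (cx u) z (stdVec i)) := fun i => by
    rw [h.xi_orthogonal z hz i]; ring
  rw [Finset.sum_congr rfl fun i _ => h1 i, ← Finset.mul_sum, ← del_eq_sum, h.ker z hz, mul_zero]

theorem leviForm_zero_succ (β : Fin n) : leviForm u z (W 0 z) (W β.succ z) = 0 := by
  rw [← conj_leviForm (h.smooth_fun z hz), h.leviForm_succ_zero hz, map_zero]

theorem conj_transverseCurvature :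
    conj (transverseCurvature u W z) = transverseCurvature u W z :=
  conj_leviForm (h.smooth_fun z hz) _ _

theorem conj_levi (α β : Fin n) : conj (levi u W z α β) = levi u W z β α :=
  conj_leviForm (h.smooth_fun z hz) _ _

theorem smooth_extMetric : EntrySmoothAt (extMetric u W) z :=
  ((h.smooth_extFrame hz).mul (smooth_bordered (h.smooth_fun z hz))).mul
    (h.smooth_extFrame hz).conjTranspose

theorem smooth_transverseCurvature : ContDiffAt ℝ ∞ (transverseCurvature u W) z := by
  have := h.smooth_extMetric hz (Sum.inr 0) (Sum.inr 0)
  simp only [extMetric_inr_inr] at this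
  exact this

theorem smooth_levi : EntrySmoothAt (levi u W) z := fun α β => by
  have := h.smooth_extMetric hz (Sum.inr α.succ) (Sum.inr β.succ)
  simp only [extMetric_inr_inr] at this
  exact this

/-- In the frame H has rows (u, 1, 0), (1, r, 0), (0, 0, h), so a null vector of h extended by zero
is a null vector of the nondegenerate H. -/
theorem isUnit_det_levi : IsUnit (levi u W z).det := by
  rw [isUnit_iff_ne_zero]
  intro h0
  obtain ⟨x, hx, hx0⟩ := Matrix.exists_mulVec_eq_zero_iff.2 h0
  have hM : IsUnit (extMetric u W z).det := by
    rw [extMetric, Matrix.det_mul, Matrix.det_mul, Matrix.det_conjTranspose]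
    exact ((h.isUnit_det_extFrame hz).mul (h.isUnit_det_bordered hz)).mul
      (h.isUnit_det_extFrame hz).star
  have h1 : extMetric u W z *ᵥ (Sum.elim 0 (Fin.cons 0 x) : Idx n → ℂ) = 0 := by
    ext (a | a)
    · obtain rfl : a = () := rfl
      simp only [Matrix.mulVec, dotProduct, sum_idx, Fin.sum_univ_succ,
        extMetric_inl_inr, h.ker z hz]
      simp
    · have := fun α : Fin n => congrFun hx0 α
      simp only [Matrix.mulVec, dotProduct, Pi.zero_apply] at this
      simp only [Matrix.mulVec, dotProduct, sum_idx, Fin.sum_univ_succ,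
        extMetric_inr_inr]
      refine Fin.cases ?_ (fun α => ?_) a
      · simp [h.leviForm_zero_succ hz]
      · simpa [levi] using this α
  have h2 := Matrix.eq_zero_of_mulVec_eq_zero hM.ne_zero h1
  exact hx (funext fun α => congrFun h2 (Sum.inr α.succ))

theorem sum_leviInv_mul (α γ : Fin n) :
    ∑ β, leviInv u W z α β * levi u W z γ β = if γ = α then 1 else 0 := by
  have := congrFun (congrFun (Matrix.mul_nonsing_inv _ (h.isUnit_det_levi hz)) γ) α
  rw [Matrix.one_apply, Matrix.mul_apply] at this
  rw [← this]
  exact Finset.sum_congr rfl fun β _ => mul_comm _ _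

theorem sum_mul_levi (x y : Fin n → ℂ)
    (hxy : ∀ β, ∑ γ, x γ * levi u W z γ β = y β) (α : Fin n) :
    x α = ∑ β, leviInv u W z α β * y β := by
  simp only [← hxy, Finset.mul_sum]
  rw [Finset.sum_comm]
  have : ∀ γ, ∑ β, leviInv u W z α β * (x γ * levi u W z γ β) =
      x γ * if γ = α then 1 else 0 := fun γ => by
    rw [← h.sum_leviInv_mul hz, Finset.mul_sum]
    exact Finset.sum_congr rfl fun β _ => by ring
  simp [this]

theorem eq_of_sum_mul_levi {x y : Fin n → ℂ}
    (hxy : ∀ β, ∑ γ, x γ * levi u W z γ β = ∑ γ, y γ * levi u W z γ β) : x = y := by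
  ext α
  rw [h.sum_mul_levi hz x _ hxy, ← h.sum_mul_levi hz y _ fun _ => rfl]

/-- With its two companions below, this is right multiplication by H in the block form (u, 1, 0),
(1, r, 0), (0, 0, h). -/
theorem mul_extMetric_zero (X : Matrix (Idx n) (Idx n) ℂ) (A : Idx n) :
    (X * extMetric u W z) A (Sum.inr 0) =
      X A (Sum.inl ()) + X A (Sum.inr 0) * transverseCurvature u W z := by
  simp only [Matrix.mul_apply, sum_idx, Fin.sum_univ_succ, extMetric_inl_inr,
    extMetric_inr_inr, h.leviForm_succ_zero hz, h.xi_normalized z hz]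
  simp [transverseCurvature]

theorem mul_extMetric_succ (X : Matrix (Idx n) (Idx n) ℂ) (A : Idx n) (β : Fin n) :
    (X * extMetric u W z) A (Sum.inr β.succ) =
      ∑ γ : Fin n, X A (Sum.inr γ.succ) * levi u W z γ β := by
  simp only [Matrix.mul_apply, sum_idx, Fin.sum_univ_succ, extMetric_inl_inr,
    extMetric_inr_inr, h.leviForm_zero_succ hz, h.ker z hz]
  simp [levi]

theorem mul_extMetric_inl (X : Matrix (Idx n) (Idx n) ℂ) (A : Idx n) :
    (X * extMetric u W z) A (Sum.inl ()) =
      X A (Sum.inl ()) * cx u z + X A (Sum.inr 0) := by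
  simp only [Matrix.mul_apply, sum_idx, Fin.sum_univ_succ, extMetric_inr_inl,
    extMetric_inl_inl, h.ker z hz, h.xi_normalized z hz]
  simp

/-! ### Components of metric compatibility -/

section Metric

variable (x : Cn n)

theorem mapDer_extMetric_apply (A B : Idx n) : fderiv ℝ (fun w => extMetric u W w A B) z x =
    (extConn u W z x * extMetric u W z) A B +
      conj ((extConn u W z x * extMetric u W z) B A) :=
  congrFun (congrFun (h.mapDer_extMetric hz x) A) B

/-- The pairing of ξ with the trivial direction is constantly 1, so compatibility at that entry has
no derivative left and can be solved for the connection form. The constant entries 0 for W_β and the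
trivial direction, and for ξ and W_β, are used in the same way in the next two lemmas. -/
theorem conn_zero_zero : conn u W 0 0 z x =
    -(transverseCurvature u W z * conj (del (cx u) z x)) - gam u W 0 z x * cx u z := by
  have h1 := h.mapDer_extMetric_apply hz x (Sum.inr 0) (Sum.inl ())
  have h2 : fderiv ℝ (fun w => extMetric u W w (Sum.inr 0) (Sum.inl ())) z x = 0 := by
    rw [(isDer_fderiv z x).congr _ (fun _ => 1) ((h.eventually_mem hz).mono fun y hy => by
      simp only [extMetric_inr_inl, h.xi_normalized y hy])]
    simp
  rw [h2, h.mul_extMetric_inl hz, h.mul_extMetric_zero hz,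
    h.extConn_inl_inl hz, h.extConn_inl_inr hz, h.coframe_zero hz, zero_add, map_mul,
    h.conj_transverseCurvature hz] at h1
  simp only [conn, gam]
  linear_combination -h1

theorem conn_succ_zero (β : Fin n) : conn u W β.succ 0 z x =
    -(∑ γ : Fin n, levi u W z β γ * conj (coframe W γ.succ z x)) - gam u W β.succ z x * cx u z := by
  have h1 := h.mapDer_extMetric_apply hz x (Sum.inr β.succ) (Sum.inl ())
  have h2 : fderiv ℝ (fun w => extMetric u W w (Sum.inr β.succ) (Sum.inl ())) z x = 0 := by
    rw [(isDer_fderiv z x).congr _ (fun _ => 0) ((h.eventually_mem hz).mono fun y hy => by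
      simp only [extMetric_inr_inl, h.ker y hy])]
    simp
  rw [h2, h.mul_extMetric_inl hz, h.mul_extMetric_succ hz] at h1
  simp only [map_sum, map_mul, h.conj_levi hz, h.extConn_inl_inr hz, mul_comm (conj _)] at h1
  simp only [conn, gam]
  linear_combination -h1

theorem sum_conn_zero_mul_levi (β : Fin n) : ∑ γ : Fin n, conn u W 0 γ.succ z x * levi u W z γ β =
    -conj (gam u W β.succ z x) - transverseCurvature u W z * conj (conn u W β.succ 0 z x) := by
  have h1 := h.mapDer_extMetric_apply hz x (Sum.inr 0) (Sum.inr β.succ)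
  have h2 : fderiv ℝ (fun w => extMetric u W w (Sum.inr 0) (Sum.inr β.succ)) z x = 0 := by
    rw [(isDer_fderiv z x).congr _ (fun _ => 0) ((h.eventually_mem hz).mono fun y hy => by
      simp only [extMetric_inr_inr, h.leviForm_zero_succ hy])]
    simp
  rw [h2, h.mul_extMetric_zero hz, h.mul_extMetric_succ hz, map_add, map_mul,
    h.conj_transverseCurvature hz] at h1
  simp only [conn, gam]
  linear_combination -h1

theorem fderiv_transverseCurvature : fderiv ℝ (transverseCurvature u W) z x =
    gam u W 0 z x + conn u W 0 0 z x * transverseCurvature u W z +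
      conj (gam u W 0 z x + conn u W 0 0 z x * transverseCurvature u W z) := by
  have h1 := h.mapDer_extMetric_apply hz x (Sum.inr 0) (Sum.inr 0)
  simp only [extMetric_inr_inr, h.mul_extMetric_zero hz] at h1
  exact h1

theorem fderiv_levi (α β : Fin n) : fderiv ℝ (fun y => levi u W y α β) z x =
    ∑ γ : Fin n, conn u W α.succ γ.succ z x * levi u W z γ β +
      ∑ γ : Fin n, levi u W z α γ * conj (conn u W β.succ γ.succ z x) := by
  have h1 := h.mapDer_extMetric_apply hz x (Sum.inr α.succ) (Sum.inr β.succ)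
  simp only [extMetric_inr_inr, h.mul_extMetric_succ hz, map_sum, map_mul,
    h.conj_levi hz, mul_comm (conj _)] at h1
  exact h1

end Metric

/-- Row 0 of the extended connection is the coframe and row 0 of its curvature is zero, so the top
row of the curvature equation says that the renormalized connection is torsion free. -/
theorem extD_coframe (b : Fin (n + 1)) (x y : Cn n) :
    extD (coframe W b) z x y = ∑ a, wedge (coframe W a) (conn u W a b) z x y := by
  have h1 := congrFun (congrFun (h.curvature_extConn hz x y) (Sum.inl ())) (Sum.inr b)
  have h2 : ∀ x y, mapDer (fd z x) (fun w => extConn u W w y) (Sum.inl ()) (Sum.inr b) =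
      fderiv ℝ (fun w => coframe W b w y) z x := fun x y =>
    (isDer_fderiv z x).congr _ _ ((h.eventually_mem hz).mono fun w hw => h.extConn_inl_inr hw y b)
  simp only [Matrix.sub_apply, h2, h.frameCurvUp_inl hz, Matrix.mul_apply, sum_idx,
    h.extConn_inl_inl hz, h.extConn_inl_inr hz, sub_self] at h1
  simp only [extD, wedge, Finset.sum_sub_distrib]
  simp only [zero_mul, zero_add] at h1
  simp only [conn, mul_comm (coframe W _ z y)] at *
  linear_combination h1

/-- The T^{1,0} block of the matrix product passes once through the trivial line; this is the source
of gam ∧ θ^b, which is not part of the curvature of K. -/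
theorem extD_conn (a b : Fin (n + 1)) (x y : Cn n) :
    extD (conn u W a b) z x y = ∑ c, wedge (conn u W a c) (conn u W c b) z x y
      + wedge (gam u W a) (coframe W b) z x y
      + (frameCurvUp u W z x y (Sum.inr a) (Sum.inr b)
        - frameCurvUp u W z y x (Sum.inr a) (Sum.inr b)) := by
  have h1 := congrFun (congrFun (h.curvature_extConn hz x y) (Sum.inr a)) (Sum.inr b)
  have h2 : ∀ x y, mapDer (fd z x) (fun w => extConn u W w y) (Sum.inr a) (Sum.inr b) =
      fderiv ℝ (fun w => conn u W a b w y) z x := fun x y => rfl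
  simp only [Matrix.sub_apply, h2, Matrix.mul_apply, sum_idx, h.extConn_inl_inr hz] at h1
  have h4 : ∑ c, conn u W a c z y * conn u W c b z x =
    ∑ c, conn u W c b z x * conn u W a c z y := Finset.sum_congr rfl fun c _ => mul_comm _ _
  simp only [extD, wedge, Finset.sum_sub_distrib]
  simp only [conn, gam] at *
  linear_combination h1

theorem isLinearMap_gam (a : Fin (n + 1)) : IsLinearMap ℂ (gam u W a z) where
  map_add v w := by
    simp only [h.gam_eq hz, (isLinearMap_connH u z).map_add, Matrix.add_apply, mul_add,
      Finset.sum_add_distrib]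
  map_smul c v := by
    simp only [h.gam_eq hz, (isLinearMap_connH u z).map_smul, Matrix.smul_apply, smul_eq_mul,
      Finset.mul_sum]
    exact Finset.sum_congr rfl fun i _ => by ring

theorem gam_eq_sum (a : Fin (n + 1)) (v : Cn n) :
    gam u W a z v = ∑ c, coframe W c z v * gamMat u W z a c := by
  have hl := h.isLinearMap_gam hz a
  conv_lhs => rw [← h.sum_coframe_smul hz v]
  have := map_sum hl.mk' (fun a => coframe W a z v • W a z) Finset.univ
  simp only [IsLinearMap.mk'_apply] at this
  rw [this]
  simp [hl.map_smul, gamMat]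

theorem gam_eq_vecMul (a : Fin (n + 1)) (x : Cn n) :
    gam u W a z x = (emb (W a z) ᵥ* connH u z x) (Sum.inl ()) := by
  rw [h.gam_eq hz]
  simp [Matrix.vecMul, dotProduct, emb]

/-- This is `delH_symm` multiplied by H⁻¹. -/
theorem gamMat_symm (a c : Fin (n + 1)) : gamMat u W z a c = gamMat u W z c a := by
  simp only [gamMat, Matrix.of_apply, h.gam_eq_vecMul hz, connH, ← Matrix.vecMul_vecMul]
  rw [delH_symm (h.smooth_fun z hz)]

/-- The coordinate connection is of type (1,0), so only the derivative of the frame contributes to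
the (0,1) part. -/
theorem eval01_conn (a b : Fin (n + 1)) (y : Cn n) : eval01 (conn u W a b z) y =
    (mapDer (fun f => delbar f z y) (frameMatrix W) * (frameMatrix W z)⁻¹) a b := by
  have h1 : conn u W a b z = fun x => (mapDer (fd z x) (frameMatrix W) * (frameMatrix W z)⁻¹) a b
      + (frameMatrix W z * (connH u z x).toBlocks₂₂ * (frameMatrix W z)⁻¹) a b := by
    ext x
    rw [h.conn_eq hz, Matrix.add_mul, Matrix.add_apply]
  have h2 : IsLinearMap ℂ fun x =>
      (frameMatrix W z * (connH u z x).toBlocks₂₂ * (frameMatrix W z)⁻¹) a b := by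
    have hc := isLinearMap_connH u z
    constructor
    · intro v w
      rw [hc.map_add, ← Matrix.add_apply, ← Matrix.add_mul, ← Matrix.mul_add]; rfl
    · intro c v
      rw [hc.map_smul, ← Matrix.smul_apply, ← Matrix.smul_mul, ← Matrix.mul_smul]; rfl
  rw [h1, eval01_fun_add, eval01_of_linear h2, add_zero]
  simp only [Matrix.mul_apply, eval01, Finset.mul_sum, ← Finset.sum_add_distrib, Finset.sum_div]
  refine Finset.sum_congr rfl fun i _ => ?_
  simp only [mapDer, Matrix.of_apply, delbar, eval01]
  ring

/-- The `(0,1)`-derivatives of `gam_a(W_c)`. -/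
theorem delbar_gamMat (a c : Fin (n + 1)) (y : Cn n) :
    delbar (fun w => gamMat u W w a c) z y =
      ∑ b, eval01 (conn u W a b z) y * gamMat u W z b c
      + ∑ b, eval01 (conn u W c b z) y * gamMat u W z a b
      - frameCurvUp u W z (W c z) y (Sum.inr a) (Sum.inl ()) := by
  set N : Cn n → Matrix (Fin (n + 1)) (Fin (n + 1)) ℂ := fun w =>
    Matrix.of fun i k => connH u w (stdVec k) (Sum.inr i) (Sum.inl ()) with hN
  have hc : ∀ w v A B, connH u w v A B = ∑ k, v k * connH u w (stdVec k) A B := fun w v A B => by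
    simp only [connH, Matrix.mul_apply, Finset.mul_sum]
    rw [Finset.sum_comm]
    refine Finset.sum_congr rfl fun j _ => ?_
    rw [show delH u w v A j = _ from del_eq_sum _ w v, Finset.sum_mul]
    exact Finset.sum_congr rfl fun k _ => mul_assoc _ _ _
  -- The form gam_a(W_c) is complex bilinear in the two frame vectors, so the frame matrix enters
  -- transposed and not conjugated. Its ∂̄ derivatives produce the two connection sums; the ∂̄
  -- derivative of N produces the curvature.
  have hG : ∀ w ∈ U, gamMat u W w = frameMatrix W w * N w * (frameMatrix W w)ᵀ := fun w hw => by
    ext a c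
    simp only [gamMat, Matrix.of_apply, h.gam_eq hw, hc w (W c w), Matrix.mul_apply, Finset.mul_sum,
      Matrix.transpose_apply, Finset.sum_mul, frameMatrix, hN]
    rw [Finset.sum_comm]
    exact Finset.sum_congr rfl fun k _ => Finset.sum_congr rfl fun i _ => by ring
  have hd := isDer_delbar z y
  have hF := h.smooth_frame hz
  have hF' : EntrySmoothAt (fun w => (frameMatrix W w)ᵀ) z := fun i j => hF j i
  have hNs : EntrySmoothAt N z := fun i k => h.smooth_connH hz (stdVec k) _ _
  set T : Matrix (Fin (n + 1)) (Fin (n + 1)) ℂ := Matrix.of fun a b => eval01 (conn u W a b z) y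
  have hT : mapDer (fun f => delbar f z y) (frameMatrix W) = T * frameMatrix W z := by
    have : T = mapDer (fun f => delbar f z y) (frameMatrix W) * (frameMatrix W z)⁻¹ := by
      ext a b; exact h.eval01_conn hz a b y
    rw [this, Matrix.mul_assoc, Matrix.nonsing_inv_mul _ (h.isUnit_det_frame hz), Matrix.mul_one]
  have h1 : mapDer (fun f => delbar f z y) (gamMat u W) = T * gamMat u W z + gamMat u W z * Tᵀ
      + frameMatrix W z * mapDer (fun f => delbar f z y) N * (frameMatrix W z)ᵀ := by
    rw [mapDer_congr hd ((h.eventually_mem hz).mono hG), mapDer_mul hd (hF.mul hNs).diffAt hF'.diffAt,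
      mapDer_mul hd hF.diffAt hNs.diffAt,
      show mapDer (fun f => delbar f z y) (fun w => (frameMatrix W w)ᵀ) =
        (mapDer (fun f => delbar f z y) (frameMatrix W))ᵀ from rfl, hT, hG z hz,
      Matrix.transpose_mul]
    noncomm_ring
  have hM : mapDer (fun f => delbar f z y) N =
      -Matrix.of fun i k => (curvH u z (stdVec k) y * (bordered u z)⁻¹) (Sum.inr i) (Sum.inl ()) := by
    ext i k
    exact congrFun (congrFun (mapDer_delbar_connH (h.eventually_smooth hz)
      (h.isUnit_det_bordered hz) (stdVec k) y) (Sum.inr i)) (Sum.inl ())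
  have h2 : frameCurvUp u W z (W c z) y (Sum.inr a) (Sum.inl ()) =
      -(frameMatrix W z * mapDer (fun f => delbar f z y) N * (frameMatrix W z)ᵀ) a c := by
    have hl := isLinearMap_curvH (h.smooth_fun z hz) y
    have hv : W c z = ∑ k, W c z k • stdVec k := by
      ext j; simp [stdVec, Pi.single_apply]
    have h3 : curvH u z (W c z) y = ∑ k, W c z k • curvH u z (stdVec k) y := by
      have := map_sum hl.mk' (fun k => W c z k • stdVec k) Finset.univ
      simp only [IsLinearMap.mk'_apply, hl.map_smul, ← hv] at this
      exact this
    rw [hM, Matrix.mul_neg, Matrix.neg_mul, Matrix.neg_apply, neg_neg, frameCurvUp,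
      h.extFrame_inv hz, h3, Matrix.sum_mul, Matrix.mul_apply, sum_idx]
    simp only [Matrix.fromBlocks_apply₁₁, Matrix.fromBlocks_apply₂₁, Matrix.zero_apply, mul_zero,
      Finset.sum_const_zero, add_zero, Matrix.one_apply_eq, mul_one]
    rw [Matrix.mul_apply_eq_vecMul, extFrame_inr]
    simp only [Matrix.vecMul, dotProduct, emb, sum_idx, Sum.elim_inl, Sum.elim_inr,
      Pi.zero_apply, zero_mul, Finset.sum_const_zero, zero_add, Matrix.sum_apply, Matrix.smul_mul,
      Matrix.smul_apply, smul_eq_mul, Finset.mul_sum]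
    rw [Matrix.mul_apply, Finset.sum_comm]
    refine Finset.sum_congr rfl fun k _ => ?_
    rw [Matrix.mul_apply, Finset.sum_mul]
    refine Finset.sum_congr rfl fun i _ => ?_
    simp only [Matrix.of_apply, Matrix.transpose_apply, frameMatrix]
    ring
  have h3 := congrFun (congrFun h1 a) c
  rw [h2, sub_neg_eq_add, show delbar (fun w => gamMat u W w a c) z y = _ from h3,
    Matrix.add_apply, Matrix.add_apply, Matrix.mul_apply, Matrix.mul_apply]
  simp only [T, Matrix.of_apply, Matrix.transpose_apply, mul_comm (gamMat u W z a _)]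

end IsRegularFrame

/-! ### Functions and forms vanishing on a hypersurface -/

section Tangential

variable {u : Cn n → ℝ} {z : Cn n}

/-- F is constant on the level set, so z is a constrained extremum and Lagrange multipliers make dF
a multiple of du. -/
theorem fderiv_real_eq_zero_of_tangent {F : Cn n → ℝ} (hF : ContDiffAt ℝ ∞ F z)
    (hu : ContDiffAt ℝ ∞ u z) (hdu : fderiv ℝ u z ≠ 0)
    (hv : ∀ᶠ y in 𝓝 z, u y = u z → F y = 0) {v : Cn n} (hvt : v ∈ Tangent u z) :
    fderiv ℝ F z v = 0 := by
  have hext : IsLocalExtrOn F {x | u x = u z} z := by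
    left
    have h0 := hv.self_of_nhds rfl
    exact eventually_nhdsWithin_iff.2 (hv.mono fun y hy hyu => by rw [h0, hy hyu])
  obtain ⟨a, b, hab, h⟩ := hext.exists_multipliers_of_hasStrictFDerivAt_1d
    (hu.hasStrictFDerivAt (by simp)) (hF.hasStrictFDerivAt (by simp))
  have hb : b ≠ 0 := by
    rintro rfl
    have ha : a ≠ 0 := fun ha => hab (by rw [ha]; rfl)
    simp only [zero_smul, add_zero, smul_eq_zero, ha, false_or] at h
    exact hdu h
  have h2 := congrArg (fun L => L v) h
  have h3 : fderiv ℝ u z v = 0 := hvt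
  simpa [h3, hb] using h2

theorem fderiv_eq_zero_of_tangent {F : Cn n → ℂ} (hF : ContDiffAt ℝ ∞ F z)
    (hu : ContDiffAt ℝ ∞ u z) (hdu : fderiv ℝ u z ≠ 0)
    (hv : ∀ᶠ y in 𝓝 z, u y = u z → F y = 0) {v : Cn n} (hvt : v ∈ Tangent u z) :
    fderiv ℝ F z v = 0 := by
  have hd := (ContDiffAt.diffAt hF).hasFDerivAt
  have hre := fderiv_real_eq_zero_of_tangent (F := fun y => (F y).re)
    (Complex.reCLM.contDiff.contDiffAt.comp z hF) hu hdu
    (hv.mono fun y hy h => by rw [hy h, Complex.zero_re]) hvt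
  have him := fderiv_real_eq_zero_of_tangent (F := fun y => (F y).im)
    (Complex.imCLM.contDiff.contDiffAt.comp z hF) hu hdu
    (hv.mono fun y hy h => by rw [hy h, Complex.zero_im]) hvt
  have h1 : HasFDerivAt (fun y => (F y).re) (Complex.reCLM ∘L fderiv ℝ F z) z :=
    Complex.reCLM.hasFDerivAt.comp z hd
  have h2 : HasFDerivAt (fun y => (F y).im) (Complex.imCLM ∘L fderiv ℝ F z) z :=
    Complex.imCLM.hasFDerivAt.comp z hd
  rw [h1.fderiv] at hre
  rw [h2.fderiv] at him
  exact Complex.ext hre him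

/-- A 1-form vanishing on the tangent spaces of a level set is closed along the level set. -/
theorem extD_eq_zero_of_tangent {α : Cn n → Cn n → ℂ} (hα : ∀ v, ContDiffAt ℝ ∞ (fun y => α y v) z)
    (hlin : ∀ y, IsLinearMap ℝ (α y)) (hu : ContDiffAt ℝ ∞ u z) (hdu : fderiv ℝ u z ≠ 0)
    (hv : ∀ᶠ y in 𝓝 z, u y = u z → ∀ v ∈ Tangent u y, α y v = 0) {v w : Cn n}
    (hvt : v ∈ Tangent u z) (hwt : w ∈ Tangent u z) : extD α z v w = 0 := by
  obtain ⟨N, hN⟩ : ∃ N, fderiv ℝ u z N ≠ 0 := by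
    by_contra! hc
    exact hdu (ContinuousLinearMap.ext hc)
  have hcu := contDiffAt_cx hu
  have hD : ∀ w, ContDiffAt ℝ ∞ (fun y => fderiv ℝ (cx u) y w) z :=
    fun w => contDiffAt_fderiv_apply hcu w
  have hev : ∀ᶠ y in 𝓝 z, DifferentiableAt ℝ u y :=
    ((hu.of_le (m := 1) (by simp)).eventually (by simp)).mono
      fun y hy => hy.differentiableAt (by simp)
  have hc : ∀ᶠ y in 𝓝 z, ∀ w, fderiv ℝ (cx u) y w = fderiv ℝ u y w := hev.mono fun y hy w => by
    have h : HasFDerivAt (cx u) (Complex.ofRealCLM ∘L fderiv ℝ u y) y :=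
      Complex.ofRealCLM.hasFDerivAt.comp y hy.hasFDerivAt
    rw [h.fderiv]; rfl
  have hN' : ∀ᶠ y in 𝓝 z, fderiv ℝ u y N ≠ 0 := by
    have : ContinuousAt (fun y => fderiv ℝ u y N) z :=
      ((hu.fderiv_right (m := ∞) (by simp)).clm_apply contDiffAt_const).continuousAt
    exact this.eventually_ne hN
  -- Moving w along N into the tangent space shows that α(w) du(N) - du(w) α(N) vanishes on the
  -- level set. Differentiate this along v. The difference of the two orders of v, w removes the
  -- symmetric second derivative of u.
  have key : ∀ v w, v ∈ Tangent u z → w ∈ Tangent u z → fderiv ℝ (fun y => α y w) z v *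
      fderiv ℝ (cx u) z N = fderiv ℝ (fun y => fderiv ℝ (cx u) y w) z v * α z N := by
    intro v w hvt hwt
    have hF : fderiv ℝ (fun y => α y w * fderiv ℝ (cx u) y N - fderiv ℝ (cx u) y w * α y N) z v
        = 0 := by
      refine fderiv_eq_zero_of_tangent (((hα w).mul (hD N)).sub ((hD w).mul (hα N))) hu hdu ?_ hvt
      filter_upwards [hv, hc, hN'] with y hy hcy hNy hyu
      set c : ℝ := fderiv ℝ u y w / fderiv ℝ u y N with hcdef
      have ht : w - c • N ∈ Tangent u y := by
        change fderiv ℝ u y (w - c • N) = 0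
        rw [map_sub, map_smul, smul_eq_mul, hcdef, div_mul_cancel₀ _ hNy, sub_self]
      have h1 := hy hyu _ ht
      rw [(hlin y).map_sub, (hlin y).map_smul, Complex.real_smul] at h1
      have h2 : ((c : ℝ) : ℂ) * fderiv ℝ u y N = fderiv ℝ u y w := by
        rw [← Complex.ofReal_mul, hcdef, div_mul_cancel₀ _ hNy]
      rw [hcy, hcy]
      linear_combination (fderiv ℝ u y N : ℂ) * h1 + α y N * h2
    have hd := isDer_fderiv z v
    rw [hd.sub ((hα w).mul (hD N)).diffAt ((hD w).mul (hα N)).diffAt,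
      hd.mul _ _ (hα w).diffAt (hD N).diffAt, hd.mul _ _ (hD w).diffAt (hα N).diffAt,
      hv.self_of_nhds rfl w hwt, hc.self_of_nhds w, show fderiv ℝ u z w = 0 from hwt] at hF
    push_cast at hF
    linear_combination hF
  have h1 := key v w hvt hwt
  have h2 := key w v hwt hvt
  rw [fderiv_fderiv_comm hcu v w] at h2
  have h3 : fderiv ℝ (cx u) z N ≠ 0 := by
    rw [hc.self_of_nhds]; exact_mod_cast hN
  have h4 : extD α z v w * fderiv ℝ (cx u) z N = 0 := by
    simp only [extD]
    linear_combination h1 - h2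
  simpa [h3] using h4

end Tangential

/-! ### The Tanaka-Webster connection -/

/-- The Tanaka-Webster connection forms, in terms of the renormalized connection. -/
noncomputable def twFun (u : Cn n → ℝ) (W : Fin (n + 1) → Cn n → Cn n) (β α : Fin n) (z v : Cn n) :
    ℂ :=
  conn u W β.succ α.succ z v
    - Complex.I * transverseCurvature u W z * contactForm u z v * (if β = α then 1 else 0)

/-- The Tanaka-Webster torsion, in terms of the renormalized connection. -/
noncomputable def twTorsion (u : Cn n → ℝ) (W : Fin (n + 1) → Cn n → Cn n) (α γ : Fin n)
    (z : Cn n) : ℂ :=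
  -Complex.I * ∑ β : Fin n, leviInv u W z α β * conj (gamMat u W z γ.succ β.succ)

theorem isLinearMap_contactForm (u : Cn n → ℝ) (z : Cn n) : IsLinearMap ℝ (contactForm u z) := by
  have h := isLinearMap_real (isLinearMap_del (cx u) z)
  constructor
  · intro v w
    simp only [contactForm, ← conj_del_cx, h.map_add, map_add]; ring
  · intro c v
    simp only [contactForm, ← conj_del_cx, h.map_smul, Complex.real_smul, map_mul,
      Complex.conj_ofReal]; ring

theorem isLinearMap_conn (u : Cn n → ℝ) (W : Fin (n + 1) → Cn n → Cn n) (a b : Fin (n + 1))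
    (z : Cn n) : IsLinearMap ℝ (conn u W a b z) := by
  have h1 : ∀ v w, mapDer (fd z (v + w)) (extFrame W) =
      mapDer (fd z v) (extFrame W) + mapDer (fd z w) (extFrame W) := fun v w => by
    ext A B; exact (fderiv ℝ (fun y => extFrame W y A B) z).map_add v w
  have h2 : ∀ (c : ℝ) v, mapDer (fd z (c • v)) (extFrame W) =
      (c : ℂ) • mapDer (fd z v) (extFrame W) := fun c v => by
    ext A B; exact ((fderiv ℝ (fun y => extFrame W y A B) z).map_smul c v).trans Complex.real_smul
  have hK := isLinearMap_connH u z
  constructor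
  · intro v w
    simp only [conn, extConn, gauge, h1, hK.map_add]
    rw [← Matrix.add_apply, ← Matrix.add_mul, Matrix.mul_add, add_add_add_comm]
  · intro c v
    have h3 : (c : ℝ) • v = (c : ℂ) • v := by ext i; simp
    simp only [conn, extConn, gauge, h2]
    rw [h3, hK.map_smul, Matrix.mul_smul, ← smul_add, Matrix.smul_mul, Matrix.smul_apply,
      Complex.real_smul, smul_eq_mul]

theorem isLinearMap_twFun (u : Cn n → ℝ) (W : Fin (n + 1) → Cn n → Cn n) (β α : Fin n)
    (z : Cn n) : IsLinearMap ℝ (twFun u W β α z) := by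
  have h1 := isLinearMap_conn u W β.succ α.succ z
  have h2 := isLinearMap_contactForm u z
  constructor
  · intro v w
    simp only [twFun, h1.map_add, h2.map_add]; ring
  · intro c v
    simp only [twFun, h1.map_smul, h2.map_smul, Complex.real_smul]; ring

/-- `twFun` as a function with values in the continuous linear forms. -/
noncomputable def twConn (u : Cn n → ℝ) (W : Fin (n + 1) → Cn n → Cn n) (β α : Fin n) (z : Cn n) :
    Cn n →L[ℝ] ℂ :=
  LinearMap.toContinuousLinearMap (isLinearMap_twFun u W β α z).mk'

theorem twConn_apply (u : Cn n → ℝ) (W : Fin (n + 1) → Cn n → Cn n) (β α : Fin n) (z v : Cn n) :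
    twConn u W β α z v = twFun u W β α z v := rfl

theorem smooth_contactForm {u : Cn n → ℝ} {z : Cn n} (hu : ContDiffAt ℝ ∞ u z) (v : Cn n) :
    ContDiffAt ℝ ∞ (fun y => contactForm u y v) z :=
  contDiffAt_const.mul ((contDiffAt_delbar (contDiffAt_cx hu) v).sub
    (contDiffAt_del (contDiffAt_cx hu) v))

theorem twFun_of_del_eq_zero {u : Cn n → ℝ} {z v : Cn n} (W : Fin (n + 1) → Cn n → Cn n)
    (hv : del (cx u) z v = 0) (β α : Fin n) :
    twFun u W β α z v = conn u W β.succ α.succ z v := by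
  simp [twFun, contactForm_of_del_eq_zero hv]

theorem cx_eq_zero {u : Cn n → ℝ} {z : Cn n} (h0 : u z = 0) : cx u z = 0 := by simp [cx, h0]

namespace IsRegularFrame

variable {u : Cn n → ℝ} {U : Set (Cn n)} {W : Fin (n + 1) → Cn n → Cn n} {z : Cn n}
  (h : IsRegularFrame u U W) (hz : z ∈ U)
include h hz

theorem fderiv_ne_zero : fderiv ℝ u z ≠ 0 := fun h0 => by
  have h1 : ∀ v, del (cx u) z v = 0 := fun v => by
    simp [del, eval10, fderiv_cx (h.smooth_fun z hz), h0]
  have := h.xi_normalized z hz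
  rw [h1] at this
  exact zero_ne_one this

theorem smooth_leviInv (α β : Fin n) : ContDiffAt ℝ ∞ (fun y => leviInv u W y α β) z :=
  (h.smooth_levi hz).inv (h.isUnit_det_levi hz) β α

theorem smooth_gamMat : EntrySmoothAt (gamMat u W) z := fun a c => by
  have h1 : (fun y => gamMat u W y a c) =ᶠ[𝓝 z] fun y => ∑ k, W c y k * gam u W a y (stdVec k) := by
    filter_upwards [h.eventually_mem hz] with y hy
    have hl := h.isLinearMap_gam hy a
    have hv : W c y = ∑ k, W c y k • stdVec k := by
      ext j; simp [stdVec, Pi.single_apply]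
    have := map_sum hl.mk' (fun k => W c y k • stdVec k) Finset.univ
    simp only [IsLinearMap.mk'_apply, hl.map_smul, ← hv, smul_eq_mul] at this
    exact this
  refine ContDiffAt.congr_of_eventuallyEq ?_ h1
  exact ContDiffAt.sum fun k _ => (h.smooth_frame hz c k).mul (h.smooth_gam hz a _)

theorem smooth_twFun (β α : Fin n) (v : Cn n) : ContDiffAt ℝ ∞ (fun y => twFun u W β α y v) z :=
  (h.smooth_conn hz _ _ v).sub (((contDiffAt_const.mul (h.smooth_transverseCurvature hz)).mul
    (smooth_contactForm (h.smooth_fun z hz) v)).mul contDiffAt_const)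

theorem smooth_twTorsion (α γ : Fin n) : ContDiffAt ℝ ∞ (twTorsion u W α γ) z :=
  contDiffAt_const.mul (ContDiffAt.sum fun β _ => (h.smooth_leviInv hz α β).mul
    (Complex.conjCLE.contDiff.contDiffAt.comp z (h.smooth_gamMat hz _ _)))

theorem smooth_twConn (β α : Fin n) : ContDiffAt ℝ ∞ (twConn u W β α) z := by
  have : ContDiffOn ℝ ∞ (twConn u W β α) U := contDiffOn_clm_apply.2 fun v y hy =>
    (h.smooth_twFun hy β α v).contDiffWithinAt
  exact this.contDiffAt (h.isOpen.mem_nhds hz)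

omit hz in
theorem del_cx_I_smul_succ {z : Cn n} (hz : z ∈ U) (α : Fin n) :
    del (cx u) z (Complex.I • W α.succ z) = 0 := by
  rw [(isLinearMap_del _ _).map_smul, h.ker z hz, smul_zero]

/-! ### The connection restricted to u = 0 -/

section Boundary

variable (h0 : u z = 0)
include h0

omit h0 in
theorem conj_coframe_zero {v : Cn n} (hv : v ∈ Tangent u z) :
    conj (del (cx u) z v) = -(Complex.I * contactForm u z v) := by
  rw [del_cx_of_tangent (h.smooth_fun z hz) hv, map_mul, Complex.conj_I, conj_contactForm]; ring

theorem conn_zero_zero_tangent {v : Cn n} (hv : v ∈ Tangent u z) :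
    conn u W 0 0 z v = Complex.I * transverseCurvature u W z * contactForm u z v := by
  rw [h.conn_zero_zero hz, cx_eq_zero h0, h.conj_coframe_zero hz hv]; ring

theorem conn_succ_zero_boundary (β : Fin n) (v : Cn n) : conn u W β.succ 0 z v =
    -∑ γ : Fin n, levi u W z β γ * conj (coframe W γ.succ z v) := by
  rw [h.conn_succ_zero hz, cx_eq_zero h0]; ring

omit h0 in
theorem gam_tangent {v : Cn n} (hv : v ∈ Tangent u z) (a : Fin (n + 1)) : gam u W a z v =
    Complex.I * contactForm u z v * gamMat u W z a 0
      + ∑ γ : Fin n, coframe W γ.succ z v * gamMat u W z a γ.succ := by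
  rw [h.gam_eq_sum hz, Fin.sum_univ_succ, h.coframe_zero hz,
    del_cx_of_tangent (h.smooth_fun z hz) hv]

omit h0 in
theorem sum_twTorsion_mul_levi (γ β : Fin n) : ∑ α, twTorsion u W α γ z * levi u W z α β =
    -Complex.I * conj (gamMat u W z γ.succ β.succ) := by
  simp only [twTorsion, mul_assoc, Finset.sum_mul, ← Finset.mul_sum]
  rw [Finset.sum_comm]
  have h1 : ∀ ν, ∑ α, leviInv u W z α ν * (conj (gamMat u W z γ.succ ν.succ) * levi u W z α β) =
      conj (gamMat u W z γ.succ ν.succ) * if ν = β then 1 else 0 := fun ν => by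
    have := congrFun (congrFun (Matrix.nonsing_inv_mul _ (h.isUnit_det_levi hz)) ν) β
    rw [Matrix.one_apply, Matrix.mul_apply] at this
    rw [← this, Finset.mul_sum]
    exact Finset.sum_congr rfl fun α _ => by simp only [leviInv]; ring
  simp [h1]

/-- Lower α with h and use compatibility of ξ with W_β. The conjugate of `gam` splits along θ^γ̄ and
θ into the torsion term and the future Scal^α term; the product of r with θ_β^0 gives r θ^α. -/
theorem conn_zero_succ_tangent {v : Cn n} (hv : v ∈ Tangent u z) (α : Fin n) :
    conn u W 0 α.succ z v = transverseCurvature u W z * coframe W α.succ z v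
      - Complex.I * ∑ γ : Fin n, twTorsion u W α γ z * conj (coframe W γ.succ z v)
      + Complex.I * contactForm u z v *
        ∑ β : Fin n, leviInv u W z α β * conj (gamMat u W z 0 β.succ) := by
  have h1 : ∀ β, ∑ γ : Fin n, conn u W 0 γ.succ z v * levi u W z γ β =
      -conj (gam u W β.succ z v)
        + transverseCurvature u W z * ∑ γ : Fin n, coframe W γ.succ z v * levi u W z γ β := by
    intro β
    rw [h.sum_conn_zero_mul_levi hz, h.conn_succ_zero_boundary hz h0, map_neg, map_sum]
    simp only [map_mul, h.conj_levi hz, Complex.conj_conj, mul_comm (levi u W z _ β)]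
    ring
  rw [h.sum_mul_levi hz _ _ h1 α]
  have h2 : coframe W α.succ z v =
      ∑ β, leviInv u W z α β * ∑ γ : Fin n, coframe W γ.succ z v * levi u W z γ β :=
    h.sum_mul_levi hz (fun γ => coframe W γ.succ z v) _ (fun β => rfl) α
  conv_rhs => rw [h2]
  simp only [twTorsion, Finset.mul_sum, Finset.sum_mul]
  have hcomm : ∀ f : Fin n → Fin n → ℂ, ∑ γ, ∑ β, f γ β = ∑ β, ∑ γ, f γ β :=
    fun f => Finset.sum_comm
  rw [hcomm (fun γ β => Complex.I * (-Complex.I * (leviInv u W z α β *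
    conj (gamMat u W z γ.succ β.succ)) * conj (coframe W γ.succ z v))),
    ← Finset.sum_sub_distrib, ← Finset.sum_add_distrib]
  refine Finset.sum_congr rfl fun β _ => ?_
  have h3 : conj (gam u W β.succ z v) = -Complex.I * contactForm u z v * conj (gamMat u W z 0 β.succ)
      + ∑ γ : Fin n, conj (coframe W γ.succ z v) * conj (gamMat u W z γ.succ β.succ) := by
    rw [h.gam_tangent hz hv, map_add, map_mul, map_mul, Complex.conj_I, conj_contactForm, map_sum,
      h.gamMat_symm hz β.succ 0]
    simp only [map_mul, h.gamMat_symm hz β.succ _]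
  rw [h3, mul_add, mul_neg, mul_add]
  simp only [Finset.mul_sum]
  have h4 : ∀ γ : Fin n, Complex.I * (-Complex.I * (leviInv u W z α β *
      conj (gamMat u W z γ.succ β.succ)) * conj (coframe W γ.succ z v)) =
      leviInv u W z α β * (conj (coframe W γ.succ z v) * conj (gamMat u W z γ.succ β.succ)) :=
    fun γ => by
      linear_combination (-(leviInv u W z α β * (conj (coframe W γ.succ z v) *
        conj (gamMat u W z γ.succ β.succ)))) * Complex.I_mul_I
  have h5 : ∀ γ : Fin n, leviInv u W z α β *
      (transverseCurvature u W z * (coframe W γ.succ z v * levi u W z γ β)) =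
      transverseCurvature u W z * (leviInv u W z α β * (coframe W γ.succ z v * levi u W z γ β)) :=
    fun γ => by ring
  rw [Finset.sum_congr rfl fun γ _ => h4 γ, Finset.sum_congr rfl fun γ _ => h5 γ]
  ring

/-- On TM the form θ_0^0 = i r θ is imaginary, so its contribution cancels against its conjugate. -/
theorem fderiv_transverseCurvature_tangent {v : Cn n} (hv : v ∈ Tangent u z) :
    fderiv ℝ (transverseCurvature u W) z v = gam u W 0 z v + conj (gam u W 0 z v) := by
  rw [h.fderiv_transverseCurvature hz, h.conn_zero_zero_tangent hz h0 hv]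
  simp only [map_add, map_mul, Complex.conj_I, h.conj_transverseCurvature hz, conj_contactForm]
  ring

/-- The form gam_0 is complex linear, so its conjugate drops out of the (1,0) derivative. -/
theorem del_transverseCurvature (β : Fin n) :
    del (transverseCurvature u W) z (W β.succ z) = gamMat u W z 0 β.succ := by
  have hl := h.isLinearMap_gam hz 0
  have h1 := h.fderiv_transverseCurvature_tangent hz h0
    (mem_tangent_of_del_eq_zero (h.smooth_fun z hz) (h.ker z hz β))
  have h2 := h.fderiv_transverseCurvature_tangent hz h0
    (mem_tangent_of_del_eq_zero (h.smooth_fun z hz) (h.del_cx_I_smul_succ hz β))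
  rw [hl.map_smul, smul_eq_mul, map_mul, Complex.conj_I] at h2
  simp only [del, eval10, h1, h2, gamMat, Matrix.of_apply]
  linear_combination (-(gam u W 0 z (W β.succ z)) / 2
    + conj (gam u W 0 z (W β.succ z)) / 2) * Complex.I_mul_I

/-- In dθ^α = θ^a ∧ θ_a^α the term a = 0 is iθ ∧ θ_0^α. Its part r θ^α is absorbed by the shift -i r
θ δ in `twFun`, its part along θ dies by θ ∧ θ = 0, and its θ^γ̄ part is the torsion term. -/
theorem structure_eq_tangent (α : Fin n) {v w : Cn n} (hv : v ∈ Tangent u z)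
    (hw : w ∈ Tangent u z) : extD (coframe W α.succ) z v w =
      ∑ β : Fin n, wedge (coframe W β.succ) (fun y x => twConn u W β α y x) z v w +
      ∑ β : Fin n, twTorsion u W α β z *
        wedge (contactForm u) (conjForm (coframe W β.succ)) z v w := by
  rw [h.extD_coframe hz, Fin.sum_univ_succ]
  have h1 : ∀ β : Fin n, wedge (coframe W β.succ) (conn u W β.succ α.succ) z v w =
      wedge (coframe W β.succ) (fun y x => twConn u W β α y x) z v w
      + Complex.I * transverseCurvature u W z * (if β = α then
        wedge (coframe W β.succ) (contactForm u) z v w else 0) := fun β => by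
    simp only [wedge, twConn_apply, twFun]
    split_ifs <;> ring
  rw [Finset.sum_congr rfl fun β _ => h1 β, Finset.sum_add_distrib, ← Finset.mul_sum,
    Finset.sum_ite_eq' Finset.univ α, if_pos (Finset.mem_univ α)]
  have h2 : ∑ β : Fin n, twTorsion u W α β z *
      wedge (contactForm u) (conjForm (coframe W β.succ)) z v w =
      contactForm u z v * ∑ γ : Fin n, twTorsion u W α γ z * conj (coframe W γ.succ z w)
      - contactForm u z w * ∑ γ : Fin n, twTorsion u W α γ z * conj (coframe W γ.succ z v) := by
    simp only [wedge, conjForm, Finset.mul_sum, ← Finset.sum_sub_distrib]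
    exact Finset.sum_congr rfl fun γ _ => by ring
  rw [h2]
  simp only [wedge, h.coframe_zero hz, del_cx_of_tangent (h.smooth_fun z hz) hv,
    del_cx_of_tangent (h.smooth_fun z hz) hw, h.conn_zero_succ_tangent hz h0 hv,
    h.conn_zero_succ_tangent hz h0 hw]
  linear_combination (contactForm u z w * (∑ γ : Fin n, twTorsion u W α γ z *
    conj (coframe W γ.succ z v)) - contactForm u z v * (∑ γ : Fin n, twTorsion u W α γ z *
    conj (coframe W γ.succ z w))) * Complex.I_mul_I

omit h0 in
-- The shift by -i r θ δ is an imaginary multiple of the identity, hence does not affect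
-- compatibility with h.
theorem metric_eq (α β : Fin n) (v : Cn n) : fderiv ℝ (fun y => levi u W y α β) z v =
    ∑ γ, twConn u W α γ z v * levi u W z γ β + ∑ γ, levi u W z α γ * conj (twConn u W β γ z v) := by
  rw [h.fderiv_levi hz]
  simp only [twConn_apply, twFun, sub_mul, map_sub, mul_sub, Finset.sum_sub_distrib, map_mul,
    Complex.conj_I, h.conj_transverseCurvature hz, conj_contactForm, apply_ite conj,
    map_zero, mul_ite, ite_mul, mul_zero, zero_mul, mul_one, Finset.sum_ite_eq, Finset.mem_univ,
    if_true]
  ring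

end Boundary

end IsRegularFrame

/-- The Tanaka-Webster connection exists. -/
theorem IsRegularFrame.isTanakaWebster {u : Cn n → ℝ} {U M : Set (Cn n)}
    {W : Fin (n + 1) → Cn n → Cn n} (h : IsRegularFrame u U W)
    (hM : ∀ z ∈ M, z ∈ U ∧ u z = 0) : IsTanakaWebster u M W (twConn u W) (twTorsion u W) where
  smooth_connection α β z hz := h.smooth_twConn (hM z hz).1 α β
  smooth_torsion α β z hz := h.smooth_twTorsion (hM z hz).1 α β
  structure_eq α z hz _ hv _ hw := h.structure_eq_tangent (hM z hz).1 (hM z hz).2 α hv hw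
  metric_eq α β z hz v _ := h.metric_eq (hM z hz).1 α β v

/-! ### Uniqueness of the Tanaka-Webster connection -/

section Unique

variable {u : Cn n → ℝ} {U M : Set (Cn n)} {W : Fin (n + 1) → Cn n → Cn n} {z : Cn n}
  (h : IsRegularFrame u U W)

include h in
theorem IsRegularFrame.tangent_decomposition (hz : z ∈ U) {v : Cn n} (hv : v ∈ Tangent u z) :
    del (cx u) z (v - contactForm u z v • (Complex.I • W 0 z)) = 0 := by
  have hl := isLinearMap_del (cx u) z
  rw [hl.map_sub, hl.map_smul, hl.map_smul, h.xi_normalized z hz,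
    del_cx_of_tangent (h.smooth_fun z hz) hv]
  simp only [smul_eq_mul]; ring

include h in
-- ∂u(iξ) = i is imaginary, so du(iξ) = 0. The vector iξ supplies the Reeb direction of TM,
-- complementary to Ker ∂u.
theorem IsRegularFrame.reeb_mem_tangent (hz : z ∈ U) : Complex.I • W 0 z ∈ Tangent u z := by
  have h1 := fderiv_eq_del_add_delbar (cx u) z (Complex.I • W 0 z)
  rw [fderiv_cx (h.smooth_fun z hz), ← conj_del_cx, (isLinearMap_del _ _).map_smul,
    h.xi_normalized z hz] at h1
  simp only [smul_eq_mul, mul_one, Complex.conj_I, add_neg_cancel] at h1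
  exact_mod_cast h1

include h in
theorem IsRegularFrame.contactForm_reeb (hz : z ∈ U) :
    contactForm u z (Complex.I • W 0 z) = 1 := by
  have h1 := del_cx_of_tangent (h.smooth_fun z hz) (h.reeb_mem_tangent hz)
  rw [(isLinearMap_del _ _).map_smul, h.xi_normalized z hz, smul_eq_mul, mul_one] at h1
  have := congrArg (fun t => -Complex.I * t) h1
  simp only [neg_mul, ← mul_assoc, Complex.I_mul_I] at this
  simpa using this.symm

include h in
/-- Real-linear forms satisfying the homogeneous Tanaka-Webster equations vanish. -/
theorem IsRegularFrame.eq_zero_of_homogeneous (hz : z ∈ U) {e : Fin n → Fin n → Cn n → ℂ}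
    {B : Fin n → Fin n → ℂ} (he : ∀ α β, IsLinearMap ℝ (e α β))
    (hs : ∀ α, ∀ v ∈ Tangent u z, ∀ w ∈ Tangent u z,
      ∑ β : Fin n, (coframe W β.succ z v * e β α w - coframe W β.succ z w * e β α v) +
      ∑ β : Fin n, B α β * (contactForm u z v * conj (coframe W β.succ z w)
        - contactForm u z w * conj (coframe W β.succ z v)) = 0)
    (hm : ∀ α β, ∀ v ∈ Tangent u z,
      ∑ γ, e α γ v * levi u W z γ β + ∑ γ, levi u W z α γ * conj (e β γ v) = 0) :
    (∀ α β, ∀ v ∈ Tangent u z, e α β v = 0) ∧ ∀ α β, B α β = 0 := by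
  have hu := h.smooth_fun z hz
  have hl := isLinearMap_del (cx u) z
  have hI : ∀ {v}, del (cx u) z v = 0 → del (cx u) z (Complex.I • v) = 0 := fun {v} hv => by
    rw [hl.map_smul, hv, smul_zero]
  have ht : ∀ {v}, del (cx u) z v = 0 → v ∈ Tangent u z := mem_tangent_of_del_eq_zero hu
  have hX := h.ker z hz
  have hcX : ∀ β μ : Fin n, coframe W β.succ z (W μ.succ z) = if μ = β then 1 else 0 := fun β μ => by
    rw [h.coframe_frame hz]; simp
  have hcIX : ∀ β μ : Fin n, coframe W β.succ z (Complex.I • W μ.succ z) =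
      if μ = β then Complex.I else 0 := fun β μ => by
    rw [(isLinearMap_coframe W _ z).map_smul, hcX]; simp
  -- Pair W_μ with a horizontal y: θ vanishes on both, so the torsion sum disappears, and the
  -- equation makes e complex linear on Ker ∂u.
  have h1 : ∀ μ α y, del (cx u) z y = 0 →
      e μ α y = ∑ β : Fin n, coframe W β.succ z y * e β α (W μ.succ z) := by
    intro μ α y hy
    have := hs α _ (ht (hX μ)) y (ht hy)
    simp only [hcX, contactForm_of_del_eq_zero (hX μ), contactForm_of_del_eq_zero hy, zero_mul,
      sub_zero, mul_zero, Finset.sum_const_zero, add_zero, Finset.sum_sub_distrib, ite_mul, one_mul,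
      Finset.sum_ite_eq, Finset.mem_univ, if_true] at this
    exact sub_eq_zero.1 this
  have h2 : ∀ μ α y, del (cx u) z y = 0 → e μ α (Complex.I • y) = Complex.I * e μ α y := by
    intro μ α y hy
    rw [h1 μ α _ (hI hy), h1 μ α y hy, Finset.mul_sum]
    refine Finset.sum_congr rfl fun β _ => ?_
    rw [(isLinearMap_coframe W _ z).map_smul, smul_eq_mul, mul_assoc]
  -- In the metric equation the first sum is complex linear in y and the second antilinear;
  -- comparing y with iy makes each vanish separately.
  have h3 : ∀ α β y, del (cx u) z y = 0 → e α β y = 0 := by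
    intro α β y hy
    have : (fun γ => e α γ y) = fun _ => 0 := h.eq_of_sum_mul_levi hz fun β => by
      have e1 := hm α β y (ht hy)
      have e2 := hm α β _ (ht (hI hy))
      simp only [h2 _ _ _ hy, map_mul, Complex.conj_I] at e2
      have e3 : ∑ γ, Complex.I * e α γ y * levi u W z γ β =
          Complex.I * ∑ γ, e α γ y * levi u W z γ β := by
        rw [Finset.mul_sum]; exact Finset.sum_congr rfl fun _ _ => by ring
      have e4 : ∑ γ, levi u W z α γ * (-Complex.I * conj (e β γ y)) =
          -Complex.I * ∑ γ, levi u W z α γ * conj (e β γ y) := by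
        rw [Finset.mul_sum]; exact Finset.sum_congr rfl fun _ _ => by ring
      rw [e3, e4] at e2
      simp only [zero_mul, Finset.sum_const_zero]
      linear_combination e1 / 2 - Complex.I / 2 * e2 + (∑ γ, e α γ y * levi u W z γ β
        - ∑ γ, levi u W z α γ * conj (e β γ y)) / 2 * Complex.I_mul_I
    exact congrFun this β
  have hT := h.reeb_mem_tangent hz
  have hcT : ∀ β : Fin n, coframe W β.succ z (Complex.I • W 0 z) = 0 := fun β => by
    rw [(isLinearMap_coframe W _ z).map_smul, h.coframe_frame hz]; simp [(Fin.succ_ne_zero β).symm]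
  -- Pair the Reeb vector with W_μ and with iW_μ. The conjugated coframe changes the sign of B, so e
  -- - B = 0 and e + B = 0.
  have h4 : ∀ μ α, e μ α (Complex.I • W 0 z) - B α μ = 0 := fun μ α => by
    have := hs α _ (ht (hX μ)) _ hT
    simpa [hcX, hcT, contactForm_of_del_eq_zero (hX μ), h.contactForm_reeb hz, sub_eq_add_neg,
      apply_ite conj] using this
  have h5 : ∀ μ α, Complex.I * e μ α (Complex.I • W 0 z) + B α μ * Complex.I = 0 := fun μ α => by
    have := hs α _ (ht (hI (hX μ))) _ hT
    simpa [hcIX, hcT, contactForm_of_del_eq_zero (hI (hX μ)), h.contactForm_reeb hz, sub_eq_add_neg,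
      apply_ite conj] using this
  have h6 : ∀ μ α, e μ α (Complex.I • W 0 z) = 0 := fun μ α => by
    linear_combination h4 μ α / 2 - Complex.I / 2 * h5 μ α + (e μ α (Complex.I • W 0 z)
      + B α μ) / 2 * Complex.I_mul_I
  refine ⟨fun α β v hv => ?_, fun α β => by linear_combination h6 β α - h4 β α⟩
  have h7 := h3 α β _ (h.tangent_decomposition hz hv)
  have h8 : contactForm u z v • (Complex.I • W 0 z) =
      (contactForm u z v).re • (Complex.I • W 0 z) := by
    have : ((contactForm u z v).re : ℂ) = contactForm u z v :=
      Complex.conj_eq_iff_re.1 (conj_contactForm u z v)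
    conv_lhs => rw [← this]
    ext i; simp
  rw [h8, (he α β).map_sub, (he α β).map_smul, h6, smul_zero, sub_zero] at h7
  exact h7

include h in
theorem IsRegularFrame.tanakaWebster_unique (hM : ∀ z ∈ M, z ∈ U ∧ u z = 0)
    {om om' : Fin n → Fin n → Cn n → (Cn n →L[ℝ] ℂ)} {A A' : Fin n → Fin n → Cn n → ℂ}
    (h1 : IsTanakaWebster u M W om A) (h2 : IsTanakaWebster u M W om' A') (hz : z ∈ M) :
    (∀ α β, ∀ v ∈ Tangent u z, om α β z v = om' α β z v) ∧ ∀ α β, A α β z = A' α β z := by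
  have key := h.eq_zero_of_homogeneous (hM z hz).1 (e := fun α β v => om α β z v - om' α β z v)
    (B := fun α β => A α β z - A' α β z)
    (fun α β => ⟨fun v w => by simp only [map_add]; ring,
      fun c v => by simp only [map_smul, smul_sub]⟩)
    (fun α v hv w hw => by
      have e1 := h1.structure_eq α z hz v hv w hw
      have e2 := h2.structure_eq α z hz v hv w hw
      rw [e2] at e1
      simp only [wedge, conjForm] at e1
      have e3 : ∑ β : Fin n, (coframe W β.succ z v * (om β α z w - om' β α z w)
            - coframe W β.succ z w * (om β α z v - om' β α z v)) =
          ∑ β : Fin n, (coframe W β.succ z v * om β α z w - coframe W β.succ z w * om β α z v)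
          - ∑ β : Fin n, (coframe W β.succ z v * om' β α z w
            - coframe W β.succ z w * om' β α z v) := by
        rw [← Finset.sum_sub_distrib]; exact Finset.sum_congr rfl fun _ _ => by ring
      have e4 : ∑ β : Fin n, (A α β z - A' α β z) * (contactForm u z v *
            conj (coframe W β.succ z w) - contactForm u z w * conj (coframe W β.succ z v)) =
          ∑ β : Fin n, A α β z * (contactForm u z v * conj (coframe W β.succ z w)
            - contactForm u z w * conj (coframe W β.succ z v))
          - ∑ β : Fin n, A' α β z * (contactForm u z v * conj (coframe W β.succ z w)
            - contactForm u z w * conj (coframe W β.succ z v)) := by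
        rw [← Finset.sum_sub_distrib]; exact Finset.sum_congr rfl fun _ _ => by ring
      rw [e3, e4]
      simp only [mul_comm (contactForm u z w)] at e1 ⊢
      linear_combination -e1)
    (fun α β v hv => by
      have e1 := h1.metric_eq α β z hz v hv
      have e2 := h2.metric_eq α β z hz v hv
      rw [e2] at e1
      simp only [sub_mul, map_sub, mul_sub, Finset.sum_sub_distrib]
      linear_combination -e1)
  exact ⟨fun α β v hv => sub_eq_zero.1 (key.1 α β v hv), fun α β => sub_eq_zero.1 (key.2 α β)⟩

end Unique

/-! ### Smoothness of the curvature and change of the connection forms -/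

section Smooth

variable {u : Cn n → ℝ} {U M : Set (Cn n)} {W : Fin (n + 1) → Cn n → Cn n} {z : Cn n}
  {om om' : Fin n → Fin n → Cn n → (Cn n →L[ℝ] ℂ)}

theorem eventually_fderiv_clm {f : Cn n → (Cn n →L[ℝ] ℂ)} (hf : ContDiffAt ℝ ∞ f z) :
    ∀ᶠ y in 𝓝 z, ∀ v w, fderiv ℝ (fun y' => f y' w) y v = fderiv ℝ f y v w := by
  filter_upwards [(hf.of_le (m := 1) (by simp)).eventually (by simp)] with y hy v w
  rw [fderiv_clm_apply (hy.differentiableAt (by simp)) (differentiableAt_const w)]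
  simp

theorem smooth_twCurvatureForm (hom : ∀ α β, ContDiffAt ℝ ∞ (om α β) z) (α β : Fin n)
    {X Y : Cn n → Cn n} (hX : ContDiffAt ℝ ∞ X z) (hY : ContDiffAt ℝ ∞ Y z) :
    ContDiffAt ℝ ∞ (fun y => twCurvatureForm om α β y (X y) (Y y)) z := by
  have hd := (hom α β).fderiv_right (m := ∞) (by simp)
  have h1 : ContDiffAt ℝ ∞ (fun y => fderiv ℝ (om α β) y (X y) (Y y)
      - fderiv ℝ (om α β) y (Y y) (X y) - ∑ γ, (om α γ y (X y) * om γ β y (Y y)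
        - om α γ y (Y y) * om γ β y (X y))) z :=
    (((hd.clm_apply hX).clm_apply hY).sub ((hd.clm_apply hY).clm_apply hX)).sub
      (ContDiffAt.sum fun γ _ => (((hom α γ).clm_apply hX).mul ((hom γ β).clm_apply hY)).sub
        (((hom α γ).clm_apply hY).mul ((hom γ β).clm_apply hX)))
  refine h1.congr_of_eventuallyEq ?_
  filter_upwards [eventually_fderiv_clm (hom α β)] with y hy
  simp only [twCurvatureForm, extD, wedge, hy]

theorem smooth_curvUp (hom : ∀ α β, ContDiffAt ℝ ∞ (om α β) z)
    (hW : ∀ a, ContDiffAt ℝ ∞ (W a) z) (α β γ δ : Fin n) :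
    ContDiffAt ℝ ∞ (curvUp W om α β γ δ) z := by
  have hI : ∀ a, ContDiffAt ℝ ∞ (fun y => Complex.I • W a y) z := fun a =>
    (hW a).const_smul Complex.I
  have hs := fun {X Y : Cn n → Cn n} (hX : ContDiffAt ℝ ∞ X z) (hY : ContDiffAt ℝ ∞ Y z) =>
    smooth_twCurvatureForm hom α β hX hY
  exact ((((hs (hW _) (hW _)).add (contDiffAt_const.mul (hs (hW _) (hI _)))).div_const 2).sub
    (contDiffAt_const.mul (((hs (hI _) (hW _)).add
      (contDiffAt_const.mul (hs (hI _) (hI _)))).div_const 2))).div_const 2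

theorem IsRegularFrame.smooth_scal (h : IsRegularFrame u U W) (hz : z ∈ U)
    (hom : ∀ α β, ContDiffAt ℝ ∞ (om α β) z) : ContDiffAt ℝ ∞ (scal u W om) z := by
  have hW : ∀ a, ContDiffAt ℝ ∞ (W a) z := fun a =>
    (h.smooth a).contDiffAt (h.isOpen.mem_nhds hz)
  exact ContDiffAt.sum fun γ _ => ContDiffAt.sum fun δ _ => (h.smooth_leviInv hz γ δ).mul
    (ContDiffAt.sum fun α _ => smooth_curvUp hom hW α α γ δ)

/-- The connection forms are arbitrary off M. The difference of two choices vanishes on the tangent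
spaces of the level set, and so does its exterior derivative there. -/
theorem twCurvatureForm_congr_of_tangent (hom : ∀ α β, ContDiffAt ℝ ∞ (om α β) z)
    (hom' : ∀ α β, ContDiffAt ℝ ∞ (om' α β) z) (hu : ContDiffAt ℝ ∞ u z)
    (hdu : fderiv ℝ u z ≠ 0)
    (heq : ∀ᶠ y in 𝓝 z, u y = u z → ∀ α β, ∀ v ∈ Tangent u y, om α β y v = om' α β y v)
    (α β : Fin n) {v w : Cn n} (hv : v ∈ Tangent u z) (hw : w ∈ Tangent u z) :
    twCurvatureForm om α β z v w = twCurvatureForm om' α β z v w := by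
  have hs : ∀ v, ContDiffAt ℝ ∞ (fun y => om α β y v) z := fun v =>
    (hom α β).clm_apply contDiffAt_const
  have hs' : ∀ v, ContDiffAt ℝ ∞ (fun y => om' α β y v) z := fun v =>
    (hom' α β).clm_apply contDiffAt_const
  have h1 : extD (fun y x => om α β y x - om' α β y x) z v w = 0 :=
    extD_eq_zero_of_tangent (fun v => (hs v).sub (hs' v))
      (fun y => ⟨fun v w => by simp only [map_add]; ring,
        fun c v => by simp only [map_smul, smul_sub]⟩) hu hdu
      (heq.mono fun y hy hyu v hv => sub_eq_zero.2 (hy hyu α β v hv)) hv hw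
  have h2 : extD (fun y x => om α β y x) z v w = extD (fun y x => om' α β y x) z v w := by
    simp only [extD] at h1 ⊢
    rw [(isDer_fderiv z v).sub (hs w).diffAt (hs' w).diffAt,
      (isDer_fderiv z w).sub (hs v).diffAt (hs' v).diffAt] at h1
    linear_combination h1
  have h3 := heq.self_of_nhds rfl
  simp only [twCurvatureForm, h2, wedge, h3 _ _ v hv, h3 _ _ w hw]

end Smooth

/-! ### The curvature on the boundary -/

theorem eval11_of_sesquilinear {f : Cn n → Cn n → ℂ}
    (h1 : ∀ x y, f (Complex.I • x) y = Complex.I * f x y)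
    (h2 : ∀ x y, f x (Complex.I • y) = -Complex.I * f x y) (v w : Cn n) :
    eval11 f v w = f v w := by
  simp only [eval11, eval10, eval01, h1, h2]
  linear_combination (f v w * (Complex.I * Complex.I - 3) / 4) * Complex.I_mul_I

theorem eval11_swap_of_sesquilinear {f : Cn n → Cn n → ℂ}
    (h1 : ∀ x y, f (Complex.I • x) y = Complex.I * f x y)
    (h2 : ∀ x y, f x (Complex.I • y) = -Complex.I * f x y) (v w : Cn n) :
    eval11 (fun x y => f y x) v w = 0 := by
  simp only [eval11, eval10, eval01, h1, h2]
  linear_combination (f w v * (1 + Complex.I * Complex.I) / 4) * Complex.I_mul_I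

theorem del_delbar_cx (u : Cn n → ℝ) {z : Cn n} (hu : ContDiffAt ℝ ∞ u z) (v w : Cn n) :
    del (fun y => delbar (cx u) y w) z v = leviForm u z v w := by
  have hs := fun v => (contDiffAt_delbar (contDiffAt_cx hu) v)
  have h1 : (fun y => delbar (cx u) y w) =
      fun y => ∑ j, conj (w j) * delbar (cx u) y (stdVec j) := by
    ext y; exact delbar_eq_sum _ y w
  have hd := isDer_del z v
  rw [h1, hd.sum _ _ fun j _ => (differentiableAt_const _).fun_mul (hs _).diffAt, leviForm,
    Finset.sum_comm]
  refine Finset.sum_congr rfl fun j _ => ?_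
  rw [hd.const_mul _ (hs _).diffAt, del_eq_sum, Finset.mul_sum]
  refine Finset.sum_congr rfl fun i _ => ?_
  simp only [hess, Matrix.of_apply]
  ring

/-- The second derivatives of pure type cancel by symmetry, and what remains is dθ = i ∂∂̄u. -/
theorem extD_contactForm {u : Cn n → ℝ} {z : Cn n} (hu : ContDiffAt ℝ ∞ u z) (v w : Cn n) :
    extD (contactForm u) z v w = Complex.I * (leviForm u z v w - leviForm u z w v) := by
  have hc := contDiffAt_cx hu
  have h1 : ∀ v w, fderiv ℝ (fun y => contactForm u y w) z v = Complex.I / 2 *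
      (fderiv ℝ (fun y => delbar (cx u) y w) z v - fderiv ℝ (fun y => del (cx u) y w) z v) :=
    fun v w => by
      have hd := isDer_fderiv z v
      simp only [contactForm]
      rw [hd.const_mul _ ((contDiffAt_delbar hc w).diffAt.fun_sub (contDiffAt_del hc w).diffAt),
        hd.sub (contDiffAt_delbar hc w).diffAt (contDiffAt_del hc w).diffAt]
  have h2 : ∀ v w, delbar (fun y => delbar (cx u) y w) z v =
      conj (del (fun y => del (cx u) y w) z v) := fun v w => by
    rw [← delbar_conj]; simp only [conj_del_cx]
  simp only [extD, h1, fderiv_eq_del_add_delbar (fun y => delbar (cx u) y _),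
    fderiv_eq_del_add_delbar (fun y => del (cx u) y _), delbar_del_comm hc, del_delbar_cx u hu, h2,
    del_del_comm hc w v]
  ring

namespace IsRegularFrame

variable {u : Cn n → ℝ} {U M : Set (Cn n)} {W : Fin (n + 1) → Cn n → Cn n} {z : Cn n}
  (h : IsRegularFrame u U W) (hz : z ∈ U)
include h hz

theorem frameCurv_smul_right (c : ℂ) (x y : Cn n) :
    frameCurv u W z x (c • y) = conj c • frameCurv u W z x y := by
  rw [← h.frameCurv_conjTranspose hz, (h.isLinearMap_frameCurv hz x).map_smul,
    Matrix.conjTranspose_smul, h.frameCurv_conjTranspose hz]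
  rfl

theorem frameCurv_sum_left {ι : Type*} (s : Finset ι) (c : ι → ℂ) (v : ι → Cn n) (y : Cn n)
    (A B : Idx n) : frameCurv u W z (∑ i ∈ s, c i • v i) y A B =
      ∑ i ∈ s, c i * frameCurv u W z (v i) y A B := by
  have hl := h.isLinearMap_frameCurv hz y
  have := map_sum hl.mk' (fun i => c i • v i) s
  simp only [IsLinearMap.mk'_apply, hl.map_smul] at this
  rw [this, Matrix.sum_apply]
  rfl

theorem frameCurv_sum_right {ι : Type*} (s : Finset ι) (c : ι → ℂ) (v : ι → Cn n) (x : Cn n)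
    (A B : Idx n) : frameCurv u W z x (∑ i ∈ s, c i • v i) A B =
      ∑ i ∈ s, conj (c i) * frameCurv u W z x (v i) A B := by
  rw [← h.frameCurv_conjTranspose hz, Matrix.conjTranspose_apply, h.frameCurv_sum_left hz]
  simp only [star_sum, star_mul']
  refine Finset.sum_congr rfl fun i _ => ?_
  rw [← Matrix.conjTranspose_apply, h.frameCurv_conjTranspose hz]
  rfl

theorem frameCurvUp_eq (x y : Cn n) :
    frameCurvUp u W z x y = frameCurv u W z x y * (extMetric u W z)⁻¹ := by
  have hM : IsUnit (extMetric u W z).det := by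
    rw [extMetric, Matrix.det_mul, Matrix.det_mul, Matrix.det_conjTranspose]
    exact ((h.isUnit_det_extFrame hz).mul (h.isUnit_det_bordered hz)).mul
      (h.isUnit_det_extFrame hz).star
  rw [← h.frameCurvUp_mul_extMetric hz, Matrix.mul_assoc, Matrix.mul_nonsing_inv _ hM,
    Matrix.mul_one]

theorem frameCurvUp_I_smul (x y : Cn n) (A B : Idx n) : frameCurvUp u W z (Complex.I • x) y A B =
    Complex.I * frameCurvUp u W z x y A B := by
  rw [h.frameCurvUp_eq hz, (h.isLinearMap_frameCurv hz y).map_smul, Matrix.smul_mul,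
    ← h.frameCurvUp_eq hz]
  rfl

theorem frameCurvUp_I_smul_right (x y : Cn n) (A B : Idx n) :
    frameCurvUp u W z x (Complex.I • y) A B = -Complex.I * frameCurvUp u W z x y A B := by
  rw [h.frameCurvUp_eq hz, h.frameCurv_smul_right hz, Matrix.smul_mul, ← h.frameCurvUp_eq hz,
    Complex.conj_I]
  rfl

/-- `extD_conn` with the curvature `Θ_a^b` on the left. -/
theorem curvature_conn (a b : Fin (n + 1)) (x y : Cn n) :
    extD (conn u W a b) z x y - ∑ c, wedge (conn u W a c) (conn u W c b) z x y =
      wedge (gam u W a) (coframe W b) z x y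
      + (frameCurvUp u W z x y (Sum.inr a) (Sum.inr b)
        - frameCurvUp u W z y x (Sum.inr a) (Sum.inr b)) := by
  rw [h.extD_conn hz]; ring

section Boundary

variable (h0 : u z = 0)
include h0

/-- Lowering the index by H in the trivial column gives X_• · u + X_0, where • is the trivial index.
The lowered entry is zero and u = 0 on the boundary. -/
theorem frameCurvUp_zero (x y : Cn n) (A : Idx n) :
    frameCurvUp u W z x y A (Sum.inr 0) = 0 := by
  have := h.mul_extMetric_inl hz (frameCurvUp u W z x y) A
  rwa [h.frameCurvUp_mul_extMetric hz, h.frameCurv_inl_right hz, cx_eq_zero h0, mul_zero, zero_add,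
    eq_comm] at this

theorem frameCurvUp_inl_right (x y : Cn n) (A : Idx n) :
    frameCurvUp u W z x y A (Sum.inl ()) = frameCurv u W z x y A (Sum.inr 0) := by
  have := h.mul_extMetric_zero hz (frameCurvUp u W z x y) A
  rw [h.frameCurvUp_mul_extMetric hz, h.frameCurvUp_zero hz h0, zero_mul, add_zero] at this
  exact this.symm

omit h0 in
theorem sum_frameCurvUp_mul_levi (x y : Cn n) (A : Idx n) (β : Fin n) :
    ∑ γ : Fin n, frameCurvUp u W z x y A (Sum.inr γ.succ) * levi u W z γ β =
      frameCurv u W z x y A (Sum.inr β.succ) := by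
  rw [← h.mul_extMetric_succ hz, h.frameCurvUp_mul_extMetric hz]

/-- Of the n + 2 diagonal entries, the trivial one and the one for ξ vanish on the boundary, so the
full trace is the trace over Greek indices. -/
theorem sum_frameCurvUp_diag (x y : Cn n)
    (htr : (curvH u z x y * (bordered u z)⁻¹).trace = 0) :
    ∑ α : Fin n, frameCurvUp u W z x y (Sum.inr α.succ) (Sum.inr α.succ) = 0 := by
  have h1 : (frameCurvUp u W z x y).trace = 0 := by
    rw [frameCurvUp, Matrix.trace_mul_comm, ← Matrix.mul_assoc,
      Matrix.nonsing_inv_mul _ (h.isUnit_det_extFrame hz), Matrix.one_mul, htr]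
  simp only [Matrix.trace, Matrix.diag_apply] at h1
  rw [sum_idx, Fin.sum_univ_succ, h.frameCurvUp_inl hz, h.frameCurvUp_zero hz h0] at h1
  simpa using h1

omit h0 in
-- Of the derivative of r θ only r dθ survives on vectors killed by θ. The remainder is the
-- curvature equation of `conn` with the path through the index 0 separated from the Greek ones.
theorem twCurvatureForm_twConn (β α : Fin n) {x y : Cn n} (hx : del (cx u) z x = 0)
    (hy : del (cx u) z y = 0) : twCurvatureForm (twConn u W) β α z x y =
      wedge (conn u W β.succ 0) (conn u W 0 α.succ) z x y
      + wedge (gam u W β.succ) (coframe W α.succ) z x y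
      + (frameCurvUp u W z x y (Sum.inr β.succ) (Sum.inr α.succ)
        - frameCurvUp u W z y x (Sum.inr β.succ) (Sum.inr α.succ))
      + (if β = α then transverseCurvature u W z else 0) *
        (leviForm u z x y - leviForm u z y x) := by
  have hu := h.smooth_fun z hz
  have hr := h.smooth_transverseCurvature hz
  set ε : ℂ := if β = α then 1 else 0
  have h1 : ∀ x y, contactForm u z y = 0 → fderiv ℝ (fun w => twConn u W β α w y) z x =
      fderiv ℝ (fun w => conn u W β.succ α.succ w y) z x
        - Complex.I * transverseCurvature u W z * ε *
          fderiv ℝ (fun w => contactForm u w y) z x := by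
    intro x y hy
    have hd := isDer_fderiv z x
    have hc := (h.smooth_conn hz β.succ α.succ y).diffAt
    have ht := (smooth_contactForm hu y).diffAt
    have e1 : (fun w => twConn u W β α w y) = fun w => conn u W β.succ α.succ w y -
        (Complex.I * ε) * (transverseCurvature u W w * contactForm u w y) := by
      ext w; simp only [twConn_apply, twFun, ε]; ring
    rw [e1, hd.sub hc ((differentiableAt_const _).fun_mul (hr.diffAt.fun_mul ht)),
      hd.const_mul _ (hr.diffAt.fun_mul ht), hd.mul _ _ hr.diffAt ht, hy]
    ring
  have h2 : extD (fun w v => twConn u W β α w v) z x y = extD (conn u W β.succ α.succ) z x y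
      - Complex.I * transverseCurvature u W z * ε * extD (contactForm u) z x y := by
    simp only [extD, h1 x y (contactForm_of_del_eq_zero hy), h1 y x (contactForm_of_del_eq_zero hx)]
    ring
  have h3 := h.curvature_conn hz β.succ α.succ x y
  rw [Fin.sum_univ_succ] at h3
  have h4 : ∑ γ, wedge (fun y x => twConn u W β γ y x) (fun y x => twConn u W γ α y x) z x y =
      ∑ γ : Fin n, wedge (conn u W β.succ γ.succ) (conn u W γ.succ α.succ) z x y := by
    simp only [wedge, twConn_apply, twFun_of_del_eq_zero W hx, twFun_of_del_eq_zero W hy]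
  have h5 : (if β = α then transverseCurvature u W z else 0) = transverseCurvature u W z * ε := by
    simp only [ε]; split_ifs <;> simp
  rw [twCurvatureForm, h2, h4, extD_contactForm hu, h5]
  linear_combination h3 - (transverseCurvature u W z * ε *
    (leviForm u z x y - leviForm u z y x)) * Complex.I_mul_I

/-- A Gauss equation. In the (1,1) part, θ_β^0 ∧ θ_0^α gives r h_{βδ̄} δ_γ^α and the shift by r dθ
gives r δ_β^α h_{γδ̄}. The form gam ∧ θ^α has type (2,0) and drops out. -/
theorem eval11_twCurvatureForm (β α γ δ : Fin n) :
    eval11 (twCurvatureForm (twConn u W) β α z) (W γ.succ z) (W δ.succ z) =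
      frameCurvUp u W z (W γ.succ z) (W δ.succ z) (Sum.inr β.succ) (Sum.inr α.succ)
      + transverseCurvature u W z * (levi u W z β δ * (if γ = α then 1 else 0)
        + (if β = α then 1 else 0) * levi u W z γ δ) := by
  have hu := h.smooth_fun z hz
  have hl := isLinearMap_del (cx u) z
  -- On Ker ∂u these are θ_β^0, which is antilinear, and θ_0^α, whose linear part is r θ^α.
  set a : Cn n → ℂ := fun x => conj (-∑ ν : Fin n, levi u W z ν β * coframe W ν.succ z x)
  set b : Cn n → ℂ := fun x => transverseCurvature u W z * coframe W α.succ z x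
      - Complex.I * ∑ γ : Fin n, twTorsion u W α γ z * conj (coframe W γ.succ z x)
  set c : ℂ := if β = α then transverseCurvature u W z else 0
  have hmem : ∀ (γ : Fin n), ∀ x ∈ ({W γ.succ z, Complex.I • W γ.succ z} : Set (Cn n)),
      del (cx u) z x = 0 := by
    rintro γ x (rfl | rfl)
    · exact h.ker z hz γ
    · exact h.del_cx_I_smul_succ hz γ
  have ha : ∀ x, conn u W β.succ 0 z x = a x := fun x => by
    simp only [a, h.conn_succ_zero_boundary hz h0, map_neg, map_sum, map_mul, h.conj_levi hz]
  have hb : ∀ x, del (cx u) z x = 0 → conn u W 0 α.succ z x = b x := fun x hx => by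
    rw [h.conn_zero_succ_tangent hz h0 (mem_tangent_of_del_eq_zero hu hx),
      contactForm_of_del_eq_zero hx]
    simp only [b]; ring
  have e1 : eval11 (twCurvatureForm (twConn u W) β α z) (W γ.succ z) (W δ.succ z) =
      eval11 (fun x y => ((a x * b y - a y * b x)
        + (gam u W β.succ z x * coframe W α.succ z y - gam u W β.succ z y * coframe W α.succ z x)
        + (frameCurvUp u W z x y (Sum.inr β.succ) (Sum.inr α.succ)
          - frameCurvUp u W z y x (Sum.inr β.succ) (Sum.inr α.succ)))
        + c * (leviForm u z x y - leviForm u z y x)) (W γ.succ z) (W δ.succ z) := by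
    refine eval11_congr fun x hx y hy => ?_
    rw [h.twCurvatureForm_twConn hz β α (hmem γ x hx) (hmem δ y hy)]
    simp only [wedge, ha, hb x (hmem γ x hx), hb y (hmem δ y hy), c]
  have hcl : ∀ ν : Fin n, IsLinearMap ℂ (coframe W ν.succ z) := fun ν => isLinearMap_coframe W _ z
  have hal : IsLinearMap ℂ (fun x => -∑ ν : Fin n, levi u W z ν β * coframe W ν.succ z x) := by
    constructor
    · intro v w
      simp only [(hcl _).map_add, mul_add, Finset.sum_add_distrib]; ring
    · intro c v
      simp only [(hcl _).map_smul, smul_eq_mul, mul_neg, Finset.mul_sum]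
      congr 1; exact Finset.sum_congr rfl fun ν _ => by ring
  have hL1 : ∀ x y, leviForm u z (Complex.I • x) y = Complex.I * leviForm u z x y := fun x y => by
    simp only [leviForm, Finset.mul_sum, Pi.smul_apply, smul_eq_mul]
    exact Finset.sum_congr rfl fun _ _ => Finset.sum_congr rfl fun _ _ => by ring
  have hL2 : ∀ x y, leviForm u z x (Complex.I • y) = -Complex.I * leviForm u z x y := fun x y => by
    simp only [leviForm, Finset.mul_sum, Pi.smul_apply, smul_eq_mul, map_mul, Complex.conj_I]
    exact Finset.sum_congr rfl fun _ _ => Finset.sum_congr rfl fun _ _ => by ring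
  have hcW : ∀ α γ : Fin n, coframe W α.succ z (W γ.succ z) = if γ = α then 1 else 0 :=
    fun α γ => by rw [h.coframe_frame hz]; simp
  have hg := h.isLinearMap_gam hz β.succ
  have e2 : eval10 a (W γ.succ z) = 0 := by
    rw [eval10_conj, eval01_of_linear hal, map_zero]
  have e3 : eval01 a (W δ.succ z) = -levi u W z β δ := by
    rw [eval01_conj, eval10_of_linear hal]
    simp [hcW, h.conj_levi hz]
  have e4 : eval10 b (W γ.succ z) = transverseCurvature u W z * if γ = α then 1 else 0 := by
    simp only [b, sub_eq_add_neg, ← neg_mul]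
    rw [eval10_fun_add, eval10_fun_const_mul, eval10_fun_const_mul, eval10_fun_sum,
      eval10_of_linear (hcl α), hcW]
    simp [eval10_fun_const_mul, eval10_conj, eval01_of_linear (hcl _)]
  rw [e1]
  simp only [eval11_add, eval11_sub, eval11_const_mul, eval11_mul, eval11_mul']
  rw [eval11_of_sesquilinear hL1 hL2, eval11_swap_of_sesquilinear hL1 hL2,
    eval11_of_sesquilinear (f := fun x y => frameCurvUp u W z x y _ _)
      (fun x y => h.frameCurvUp_I_smul hz x y _ _) (fun x y => h.frameCurvUp_I_smul_right hz x y _ _),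
    eval11_swap_of_sesquilinear (f := fun x y => frameCurvUp u W z x y _ _)
      (fun x y => h.frameCurvUp_I_smul hz x y _ _) (fun x y => h.frameCurvUp_I_smul_right hz x y _ _),
    e2, e3, e4, eval01_of_linear (hcl α), eval01_of_linear hg]
  have e5 : leviForm u z (W γ.succ z) (W δ.succ z) = levi u W z γ δ := rfl
  rw [e5]
  simp only [c]
  split_ifs <;> ring

end Boundary

end IsRegularFrame

/-! ### The Tanaka-Webster invariants of the boundary -/

/-- A piece `M` of the zero set of `u`, with a Tanaka-Webster connection, such that
`∂∂̄ log |J[u]|` vanishes on the complex tangent spaces of `M`. -/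
structure IsBoundaryData (u : Cn n → ℝ) (U M : Set (Cn n)) (W : Fin (n + 1) → Cn n → Cn n)
    (om : Fin n → Fin n → Cn n → (Cn n →L[ℝ] ℂ)) (A : Fin n → Fin n → Cn n → ℂ) : Prop where
  pos : 0 < n
  frame : IsRegularFrame u U W
  mem : ∀ z ∈ M, z ∈ U ∧ u z = 0
  locally_all : ∀ z ∈ M, ∀ᶠ y in 𝓝 z, u y = u z → y ∈ M
  mongeAmpere_eq : ∀ z ∈ M, ∀ x y, del (cx u) z y = 0 →
    mongeAmpere u z * delbar (fun w => del (mongeAmpere u) w x) z y =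
      del (mongeAmpere u) z x * delbar (mongeAmpere u) z y
  tanakaWebster : IsTanakaWebster u M W om A

/-! ### Tanaka-Webster invariants expressed by r, gam and the curvature of the bordered Hessian -/

namespace IsBoundaryData

variable {u : Cn n → ℝ} {U M : Set (Cn n)} {W : Fin (n + 1) → Cn n → Cn n}
  {om : Fin n → Fin n → Cn n → (Cn n →L[ℝ] ℂ)} {A : Fin n → Fin n → Cn n → ℂ} {z : Cn n}
  (d : IsBoundaryData u U M W om A) (hz : z ∈ M)
include d hz

theorem mem_open : z ∈ U := (d.mem z hz).1

theorem fun_eq_zero : u z = 0 := (d.mem z hz).2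

theorem om_eq (α β : Fin n) {v : Cn n} (hv : v ∈ Tangent u z) :
    om α β z v = twFun u W α β z v :=
  (d.frame.tanakaWebster_unique d.mem d.tanakaWebster (d.frame.isTanakaWebster d.mem) hz).1 α β v hv

theorem torsion_up_eq (α β : Fin n) : A α β z = twTorsion u W α β z :=
  (d.frame.tanakaWebster_unique d.mem d.tanakaWebster (d.frame.isTanakaWebster d.mem) hz).2 α β

theorem frame_mem_tangent (γ : Fin n) : ∀ x ∈ ({W γ.succ z, Complex.I • W γ.succ z} : Set (Cn n)),
    x ∈ Tangent u z := by
  have hU := d.mem_open hz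
  rintro x (rfl | rfl)
  · exact mem_tangent_of_del_eq_zero (d.frame.smooth_fun z hU) (d.frame.ker z hU γ)
  · exact mem_tangent_of_del_eq_zero (d.frame.smooth_fun z hU) (d.frame.del_cx_I_smul_succ hU γ)

theorem fderiv_eq_of_eqOn {f g : Cn n → ℂ} (hf : ContDiffAt ℝ ∞ f z) (hg : ContDiffAt ℝ ∞ g z)
    (hfg : ∀ y ∈ M, f y = g y) {v : Cn n} (hv : v ∈ Tangent u z) :
    fderiv ℝ f z v = fderiv ℝ g z v := by
  have hU := d.mem_open hz
  have := fderiv_eq_zero_of_tangent (hf.sub hg) (d.frame.smooth_fun z hU) (d.frame.fderiv_ne_zero hU)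
    ((d.locally_all z hz).mono fun y hy hyu => sub_eq_zero.2 (hfg y (hy hyu))) hv
  rw [(isDer_fderiv z v).sub (ContDiffAt.diffAt hf) (ContDiffAt.diffAt hg)] at this
  exact sub_eq_zero.1 this

theorem del_eq_of_eqOn {f g : Cn n → ℂ} (hf : ContDiffAt ℝ ∞ f z) (hg : ContDiffAt ℝ ∞ g z)
    (hfg : ∀ y ∈ M, f y = g y) (γ : Fin n) : del f z (W γ.succ z) = del g z (W γ.succ z) := by
  have ht := d.frame_mem_tangent hz γ
  simp only [del, eval10, d.fderiv_eq_of_eqOn hz hf hg hfg (ht _ (Set.mem_insert _ _)),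
    d.fderiv_eq_of_eqOn hz hf hg hfg (ht _ (Set.mem_insert_of_mem _ rfl))]

theorem delbar_eq_of_eqOn {f g : Cn n → ℂ} (hf : ContDiffAt ℝ ∞ f z) (hg : ContDiffAt ℝ ∞ g z)
    (hfg : ∀ y ∈ M, f y = g y) (γ : Fin n) :
    delbar f z (W γ.succ z) = delbar g z (W γ.succ z) := by
  have ht := d.frame_mem_tangent hz γ
  simp only [delbar, eval01, d.fderiv_eq_of_eqOn hz hf hg hfg (ht _ (Set.mem_insert _ _)),
    d.fderiv_eq_of_eqOn hz hf hg hfg (ht _ (Set.mem_insert_of_mem _ rfl))]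

theorem curvUp_eq (β α γ δ : Fin n) : curvUp W om β α γ δ z =
    frameCurvUp u W z (W γ.succ z) (W δ.succ z) (Sum.inr β.succ) (Sum.inr α.succ)
      + transverseCurvature u W z * (levi u W z β δ * (if γ = α then 1 else 0)
        + (if β = α then 1 else 0) * levi u W z γ δ) := by
  have hU := d.mem_open hz
  rw [← d.frame.eval11_twCurvatureForm hU (d.fun_eq_zero hz)]
  exact eval11_congr fun x hx y hy => twCurvatureForm_congr_of_tangent
    (fun α β => d.tanakaWebster.smooth_connection α β z hz)
    (fun α β => d.frame.smooth_twConn hU α β) (d.frame.smooth_fun z hU) (d.frame.fderiv_ne_zero hU)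
    ((d.locally_all z hz).mono fun y hy hyu α β v hv => d.om_eq (hy hyu) α β hv) β α
    (d.frame_mem_tangent hz γ x hx) (d.frame_mem_tangent hz δ y hy)

theorem curv_eq (β α γ μ : Fin n) : curv u W om β α γ μ z =
    frameCurv u W z (W γ.succ z) (W μ.succ z) (Sum.inr β.succ) (Sum.inr α.succ)
      + transverseCurvature u W z * (levi u W z β α * levi u W z γ μ
        + levi u W z γ α * levi u W z β μ) := by
  simp only [curv, d.curvUp_eq hz, add_mul, Finset.sum_add_distrib,
    d.frame.sum_frameCurvUp_mul_levi (d.mem_open hz)]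
  have h1 : ∀ ν, transverseCurvature u W z * (levi u W z β μ * (if γ = ν then 1 else 0)
      + (if β = ν then 1 else 0) * levi u W z γ μ) * levi u W z ν α =
      (if γ = ν then transverseCurvature u W z * levi u W z β μ * levi u W z ν α else 0)
      + if β = ν then transverseCurvature u W z * levi u W z γ μ * levi u W z ν α else 0 := fun ν => by
    split_ifs <;> ring
  rw [Finset.sum_congr rfl fun ν _ => h1 ν, Finset.sum_add_distrib]
  simp only [Finset.sum_ite_eq, Finset.mem_univ, if_true]
  ring

/-- This is where the Monge-Ampère equation enters: it kills the trace of the curvature part. Of the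
factor n + 1, n comes from δ_α^α and 1 from contracting δ_γ^α with h_{αδ̄}. -/
theorem ric_eq (γ δ : Fin n) :
    ric W om γ δ z = (n + 1) * transverseCurvature u W z * levi u W z γ δ := by
  have hU := d.mem_open hz
  have h1 := d.frame.sum_frameCurvUp_diag hU (d.fun_eq_zero hz) (W γ.succ z) (W δ.succ z)
    (trace_curvH (d.frame.eventually_smooth hU) (d.frame.isUnit_det_bordered hU) _ _
      (d.mongeAmpere_eq z hz _ _ (d.frame.ker z hU δ)))
  simp only [ric, d.curvUp_eq hz, Finset.sum_add_distrib, h1, ← Finset.mul_sum]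
  simp
  ring

theorem scal_eq : scal u W om z = n * (n + 1) * transverseCurvature u W z := by
  have h1 : ∀ γ, ∑ δ, leviInv u W z γ δ * ric W om γ δ z = (n + 1) * transverseCurvature u W z :=
    fun γ => by
      have := d.frame.sum_leviInv_mul (d.mem_open hz) γ γ
      simp only [d.ric_eq hz, mul_left_comm (leviInv u W z γ _), ← Finset.mul_sum, this]
      simp
  simp only [scal, h1]
  simp
  ring

omit hz in
theorem nat_ne : (n : ℂ) * (n + 1) ≠ 0 := by
  have h1 : (n : ℂ) ≠ 0 := by exact_mod_cast d.pos.ne'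
  have h2 : (n : ℂ) + 1 ≠ 0 := by exact_mod_cast n.succ_ne_zero
  exact mul_ne_zero h1 h2

theorem scal_div : scal u W om z / ((n : ℂ) * (n + 1)) = transverseCurvature u W z := by
  rw [d.scal_eq hz, mul_div_cancel_left₀ _ (d.nat_ne)]

theorem smooth_const_mul_transverseCurvature (c : ℂ) :
    ContDiffAt ℝ ∞ (fun y => c * transverseCurvature u W y) z :=
  contDiffAt_const.mul (d.frame.smooth_transverseCurvature (d.mem_open hz))

/-- Scal = n(n+1) r holds only on M, but W_γ is complex tangential, so the (1,0) derivatives of the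
two smooth functions agree. -/
theorem dScal_eq (γ : Fin n) : dScal u W om γ z = n * (n + 1) * gamMat u W z 0 γ.succ := by
  have hU := d.mem_open hz
  rw [dScal, d.del_eq_of_eqOn hz (d.frame.smooth_scal hU
    fun α β => d.tanakaWebster.smooth_connection α β z hz)
    (d.smooth_const_mul_transverseCurvature hz (n * (n + 1))) (fun y hy => d.scal_eq hy) γ,
    (isDer_del z _).const_mul _ (d.frame.smooth_transverseCurvature hU).diffAt,
    ← d.frame.del_transverseCurvature hU (d.fun_eq_zero hz)]

theorem delbar_scal_eq (γ : Fin n) : delbar (scal u W om) z (W γ.succ z) =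
    n * (n + 1) * conj (gamMat u W z 0 γ.succ) := by
  have hU := d.mem_open hz
  rw [d.delbar_eq_of_eqOn hz (d.frame.smooth_scal hU
    fun α β => d.tanakaWebster.smooth_connection α β z hz)
    (d.smooth_const_mul_transverseCurvature hz (n * (n + 1))) (fun y hy => d.scal_eq hy) γ,
    (isDer_delbar z _).const_mul _ (d.frame.smooth_transverseCurvature hU).diffAt,
    ← d.frame.del_transverseCurvature hU (d.fun_eq_zero hz), ← delbar_conj]
  congr 1
  exact (isDer_delbar z _).congr _ _ ((d.frame.eventually_mem hU).mono
    fun y hy => (d.frame.conj_transverseCurvature hy).symm)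

theorem dScalUp_eq (α : Fin n) : dScalUp u W om α z =
    n * (n + 1) * ∑ β : Fin n, leviInv u W z α β * conj (gamMat u W z 0 β.succ) := by
  simp only [dScalUp, d.delbar_scal_eq hz, Finset.mul_sum]
  exact Finset.sum_congr rfl fun β _ => by ring

theorem torsion_eq (α β : Fin n) :
    torsion u W A α β z = Complex.I * gamMat u W z α.succ β.succ := by
  have hU := d.mem_open hz
  have h1 := congrArg conj (d.frame.sum_twTorsion_mul_levi hU β α)
  simp only [map_sum, map_mul, map_neg, Complex.conj_I, neg_neg, Complex.conj_conj,
    d.frame.conj_levi hU, d.frame.gamMat_symm hU β.succ] at h1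
  rw [← h1, torsion]
  refine Finset.sum_congr rfl fun γ _ => ?_
  rw [d.torsion_up_eq hz, mul_comm]

theorem smooth_torsion (α β : Fin n) : ContDiffAt ℝ ∞ (torsion u W A α β) z :=
  ContDiffAt.sum fun γ _ => (d.frame.smooth_levi (d.mem_open hz) α γ).mul
    (Complex.conjCLE.contDiff.contDiffAt.comp z (d.tanakaWebster.smooth_torsion γ β z hz))

theorem eval01_om (α β γ : Fin n) : eval01 (fun x => om α β z x) (W γ.succ z) =
    eval01 (conn u W α.succ β.succ z) (W γ.succ z) := by
  have hU := d.mem_open hz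
  have ht := d.frame_mem_tangent hz γ
  simp only [eval01, d.om_eq hz α β (ht _ (Set.mem_insert _ _)),
    d.om_eq hz α β (ht _ (Set.mem_insert_of_mem _ rfl)),
    twFun_of_del_eq_zero W (d.frame.ker z hU γ),
    twFun_of_del_eq_zero W (d.frame.del_cx_I_smul_succ hU γ)]

theorem eval01_conn_succ_zero (β α : Fin n) :
    eval01 (conn u W β.succ 0 z) (W α.succ z) = -levi u W z β α := by
  have hU := d.mem_open hz
  have hI : Complex.I • W α.succ z = Complex.I • W α.succ z := rfl
  simp only [eval01, d.frame.conn_succ_zero_boundary hU (d.fun_eq_zero hz),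
    (isLinearMap_coframe W _ z).map_smul, d.frame.coframe_frame hU, Fin.succ_inj]
  simp only [smul_eq_mul, mul_ite, mul_one, mul_zero, apply_ite conj, map_one, map_zero,
    Complex.conj_I, Finset.sum_ite_eq, Finset.mem_univ, if_true]
  linear_combination (levi u W z β α) / 2 * Complex.I_mul_I

/-- Since A_{βγ} = i gam_β(W_γ) on M, take the ∂̄ derivative of gam. Its Greek connection terms are
those of the covariant derivative and cancel; the terms through the index 0 carry θ_β^0(W_ᾱ) =
-h_{βᾱ} and leave the derivatives of r. -/
theorem dTorsion_eq (β γ α : Fin n) : dTorsion u W om A β γ α z = -Complex.I *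
    (levi u W z β α * gamMat u W z 0 γ.succ + levi u W z γ α * gamMat u W z 0 β.succ
      + frameCurv u W z (W γ.succ z) (W 0 z) (Sum.inr β.succ) (Sum.inr α.succ)) := by
  have hU := d.mem_open hz
  have h0 := d.fun_eq_zero hz
  have hg := d.frame.smooth_gamMat hU β.succ γ.succ
  have h1 : delbar (torsion u W A β γ) z (W α.succ z) =
      Complex.I * delbar (fun w => gamMat u W w β.succ γ.succ) z (W α.succ z) := by
    rw [d.delbar_eq_of_eqOn hz (d.smooth_torsion hz β γ)
      (contDiffAt_const.mul hg : ContDiffAt ℝ ∞ (fun w => Complex.I * gamMat u W w β.succ γ.succ) z)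
      (fun y hy => d.torsion_eq hy β γ) α, (isDer_delbar z _).const_mul _ (ContDiffAt.diffAt hg)]
  rw [dTorsion, h1, d.frame.delbar_gamMat hU, Fin.sum_univ_succ, Fin.sum_univ_succ,
    d.frame.frameCurvUp_inl_right hU h0, d.eval01_conn_succ_zero hz, d.eval01_conn_succ_zero hz,
    d.frame.frameCurv_symm_right hU]
  simp only [d.eval01_om hz, d.torsion_eq hz, mul_left_comm _ Complex.I, ← Finset.mul_sum,
    d.frame.gamMat_symm hU β.succ 0]
  ring

/-- The Scal terms in the definition of V are exactly the ones that remove the terms with gam_0 from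
∇A. -/
theorem tensorV_eq (β α γ : Fin n) : tensorV u W om A β α γ z = -Complex.I *
    frameCurv u W z (W γ.succ z) (W 0 z) (Sum.inr β.succ) (Sum.inr α.succ) := by
  have h1 : ∀ γ, Complex.I * dScal u W om γ z / ((n : ℂ) * (n + 1)) =
      Complex.I * gamMat u W z 0 γ.succ := fun γ => by
    rw [d.dScal_eq hz, mul_left_comm, mul_div_cancel_left₀ _ (d.nat_ne)]
  rw [tensorV, d.dTorsion_eq hz, h1, h1]
  ring

theorem tensorS_eq (β α γ μ : Fin n) : tensorS u W om β α γ μ z =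
    frameCurv u W z (W γ.succ z) (W μ.succ z) (Sum.inr β.succ) (Sum.inr α.succ) := by
  rw [tensorS, d.curv_eq hz, d.scal_div hz]
  ring

/-- With Ric = (n+1) r h and Scal = n(n+1) r, each product h h receives -2(n+1)r/(n+2) + n r/(n+2) =
-r, which is its coefficient in S. -/
theorem tensorS_eq_chernMoser (β α γ μ : Fin n) :
    tensorS u W om β α γ μ z = chernMoser u W om β α γ μ z := by
  have h1 : (n : ℂ) + 1 ≠ 0 := by exact_mod_cast n.succ_ne_zero
  have h2 : (n : ℂ) + 2 ≠ 0 := by exact_mod_cast (n + 1).succ_ne_zero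
  rw [tensorS, chernMoser, d.scal_div hz, d.scal_eq hz]
  simp only [d.ric_eq hz]
  field_simp
  ring

/-- Expand x and y in the frame with θ^0 = iθ. The component with both directions ξ stays
unidentified; being symmetric in x and y, it disappears on antisymmetrizing. -/
theorem frameCurv_tangent {x y : Cn n} (hx : x ∈ Tangent u z) (hy : y ∈ Tangent u z) (β ν : Fin n) :
    frameCurv u W z x y (Sum.inr β.succ) (Sum.inr ν.succ) =
      ∑ γ : Fin n, ∑ μ : Fin n, tensorS u W om β ν γ μ z *
        (coframe W γ.succ z x * conj (coframe W μ.succ z y))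
      + ∑ γ : Fin n, tensorV u W om A β ν γ z * (coframe W γ.succ z x * contactForm u z y)
      + ∑ γ : Fin n, conj (tensorV u W om A ν β γ z) *
        (conj (coframe W γ.succ z y) * contactForm u z x)
      + contactForm u z x * contactForm u z y *
        frameCurv u W z (W 0 z) (W 0 z) (Sum.inr β.succ) (Sum.inr ν.succ) := by
  have hU := d.mem_open hz
  have hu := d.frame.smooth_fun z hU
  have e1 : ∀ γ, frameCurv u W z (W 0 z) (W (Fin.succ γ) z) (Sum.inr β.succ) (Sum.inr ν.succ) =
      -Complex.I * conj (tensorV u W om A ν β γ z) := fun γ => by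
    rw [d.tensorV_eq hz, ← d.frame.frameCurv_conjTranspose hU, Matrix.conjTranspose_apply,
      map_mul, map_neg, Complex.conj_I]
    change conj _ = _
    linear_combination (conj (frameCurv u W z (W γ.succ z) (W 0 z) (Sum.inr ν.succ)
      (Sum.inr β.succ))) * Complex.I_mul_I
  have e2 : ∀ γ, frameCurv u W z (W (Fin.succ γ) z) (W 0 z) (Sum.inr β.succ) (Sum.inr ν.succ) =
      Complex.I * tensorV u W om A β ν γ z := fun γ => by
    rw [d.tensorV_eq hz]
    linear_combination (frameCurv u W z (W γ.succ z) (W 0 z) (Sum.inr β.succ)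
      (Sum.inr ν.succ)) * Complex.I_mul_I
  conv_lhs => rw [← d.frame.sum_coframe_smul hU x, ← d.frame.sum_coframe_smul hU y]
  simp only [d.frame.frameCurv_sum_left hU, d.frame.frameCurv_sum_right hU]
  rw [Fin.sum_univ_succ]
  simp only [Fin.sum_univ_succ (n := n), d.frame.coframe_zero hU, e1, e2, ← d.tensorS_eq hz]
  simp only [del_cx_of_tangent hu hx, del_cx_of_tangent hu hy, map_mul, Complex.conj_I,
    conj_contactForm, mul_add, Finset.sum_add_distrib, Finset.mul_sum]
  have e3 : ∀ γ : Fin n, coframe W γ.succ z x * (-Complex.I * contactForm u z y *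
      (Complex.I * tensorV u W om A β ν γ z)) =
      tensorV u W om A β ν γ z * (coframe W γ.succ z x * contactForm u z y) := fun γ => by
    linear_combination (-(coframe W γ.succ z x * contactForm u z y *
      tensorV u W om A β ν γ z)) * Complex.I_mul_I
  have e4 : ∀ γ : Fin n, Complex.I * contactForm u z x * (conj (coframe W γ.succ z y) *
      (-Complex.I * conj (tensorV u W om A ν β γ z))) =
      conj (tensorV u W om A ν β γ z) * (conj (coframe W γ.succ z y) * contactForm u z x) :=
    fun γ => by
      linear_combination (-(contactForm u z x * conj (coframe W γ.succ z y) *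
        conj (tensorV u W om A ν β γ z))) * Complex.I_mul_I
  have e5 : ∀ γ μ : Fin n, coframe W γ.succ z x * (conj (coframe W μ.succ z y) *
      tensorS u W om β ν γ μ z) = tensorS u W om β ν γ μ z *
        (coframe W γ.succ z x * conj (coframe W μ.succ z y)) := fun γ μ => by ring
  simp only [e3, e4, e5]
  linear_combination (-(contactForm u z x * contactForm u z y *
    frameCurv u W z (W 0 z) (W 0 z) (Sum.inr β.succ) (Sum.inr ν.succ))) * Complex.I_mul_I

theorem frameCurv_tangent_sub {x y : Cn n} (hx : x ∈ Tangent u z) (hy : y ∈ Tangent u z)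
    (β ν : Fin n) : frameCurv u W z x y (Sum.inr β.succ) (Sum.inr ν.succ)
      - frameCurv u W z y x (Sum.inr β.succ) (Sum.inr ν.succ) =
      ∑ γ : Fin n, ∑ μ : Fin n, tensorS u W om β ν γ μ z *
          wedge (coframe W γ.succ) (conjForm (coframe W μ.succ)) z x y
        + ∑ γ : Fin n, tensorV u W om A β ν γ z *
          wedge (coframe W γ.succ) (contactForm u) z x y
        - ∑ γ : Fin n, conj (tensorV u W om A ν β γ z) *
          wedge (conjForm (coframe W γ.succ)) (contactForm u) z x y := by
  rw [d.frameCurv_tangent hz hx hy, d.frameCurv_tangent hz hy hx]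
  simp only [wedge, conjForm, mul_sub, Finset.sum_sub_distrib]
  ring

theorem frameCurvUp_tangent {x y : Cn n} (hx : x ∈ Tangent u z) (hy : y ∈ Tangent u z)
    (β α : Fin n) : frameCurvUp u W z x y (Sum.inr β.succ) (Sum.inr α.succ)
      - frameCurvUp u W z y x (Sum.inr β.succ) (Sum.inr α.succ) =
      ∑ γ : Fin n, ∑ μ : Fin n, tensorSUp u W om β α γ μ z *
          wedge (coframe W γ.succ) (conjForm (coframe W μ.succ)) z x y
        + ∑ γ : Fin n, tensorVUp u W om A β α γ z *
          wedge (coframe W γ.succ) (contactForm u) z x y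
        - ∑ γ : Fin n, tensorVUpBar u W om A α β γ z *
          wedge (conjForm (coframe W γ.succ)) (contactForm u) z x y := by
  have hU := d.mem_open hz
  have e1 : ∀ x y, frameCurvUp u W z x y (Sum.inr β.succ) (Sum.inr α.succ) =
      ∑ ν, leviInv u W z α ν * frameCurv u W z x y (Sum.inr β.succ) (Sum.inr ν.succ) := fun x y =>
    d.frame.sum_mul_levi hU (fun α => frameCurvUp u W z x y (Sum.inr β.succ) (Sum.inr α.succ)) _
      (fun β' => d.frame.sum_frameCurvUp_mul_levi hU x y _ β') α
  simp only [e1, ← Finset.sum_sub_distrib, ← mul_sub, d.frameCurv_tangent_sub hz hx hy]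
  simp only [mul_sub, mul_add, Finset.sum_sub_distrib, Finset.sum_add_distrib, Finset.mul_sum,
    tensorSUp, tensorVUp, tensorVUpBar, Finset.sum_mul, ← mul_assoc]
  refine congrArg₂ _ (congrArg₂ _ ?_ Finset.sum_comm) Finset.sum_comm
  rw [Finset.sum_comm]
  exact Finset.sum_congr rfl fun γ _ => Finset.sum_comm

theorem gam_tangent_dScal {x : Cn n} (hx : x ∈ Tangent u z) (β : Fin n) :
    gam u W β.succ z x = -Complex.I * ∑ γ : Fin n, torsion u W A β γ z * coframe W γ.succ z x
      + Complex.I / ((n : ℂ) * (n + 1)) * dScal u W om β z * contactForm u z x := by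
  have hU := d.mem_open hz
  have hne := d.nat_ne
  have e1 : Complex.I / ((n : ℂ) * (n + 1)) * dScal u W om β z =
      Complex.I * gamMat u W z 0 β.succ := by
    rw [d.dScal_eq hz, div_mul_eq_mul_div, mul_left_comm, mul_div_cancel_left₀ _ hne]
  rw [d.frame.gam_tangent hU hx, e1, d.frame.gamMat_symm hU β.succ 0, Finset.mul_sum, add_comm]
  congr 1
  · refine Finset.sum_congr rfl fun γ _ => ?_
    rw [d.torsion_eq hz]
    linear_combination (coframe W γ.succ z x * gamMat u W z β.succ γ.succ) * Complex.I_mul_I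
  · ring

/-- The curvature forms `Θ_β^α` of the renormalized connection on the boundary. -/
theorem curvature_succ_succ {x y : Cn n} (hx : x ∈ Tangent u z) (hy : y ∈ Tangent u z)
    (β α : Fin n) : extD (conn u W β.succ α.succ) z x y
      - ∑ c, wedge (conn u W β.succ c) (conn u W c α.succ) z x y =
      ∑ γ : Fin n, ∑ μ : Fin n, tensorSUp u W om β α γ μ z *
          wedge (coframe W γ.succ) (conjForm (coframe W μ.succ)) z x y
        + ∑ γ : Fin n, tensorVUp u W om A β α γ z *
          wedge (coframe W γ.succ) (contactForm u) z x y
        - ∑ γ : Fin n, tensorVUpBar u W om A α β γ z *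
          wedge (conjForm (coframe W γ.succ)) (contactForm u) z x y
        - Complex.I * ∑ γ : Fin n, torsion u W A β γ z *
          wedge (coframe W γ.succ) (coframe W α.succ) z x y
        + Complex.I / ((n : ℂ) * (n + 1)) * dScal u W om β z *
          wedge (contactForm u) (coframe W α.succ) z x y := by
  have hU := d.mem_open hz
  rw [d.frame.curvature_conn hU, d.frameCurvUp_tangent hz hx hy]
  have e1 : ∑ γ : Fin n, torsion u W A β γ z * wedge (coframe W γ.succ) (coframe W α.succ) z x y =
      (∑ γ : Fin n, torsion u W A β γ z * coframe W γ.succ z x) * coframe W α.succ z y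
      - (∑ γ : Fin n, torsion u W A β γ z * coframe W γ.succ z y) * coframe W α.succ z x := by
    simp only [wedge, Finset.sum_mul, ← Finset.sum_sub_distrib]
    exact Finset.sum_congr rfl fun γ _ => by ring
  rw [e1]
  simp only [wedge.eq_1 (gam u W β.succ), wedge.eq_1 (contactForm u), d.gam_tangent_dScal hz hx,
    d.gam_tangent_dScal hz hy]
  ring

/-- The curvature forms `Θ_β^0` of the renormalized connection on the boundary. -/
theorem curvature_succ_zero {x y : Cn n} (hx : x ∈ Tangent u z) (hy : y ∈ Tangent u z)
    (β : Fin n) : extD (conn u W β.succ 0) z x y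
      - ∑ c, wedge (conn u W β.succ c) (conn u W c 0) z x y =
      ∑ γ : Fin n, torsion u W A β γ z * wedge (coframe W γ.succ) (contactForm u) z x y := by
  have hU := d.mem_open hz
  have hu := d.frame.smooth_fun z hU
  have h0 := d.fun_eq_zero hz
  rw [d.frame.curvature_conn hU, d.frame.frameCurvUp_zero hU h0, d.frame.frameCurvUp_zero hU h0]
  have e1 : ∑ γ : Fin n, torsion u W A β γ z * wedge (coframe W γ.succ) (contactForm u) z x y =
      (∑ γ : Fin n, torsion u W A β γ z * coframe W γ.succ z x) * contactForm u z y
      - (∑ γ : Fin n, torsion u W A β γ z * coframe W γ.succ z y) * contactForm u z x := by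
    simp only [wedge, Finset.sum_mul, ← Finset.sum_sub_distrib]
    exact Finset.sum_congr rfl fun γ _ => by ring
  rw [e1]
  simp only [wedge, d.gam_tangent_dScal hz hx, d.gam_tangent_dScal hz hy, d.frame.coframe_zero hU,
    del_cx_of_tangent hu hx, del_cx_of_tangent hu hy]
  linear_combination (-((∑ γ : Fin n, torsion u W A β γ z * coframe W γ.succ z x) *
    contactForm u z y) + (∑ γ : Fin n, torsion u W A β γ z * coframe W γ.succ z y) *
    contactForm u z x) * Complex.I_mul_I

end IsBoundaryData

/-! ### Defining functions in holomorphic charts -/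

section Chart

variable {N : Type*} [TopologicalSpace N] [ChartedSpace (Cn n) N]
  {φ χ : OpenPartialHomeomorph N (Cn n)} {ρ : N → ℝ} {z : Cn n}

theorem isHolChart_chartAt [IsManifold 𝓘(ℂ, Cn n) ω N] (p : N) :
    IsHolChart (chartAt (Cn n) p) :=
  IsManifold.chart_mem_maximalAtlas p

theorem IsHolChart.contDiffAt_transition (hφ : IsHolChart φ) (hχ : IsHolChart χ)
    (hz : z ∈ φ.target) (hz' : φ.symm z ∈ χ.source) : ContDiffAt ℂ ω (χ ∘ φ.symm) z := by
  have h := (contDiffGroupoid ω 𝓘(ℂ, Cn n)).compatible_of_mem_maximalAtlas hφ hχ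
  rw [contDiffGroupoid, mem_groupoid_of_pregroupoid, contDiffPregroupoid] at h
  have h1 := h.1
  simp only [modelWithCornersSelf_coe, modelWithCornersSelf_coe_symm,
    Function.comp_id, Function.id_comp, Set.preimage_id, Set.range_id, Set.inter_univ] at h1
  refine h1.contDiffAt ((φ.symm ≫ₕ χ).open_source.mem_nhds ?_)
  simp [hz, hz']

theorem contDiffAt_comp_chartAt_symm (hρ : ContMDiff 𝓘(ℝ, Cn n) 𝓘(ℝ, ℝ) ∞ ρ) (p : N) :
    ContDiffAt ℝ ∞ (ρ ∘ (chartAt (Cn n) p).symm) (chartAt (Cn n) p p) := by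
  have h := (contMDiffAt_iff.1 (hρ p)).2
  simp only [extChartAt, mfld_simps, contDiffWithinAt_univ] at h
  exact h

variable [IsManifold 𝓘(ℂ, Cn n) ω N]

/-- Smoothness of ρ is expressed in the preferred charts; holomorphic transition maps, real smooth
in particular, carry it to every holomorphic chart. -/
theorem IsHolChart.contDiffAt_comp_symm (hφ : IsHolChart φ)
    (hρ : ContMDiff 𝓘(ℝ, Cn n) 𝓘(ℝ, ℝ) ∞ ρ) (hz : z ∈ φ.target) :
    ContDiffAt ℝ ∞ (ρ ∘ φ.symm) z := by
  set χ := chartAt (Cn n) (φ.symm z)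
  have hs : φ.symm z ∈ χ.source := mem_chart_source _ _
  have h1 := ((hφ.contDiffAt_transition (isHolChart_chartAt _) hz hs).restrict_scalars ℝ).of_le
    (show (∞ : WithTop ℕ∞) ≤ ω from le_top)
  have h2 : ContDiffAt ℝ ∞ ((ρ ∘ χ.symm) ∘ (χ ∘ φ.symm)) z :=
    (contDiffAt_comp_chartAt_symm hρ (φ.symm z)).comp z h1
  refine h2.congr_of_eventuallyEq ?_
  have h3 : ∀ᶠ y in 𝓝 z, φ.symm y ∈ χ.source :=
    (φ.symm.continuousAt hz).eventually (χ.open_source.mem_nhds hs)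
  filter_upwards [h3] with y hy
  simp [χ.left_inv hy]

theorem IsHolChart.fderiv_ne_zero (hφ : IsHolChart φ)
    (hρ : ContMDiff 𝓘(ℝ, Cn n) 𝓘(ℝ, ℝ) ∞ ρ) (hz : z ∈ φ.target)
    (hd : mfderiv 𝓘(ℝ, Cn n) 𝓘(ℝ, ℝ) ρ (φ.symm z) ≠ 0) : fderiv ℝ (ρ ∘ φ.symm) z ≠ 0 := by
  set p := φ.symm z with hp
  set χ := chartAt (Cn n) p
  have hs : p ∈ χ.source := mem_chart_source _ _
  have hps : p ∈ φ.source := φ.map_target hz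
  have hpz : φ p = z := φ.right_inv hz
  intro h0
  apply hd
  have h1 := ((isHolChart_chartAt p).contDiffAt_transition hφ (χ.map_source hs)
    (by rwa [χ.left_inv hs])).restrict_scalars ℝ
  have e1 : (φ ∘ χ.symm) (χ p) = z := by simp [χ.left_inv hs, hpz]
  have h2 : (ρ ∘ χ.symm) =ᶠ[𝓝 (χ p)] (ρ ∘ φ.symm) ∘ (φ ∘ χ.symm) := by
    have h3 : ∀ᶠ y in 𝓝 (χ p), χ.symm y ∈ φ.source := by
      refine (χ.symm.continuousAt (χ.map_source hs)).eventually (φ.open_source.mem_nhds ?_)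
      rwa [χ.left_inv hs]
    filter_upwards [h3] with y hy
    simp [φ.left_inv hy]
  have h4 : fderiv ℝ (ρ ∘ χ.symm) (χ p) = 0 := by
    rw [h2.fderiv_eq, fderiv_comp _ (by
      rw [e1]; exact (hφ.contDiffAt_comp_symm hρ hz).differentiableAt (by simp))
      (h1.differentiableAt (by simp)), e1, h0, ContinuousLinearMap.zero_comp]
  refine ((hρ p).mdifferentiableAt (by simp)).mfderiv.trans ?_
  simp only [writtenInExtChartAt, extChartAt, mfld_simps, fderivWithin_univ]
  exact h4

end Chart

/-! ### One-sided derivatives -/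

theorem hasDerivAt_comp_line {E : Type*} [NormedAddCommGroup E] [NormedSpace ℝ E] {f : Cn n → E}
    {z : Cn n} (hf : DifferentiableAt ℝ f z) (v : Cn n) :
    HasDerivAt (fun t : ℝ => f (z + t • v)) (fderiv ℝ f z v) 0 := by
  have h1 : HasDerivAt (fun t : ℝ => z + t • v) v 0 := by
    simpa using ((hasDerivAt_id (0 : ℝ)).smul_const v).const_add z
  have h2 : HasFDerivAt f (fderiv ℝ f z) (z + (0 : ℝ) • v) := by simpa using hf.hasFDerivAt
  exact h2.comp_hasDerivAt 0 h1

theorem tendsto_line (z v : Cn n) :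
    Filter.Tendsto (fun t : ℝ => z + t • v) (𝓝[>] 0) (𝓝 z) := by
  have h : Continuous (fun t : ℝ => z + t • v) := by fun_prop
  simpa using (h.tendsto 0).mono_left nhdsWithin_le_nhds

theorem eventually_line_neg {u : Cn n → ℝ} {z v : Cn n} (hu : DifferentiableAt ℝ u z)
    (h0 : u z = 0) (hv : fderiv ℝ u z v < 0) : ∀ᶠ t : ℝ in 𝓝[>] 0, u (z + t • v) < 0 := by
  have h1 := (hasDerivAt_iff_tendsto_slope.1 (hasDerivAt_comp_line hu v)).eventually_lt_const hv
  have h2 : (𝓝[>] (0 : ℝ)) ≤ 𝓝[≠] 0 := nhdsWithin_mono _ fun t ht => ne_of_gt ht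
  filter_upwards [h2 h1, self_mem_nhdsWithin] with t ht ht0
  rw [slope_def_field, div_neg_iff] at ht
  simp only [zero_smul, add_zero, h0, sub_zero] at ht
  have : (0 : ℝ) < t := ht0
  rcases ht with h | h
  · linarith [h.2]
  · exact h.1

theorem exists_fderiv_neg {u : Cn n → ℝ} {z : Cn n} (h : fderiv ℝ u z ≠ 0) :
    ∃ v, fderiv ℝ u z v < 0 := by
  obtain ⟨v, hv⟩ : ∃ v, fderiv ℝ u z v ≠ 0 := by
    by_contra! h'
    exact h (ContinuousLinearMap.ext h')
  rcases lt_or_gt_of_ne hv with h1 | h1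
  · exact ⟨v, h1⟩
  · exact ⟨-v, by simpa using h1⟩

/-- A function that is `O(u²)` on `{u < 0}` vanishes to first order on `{u = 0}`. -/
theorem eq_zero_and_fderiv_eq_zero_of_le {E : Type*} [NormedAddCommGroup E] [NormedSpace ℝ E]
    {u : Cn n → ℝ} {G : Cn n → E} {z : Cn n} (hu : DifferentiableAt ℝ u z) (h0 : u z = 0)
    (hdu : fderiv ℝ u z ≠ 0) (hG : DifferentiableAt ℝ G z) {C : ℝ} {k : ℕ}
    (hb : ∀ᶠ y in 𝓝 z, u y < 0 → ‖G y‖ ≤ C * |u y| ^ (k + 2)) : G z = 0 ∧ fderiv ℝ G z = 0 := by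
  have key : ∀ v, fderiv ℝ u z v < 0 → ∀ᶠ t : ℝ in 𝓝[>] 0,
      ‖G (z + t • v)‖ ≤ C * |u (z + t • v)| ^ (k + 2) := fun v hv =>
    ((eventually_line_neg hu h0 hv).and ((tendsto_line z v).eventually hb)).mono fun t ht => ht.2 ht.1
  have hz : G z = 0 := by
    obtain ⟨v, hv⟩ := exists_fderiv_neg hdu
    have h1 := (hG.continuousAt.tendsto.comp (tendsto_line z v)).norm
    have h2 := ((hu.continuousAt.tendsto.comp (tendsto_line z v)).abs.pow (k + 2)).const_mul C
    have h3 := le_of_tendsto_of_tendsto h1 h2 (key v hv)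
    simp only [h0, abs_zero, ne_eq, Nat.add_eq_zero_iff, OfNat.ofNat_ne_zero, and_false,
      not_false_eq_true, zero_pow, mul_zero] at h3
    exact norm_le_zero_iff.1 h3
  -- Along a ray entering {u < 0}, |G|/t is at most C |u|^{k+1} times |u|/t, and the first factor
  -- tends to 0.
  have hd : ∀ v, fderiv ℝ u z v < 0 → fderiv ℝ G z v = 0 := fun v hv => by
    have h2 : (𝓝[>] (0 : ℝ)) ≤ 𝓝[≠] 0 := nhdsWithin_mono _ fun t ht => ne_of_gt ht
    have h1 := ((hasDerivAt_iff_tendsto_slope.1 (hasDerivAt_comp_line hG v)).mono_left h2).norm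
    have h3 := ((hasDerivAt_iff_tendsto_slope.1 (hasDerivAt_comp_line hu v)).mono_left h2).abs
    have h4 := ((hu.continuousAt.tendsto.comp (tendsto_line z v)).abs.pow (k + 1)).const_mul C
    have h5 := le_of_tendsto_of_tendsto h1 (h4.mul h3) (by
      filter_upwards [key v hv, self_mem_nhdsWithin] with t ht ht0
      have htp : (0 : ℝ) < t := ht0
      simp only [slope_def_module, sub_zero, zero_smul, add_zero, hz, h0, norm_smul,
        norm_inv, Real.norm_eq_abs, smul_eq_mul, abs_mul, abs_inv, abs_of_pos htp, Function.comp]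
      rw [inv_mul_le_iff₀ htp]
      calc _ ≤ _ := ht
        _ = _ := by field_simp; ring)
    simp only [h0, abs_zero, ne_eq, Nat.add_eq_zero_iff, one_ne_zero, and_false,
      not_false_eq_true, zero_pow, mul_zero, zero_mul] at h5
    exact norm_le_zero_iff.1 h5
  refine ⟨hz, ContinuousLinearMap.ext fun v => ?_⟩
  obtain ⟨w, hw⟩ := exists_fderiv_neg hdu
  -- Inward vectors span: s is chosen so that v + s w has du = -1, and dG already vanishes on w.
  obtain ⟨s, hs⟩ : ∃ s : ℝ, fderiv ℝ u z (v + s • w) < 0 := by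
    refine ⟨-(fderiv ℝ u z v + 1) / fderiv ℝ u z w, ?_⟩
    rw [map_add, map_smul, smul_eq_mul, div_mul_cancel₀ _ hw.ne]
    linarith
  have := hd _ hs
  rwa [map_add, map_smul, hd w hw, smul_zero, add_zero] at this

/-! ### The boundary -/

section Boundary

variable {N : Type*} [TopologicalSpace N] [ChartedSpace (Cn n) N] {ρ : N → ℝ}

theorem IsDefiningFunction.continuous (hρ : IsDefiningFunction (n := n) ρ) : Continuous ρ :=
  hρ.smooth.continuous

theorem IsDefiningFunction.isOpen_inside (hρ : IsDefiningFunction (n := n) ρ) :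
    IsOpen (inside ρ) :=
  isOpen_lt hρ.continuous continuous_const

theorem IsDefiningFunction.eq_zero (hρ : IsDefiningFunction (n := n) ρ) {p : N}
    (hp : p ∈ bdry ρ) : ρ p = 0 := by
  rw [bdry, hρ.isOpen_inside.frontier_eq] at hp
  have h1 : ρ p ≤ 0 := closure_minimal (fun q (hq : ρ q < 0) => hq.le)
    (isClosed_le hρ.continuous continuous_const) hp.1
  exact le_antisymm h1 (not_lt.1 hp.2)

theorem closure_inside (ρ : N → ℝ) : closure (inside ρ) = inside ρ ∪ bdry ρ :=
  closure_eq_self_union_frontier _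

/-- A ray along which u decreases lies in X for small positive times, so the point is a limit of
points of X without belonging to X. -/
theorem mem_bdry_of_fderiv_ne_zero (hρ : IsDefiningFunction (n := n) ρ)
    {φ : OpenPartialHomeomorph N (Cn n)} {z : Cn n} (hz : z ∈ φ.target)
    (hu : DifferentiableAt ℝ (ρ ∘ φ.symm) z) (hd : fderiv ℝ (ρ ∘ φ.symm) z ≠ 0)
    (h0 : (ρ ∘ φ.symm) z = 0) : φ.symm z ∈ bdry ρ := by
  rw [bdry, hρ.isOpen_inside.frontier_eq]
  obtain ⟨v, hv⟩ := exists_fderiv_neg hd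
  refine ⟨?_, fun h => (ne_of_lt (show ρ (φ.symm z) < 0 from h)) h0⟩
  exact mem_closure_of_tendsto ((φ.symm.continuousAt hz).tendsto.comp (tendsto_line z v))
    (eventually_line_neg hu h0 hv)

end Boundary

/-! ### Holomorphic changes of coordinates -/

section Holomorphic

variable {τ : Cn n → Cn n} {f : Cn n → ℂ} {z : Cn n}

theorem fderiv_of_holomorphic (hf : ContDiffAt ℂ ω f z) (v : Cn n) :
    fderiv ℝ f z v = fderiv ℂ f z v := by
  rw [(hf.differentiableAt (by simp)).fderiv_restrictScalars ℝ]
  rfl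

theorem isLinearMap_fderiv_of_holomorphic (hf : ContDiffAt ℂ ω f z) :
    IsLinearMap ℂ (fun v => fderiv ℝ f z v) := by
  simp only [fderiv_of_holomorphic hf]
  exact ⟨map_add _, map_smul _⟩

theorem delbar_of_holomorphic (hf : ContDiffAt ℂ ω f z) (v : Cn n) : delbar f z v = 0 :=
  eval01_of_linear (isLinearMap_fderiv_of_holomorphic hf) v

theorem del_conj_of_holomorphic (hf : ContDiffAt ℂ ω f z) (v : Cn n) :
    del (fun y => conj (f y)) z v = 0 := by
  rw [del_conj, delbar_of_holomorphic hf, map_zero]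

theorem smooth_of_holomorphic (hf : ContDiffAt ℂ ω f z) : ContDiffAt ℝ ∞ f z :=
  (hf.restrict_scalars ℝ).of_le le_top

theorem smooth_conj {g : Cn n → ℂ} (hg : ContDiffAt ℝ ∞ g z) :
    ContDiffAt ℝ ∞ (fun y => conj (g y)) z :=
  Complex.conjCLE.contDiff.contDiffAt.comp z hg

theorem fderiv_comp_of_holomorphic (hτ : ContDiffAt ℂ ω τ z) (hf : DifferentiableAt ℝ f (τ z))
    (v : Cn n) : fderiv ℝ (f ∘ τ) z v = fderiv ℝ f (τ z) (fderiv ℂ τ z v) := by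
  have h := hτ.differentiableAt (by simp)
  rw [fderiv_comp z hf (h.restrictScalars ℝ), h.fderiv_restrictScalars ℝ]
  rfl

theorem del_comp (hτ : ContDiffAt ℂ ω τ z) (hf : DifferentiableAt ℝ f (τ z)) (v : Cn n) :
    del (f ∘ τ) z v = del f (τ z) (fderiv ℂ τ z v) := by
  simp only [del, eval10, fderiv_comp_of_holomorphic hτ hf, map_smul]

theorem delbar_comp (hτ : ContDiffAt ℂ ω τ z) (hf : DifferentiableAt ℝ f (τ z)) (v : Cn n) :
    delbar (f ∘ τ) z v = delbar f (τ z) (fderiv ℂ τ z v) := by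
  simp only [delbar, eval01, fderiv_comp_of_holomorphic hτ hf, map_smul]

/-- The complex Jacobian matrix, with rows the partial derivatives. -/
noncomputable def jac (τ : Cn n → Cn n) (z : Cn n) : Matrix (Fin (n + 1)) (Fin (n + 1)) ℂ :=
  Matrix.of fun i k => fderiv ℂ τ z (stdVec i) k

theorem holomorphic_jac (hτ : ContDiffAt ℂ ω τ z) (i k : Fin (n + 1)) :
    ContDiffAt ℂ ω (fun y => jac τ y i k) z :=
  contDiffAt_pi.1 ((hτ.fderiv_right (m := ω) le_top).clm_apply contDiffAt_const) k

theorem holomorphic_det_jac (hτ : ContDiffAt ℂ ω τ z) :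
    ContDiffAt ℂ ω (fun y => (jac τ y).det) z := by
  simp only [Matrix.det_apply']
  exact ContDiffAt.sum fun σ _ => contDiffAt_const.mul
    (contDiffAt_prod fun i _ => holomorphic_jac hτ _ _)

theorem del_comp_stdVec (hτ : ContDiffAt ℂ ω τ z) (hf : DifferentiableAt ℝ f (τ z))
    (i : Fin (n + 1)) :
    del (f ∘ τ) z (stdVec i) = ∑ l, jac τ z i l * del f (τ z) (stdVec l) := by
  rw [del_comp hτ hf, del_eq_sum]
  rfl

theorem delbar_comp_stdVec (hτ : ContDiffAt ℂ ω τ z) (hf : DifferentiableAt ℝ f (τ z))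
    (j : Fin (n + 1)) :
    delbar (f ∘ τ) z (stdVec j) = ∑ k, conj (jac τ z j k) * delbar f (τ z) (stdVec k) := by
  rw [delbar_comp hτ hf, delbar_eq_sum]
  rfl

variable {u : Cn n → ℝ}

/-- The chain rule has no second-order term: ∂ annihilates the conjugated Jacobian entries. -/
theorem hess_comp (hτ : ContDiffAt ℂ ω τ z) (hu : ∀ᶠ y in 𝓝 (τ z), ContDiffAt ℝ ∞ u y) :
    hess (u ∘ τ) z = jac τ z * hess u (τ z) * (jac τ z)ᴴ := by
  have hs : ∀ k, ContDiffAt ℝ ∞ (fun y => delbar (cx u) y (stdVec k)) (τ z) := fun k =>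
    contDiffAt_delbar (contDiffAt_cx hu.self_of_nhds) _
  have hτs : ContDiffAt ℝ ∞ τ z := (hτ.restrict_scalars ℝ).of_le le_top
  ext i j
  have h1 : (fun y => delbar (cx (u ∘ τ)) y (stdVec j)) =ᶠ[𝓝 z] fun y => ∑ k,
      conj (jac τ y j k) * ((fun y => delbar (cx u) y (stdVec k)) ∘ τ) y := by
    filter_upwards [hτ.eventually (by simp), hτ.continuousAt.eventually hu] with y hy hy'
    exact delbar_comp_stdVec hy (contDiffAt_cx hy').diffAt j
  have hj : ∀ k, DifferentiableAt ℝ (fun y => conj (jac τ y j k)) z := fun k =>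
    (smooth_conj (smooth_of_holomorphic (holomorphic_jac hτ j k))).diffAt
  have hc : ∀ k, DifferentiableAt ℝ ((fun y => delbar (cx u) y (stdVec k)) ∘ τ) z := fun k =>
    ((hs k).comp z hτs).diffAt
  change del (fun y => delbar (cx (u ∘ τ)) y (stdVec j)) z (stdVec i) = _
  rw [(isDer_del z _).congr _ _ h1, (isDer_del z _).sum _ _ fun k _ => (hj k).fun_mul (hc k)]
  simp only [Matrix.mul_apply, Matrix.conjTranspose_apply]
  refine Finset.sum_congr rfl fun k _ => ?_
  rw [(isDer_del z _).mul _ _ (hj k) (hc k), del_conj_of_holomorphic (holomorphic_jac hτ j k),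
    zero_mul, zero_add, del_comp_stdVec hτ (hs k).diffAt, mul_comm]
  rfl

theorem bordered_comp (hτ : ContDiffAt ℂ ω τ z) (hu : ∀ᶠ y in 𝓝 (τ z), ContDiffAt ℝ ∞ u y) :
    bordered (u ∘ τ) z = Matrix.fromBlocks 1 0 0 (jac τ z) * bordered u (τ z) *
      (Matrix.fromBlocks 1 0 0 (jac τ z))ᴴ := by
  have hd := (contDiffAt_cx hu.self_of_nhds).diffAt
  simp only [bordered, Matrix.fromBlocks_conjTranspose, Matrix.fromBlocks_multiply,
    Matrix.one_mul, Matrix.zero_mul, Matrix.mul_zero, add_zero, zero_add, Matrix.conjTranspose_zero,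
    Matrix.conjTranspose_one, Matrix.mul_one, hess_comp hτ hu]
  congr 1
  · ext _ j
    refine (delbar_comp_stdVec hτ hd j).trans ?_
    simp only [Matrix.mul_apply, Matrix.of_apply, Matrix.conjTranspose_apply]
    exact Finset.sum_congr rfl fun k _ => mul_comm _ _
  · ext i _
    exact del_comp_stdVec hτ hd i

theorem mongeAmpere_comp (hτ : ContDiffAt ℂ ω τ z) (hu : ∀ᶠ y in 𝓝 (τ z), ContDiffAt ℝ ∞ u y) :
    mongeAmpere (u ∘ τ) z =
      (jac τ z).det * conj (jac τ z).det * mongeAmpere u (τ z) := by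
  rw [mongeAmpere_eq_det, bordered_comp hτ hu, Matrix.det_mul, Matrix.det_mul,
    Matrix.det_conjTranspose, Matrix.det_fromBlocks_zero₂₁, Matrix.det_one, one_mul,
    mongeAmpere_eq_det, starRingEnd_apply]
  ring

/-- If `J[u] = -|f|² + O(u²)` with `f` holomorphic on the side `u < 0`, then `∂∂̄ log |J[u]|`
vanishes on the complex tangent spaces of `u = 0`. -/
theorem mongeAmpere_mul_eq_of_le (hu : ∀ᶠ y in 𝓝 z, ContDiffAt ℝ ∞ u y) (h0 : u z = 0)
    (hdu : fderiv ℝ u z ≠ 0) (hf : ContDiffAt ℂ ω f z) {C : ℝ} {k : ℕ}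
    (hb : ∀ᶠ y in 𝓝 z, u y < 0 →
      ‖mongeAmpere u y + f y * conj (f y)‖ ≤ C * |u y| ^ (k + 2)) {x y : Cn n}
    (hy : del (cx u) z y = 0) :
    mongeAmpere u z * delbar (fun w => del (mongeAmpere u) w x) z y =
      del (mongeAmpere u) z x * delbar (mongeAmpere u) z y := by
  have hu0 := hu.self_of_nhds
  have hfe : ∀ᶠ w in 𝓝 z, ContDiffAt ℂ ω f w := hf.eventually (by simp)
  have hJ : ∀ w, ContDiffAt ℝ ∞ u w → ContDiffAt ℝ ∞ (mongeAmpere u) w := fun w hw =>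
    (smooth_bordered hw).det
  have hff : ∀ w, ContDiffAt ℂ ω f w → ContDiffAt ℝ ∞ (fun y => f y * conj (f y)) w := fun w hw =>
    (smooth_of_holomorphic hw).mul (smooth_conj (smooth_of_holomorphic hw))
  set G : Cn n → ℂ := fun y => mongeAmpere u y + f y * conj (f y) with hGdef
  have hG : ContDiffAt ℝ ∞ G z := (hJ z hu0).add (hff z hf)
  have hdu' : ∀ᶠ w in 𝓝 z, fderiv ℝ u w ≠ 0 :=
    (hu0.fderiv_right (m := ∞) (by simp)).continuousAt.eventually_ne hdu
  have hG0 : ∀ᶠ w in 𝓝 z, u w = u z → G w = 0 ∧ fderiv ℝ G w = 0 := by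
    filter_upwards [hu, hfe, hdu', hb.eventually_nhds] with w hw hw' hdw hbw huw
    exact eq_zero_and_fderiv_eq_zero_of_le (hw.differentiableAt (by simp)) (huw.trans h0) hdw
      ((hJ w hw).add (hff w hw')).diffAt hbw
  obtain ⟨hGz, hdGz⟩ := hG0.self_of_nhds rfl
  have hdel : ∀ w v, del G w v = eval10 (fun x => fderiv ℝ G w x) v := fun _ _ => rfl
  -- dG vanishes on the whole level set, so ∂_x G does too. Its derivatives along y and iy vanish
  -- because ∂u(y) = 0 makes both tangential; x is unrestricted.
  have e1 : delbar (fun w => del G w x) z y = 0 := by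
    have h1 : ∀ v, v ∈ Tangent u z → fderiv ℝ (fun w => del G w x) z v = 0 := fun v hv =>
      fderiv_eq_zero_of_tangent (contDiffAt_del hG x) hu0 hdu
        (hG0.mono fun w hw hwu => by simp [hdel, (hw hwu).2, eval10]) hv
    have hyI : del (cx u) z (Complex.I • y) = 0 := by
      rw [(isLinearMap_del _ z).map_smul, hy, smul_zero]
    simp only [delbar, eval01, h1 y (mem_tangent_of_del_eq_zero hu0 hy),
      h1 _ (mem_tangent_of_del_eq_zero hu0 hyI)]
    simp
  have split : ∀ᶠ w in 𝓝 z, ∀ v, del G w v = del (mongeAmpere u) w v + del f w v * conj (f w) ∧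
      delbar G w v = delbar (mongeAmpere u) w v + f w * conj (del f w v) := by
    filter_upwards [hu, hfe] with w hw hw' v
    have hs := smooth_of_holomorphic hw'
    constructor
    · rw [(isDer_del w v).add _ _ (hJ w hw).diffAt (hff w hw').diffAt,
        (isDer_del w v).mul _ _ hs.diffAt (smooth_conj hs).diffAt, del_conj_of_holomorphic hw']
      ring
    · rw [(isDer_delbar w v).add _ _ (hJ w hw).diffAt (hff w hw').diffAt,
        (isDer_delbar w v).mul _ _ hs.diffAt (smooth_conj hs).diffAt, delbar_of_holomorphic hw',
        delbar_conj]
      ring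
  have hfs := smooth_of_holomorphic hf
  have e2 : delbar (fun w => del f w x) z y = 0 := by
    rw [delbar_del_comm hfs, (isDer_del z x).congr _ (fun _ => 0)
      (hfe.mono fun w hw => delbar_of_holomorphic hw y), (isDer_del z x).const]
  have e3 : delbar (fun w => del G w x) z y =
      delbar (fun w => del (mongeAmpere u) w x) z y + del f z x * conj (del f z y) := by
    rw [(isDer_delbar z y).congr _ _ (split.mono fun w hw => (hw x).1),
      (isDer_delbar z y).add _ _ (contDiffAt_del (hJ z hu0) x).diffAt
        (((contDiffAt_del hfs x).mul (smooth_conj hfs)).diffAt),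
      (isDer_delbar z y).mul _ _ (contDiffAt_del hfs x).diffAt (smooth_conj hfs).diffAt, e2,
      delbar_conj]
    ring
  have e4 := (split.self_of_nhds x).1
  have e5 := (split.self_of_nhds y).2
  have e6 : del G z x = 0 := by simp [del, hdGz, eval10]
  have e7 : delbar G z y = 0 := by simp [delbar, hdGz, eval01]
  rw [e6] at e4; rw [e7] at e5; rw [e1] at e3
  have e8 : mongeAmpere u z + f z * conj (f z) = 0 := hGz
  have e9 : mongeAmpere u z = -(f z * conj (f z)) := by linear_combination e8
  have e10 : del (mongeAmpere u) z x = -(del f z x * conj (f z)) := by linear_combination -e4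
  have e11 : delbar (mongeAmpere u) z y = -(f z * conj (del f z y)) := by linear_combination -e5
  -- To this order J behaves like -|f|², for which J ∂∂̄J = ∂J ∂̄J identically.
  have e12 : delbar (fun w => del (mongeAmpere u) w x) z y = -(del f z x * conj (del f z y)) := by
    linear_combination -e3
  rw [e9, e10, e11, e12]
  ring

end Holomorphic

/-! ### The Monge-Ampère condition in an arbitrary holomorphic chart -/

section Manifold

variable {N : Type*} [TopologicalSpace N] [ChartedSpace (Cn n) N] [IsManifold 𝓘(ℂ, Cn n) ω N]
  {φ : OpenPartialHomeomorph N (Cn n)} {ρ : N → ℝ} {z : Cn n}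

theorem IsHolChart.eventually_smooth (hφ : IsHolChart φ) (hρ : IsDefiningFunction (n := n) ρ)
    (hz : z ∈ φ.target) : ∀ᶠ y in 𝓝 z, ContDiffAt ℝ ∞ (ρ ∘ φ.symm) y :=
  Filter.Eventually.mono (φ.open_target.mem_nhds hz) fun _ hy => hφ.contDiffAt_comp_symm hρ.smooth hy

/-- The equation is given only in some chart χ around each point. Passing to φ multiplies J by |det
τ'|² for the transition map τ, so `mongeAmpere_mul_eq_of_le` applies with f = det τ'. -/
theorem IsGlobalApproxSolution.mongeAmpere_mul_eq (hMA : IsGlobalApproxSolution (n := n) ρ)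
    (hρ : IsDefiningFunction (n := n) ρ) (hφ : IsHolChart φ) (hz : z ∈ φ.target)
    (hb : φ.symm z ∈ bdry ρ) {x y : Cn n}
    (hy : del (cx (ρ ∘ φ.symm)) z y = 0) :
    mongeAmpere (ρ ∘ φ.symm) z * delbar (fun w => del (mongeAmpere (ρ ∘ φ.symm)) w x) z y =
      del (mongeAmpere (ρ ∘ φ.symm)) z x * delbar (mongeAmpere (ρ ∘ φ.symm)) z y := by
  obtain ⟨χ, hχ, hs, hO⟩ := hMA _ hb
  set τ : Cn n → Cn n := χ ∘ φ.symm
  have hτ : ContDiffAt ℂ ω τ z := hφ.contDiffAt_transition hχ hz hs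
  obtain ⟨C, hC⟩ := hO.bound
  rw [eventually_nhdsWithin_iff] at hC
  have hf := holomorphic_det_jac hτ
  have hsrc : ∀ᶠ w in 𝓝 z, φ.symm w ∈ χ.source :=
    (φ.symm.continuousAt hz).eventually (χ.open_source.mem_nhds hs)
  have hcomp : ∀ w, φ.symm w ∈ χ.source → ((ρ ∘ χ.symm) ∘ τ) w = (ρ ∘ φ.symm) w := fun w hw => by
    simp [τ, χ.left_inv hw]
  -- A local bound for |det τ'|², so that the error in the chart φ is still O(u^{n+2}).
  have hK : ∀ᶠ w in 𝓝 z, ‖(jac τ w).det * conj (jac τ w).det‖ ≤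
      ‖(jac τ z).det * conj (jac τ z).det‖ + 1 :=
    (((smooth_of_holomorphic hf).mul (smooth_conj (smooth_of_holomorphic hf))).continuousAt.norm
      |>.eventually_lt_const (lt_add_one _)).mono fun _ h => h.le
  refine mongeAmpere_mul_eq_of_le (hφ.eventually_smooth hρ hz) (hρ.eq_zero hb)
    (hφ.fderiv_ne_zero hρ.smooth hz (hρ.deriv_ne_zero _ hb)) hf (k := n)
    (C := (‖(jac τ z).det * conj (jac τ z).det‖ + 1) * C) ?_ hy
  filter_upwards [hτ.eventually (by simp), hsrc, hsrc.eventually_nhds, hK,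
    hτ.continuousAt.eventually hC] with w h1 h2 h3 h4 h5 hneg
  have e1 : mongeAmpere (ρ ∘ φ.symm) w = mongeAmpere ((ρ ∘ χ.symm) ∘ τ) w := by
    have h : cx (ρ ∘ φ.symm) =ᶠ[𝓝 w] cx ((ρ ∘ χ.symm) ∘ τ) :=
      h3.mono fun y hy => congrArg Complex.ofReal (hcomp y hy).symm
    have h' : bordered (ρ ∘ φ.symm) w = bordered ((ρ ∘ χ.symm) ∘ τ) w := by
      ext (_ | i) (_ | j)
      · exact h.self_of_nhds
      · exact (isDer_delbar w _).congr _ _ h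
      · exact (isDer_del w _).congr _ _ h
      · exact (isDer_del w _).congr _ _ (h.eventually_nhds.mono fun y hy =>
          (isDer_delbar y _).congr _ _ hy)
    rw [mongeAmpere_eq_det, h', mongeAmpere_eq_det]
  have hτw : τ w ∈ χ.target := χ.map_source h2
  rw [e1, mongeAmpere_comp h1 (hχ.eventually_smooth hρ hτw)]
  have e2 : (ρ ∘ χ.symm) (τ w) = (ρ ∘ φ.symm) w := hcomp w h2
  have h6 := h5 (by rwa [e2])
  rw [e2, norm_pow, Real.norm_eq_abs] at h6
  rw [show (jac τ w).det * conj (jac τ w).det * mongeAmpere (ρ ∘ χ.symm) (τ w) +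
    (jac τ w).det * conj (jac τ w).det = (jac τ w).det * conj (jac τ w).det *
      (mongeAmpere (ρ ∘ χ.symm) (τ w) + 1) by ring, norm_mul, mul_assoc]
  exact mul_le_mul h4 h6 (norm_nonneg _) (by positivity)

end Manifold

/-! ### Existence of admissible frames -/

section

variable {u : Cn n → ℝ} {z : Cn n}

theorem del_cx_ne_zero (hu : ContDiffAt ℝ ∞ u z) (hdu : fderiv ℝ u z ≠ 0) :
    ∃ i, del (cx u) z (stdVec i) ≠ 0 := by
  by_contra! h
  refine hdu (ContinuousLinearMap.ext fun v => mem_tangent_of_del_eq_zero hu ?_)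
  rw [del_eq_sum]
  simp [h]

/-- The bordered Hessian with its corner entry replaced by zero. -/
noncomputable def cornerless (u : Cn n → ℝ) (z : Cn n) : Matrix (Idx n) (Idx n) ℂ :=
  Matrix.fromBlocks 0
    (Matrix.of fun (_ : Unit) j => delbar (cx u) z (stdVec j))
    (Matrix.of fun i (_ : Unit) => del (cx u) z (stdVec i))
    (hess u z)

theorem cornerless_eq_bordered (h0 : u z = 0) : cornerless u z = bordered u z := by
  rw [cornerless, bordered]
  congr 1
  ext
  simp [cx, h0]

theorem smooth_cornerless (hu : ContDiffAt ℝ ∞ u z) : EntrySmoothAt (cornerless u) z := by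
  rintro (_ | i) (_ | j)
  · exact contDiffAt_const
  · exact smooth_bordered hu (Sum.inl ()) (Sum.inr j)
  · exact smooth_bordered hu (Sum.inr i) (Sum.inl ())
  · exact smooth_bordered hu (Sum.inr i) (Sum.inr j)

/-- Let (c, v) be a left null vector. The border column says ∂u(v) = 0; pairing the remaining
equations with v̄ gives Levi form zero, so v = 0, and then c = 0 since ∂u ≠ 0. -/
theorem det_cornerless_ne_zero (hu : ContDiffAt ℝ ∞ u z) (hdu : fderiv ℝ u z ≠ 0)
    (hL : ∀ v : Cn n, v ≠ 0 → del (cx u) z v = 0 → 0 < (leviForm u z v v).re) :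
    (cornerless u z).det ≠ 0 := by
  intro hdet
  obtain ⟨w, hw, hw0⟩ := Matrix.exists_vecMul_eq_zero_iff.2 hdet
  set v : Cn n := fun i => w (Sum.inr i) with hv
  have e1 : del (cx u) z v = 0 := by
    have := congrFun hw0 (Sum.inl ())
    rw [del_eq_sum]
    simpa [Matrix.vecMul, dotProduct, cornerless] using this
  have e2 : ∀ j, w (Sum.inl ()) * delbar (cx u) z (stdVec j) + ∑ i, v i * hess u z i j = 0 :=
    fun j => by
      have := congrFun hw0 (Sum.inr j)
      simpa [Matrix.vecMul, dotProduct, cornerless] using this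
  have e3 : leviForm u z v v = 0 := by
    have h1 : ∑ j, (w (Sum.inl ()) * delbar (cx u) z (stdVec j) + ∑ i, v i * hess u z i j)
        * conj (v j) = 0 := by simp [e2]
    have h2 : ∑ j, conj (v j) * delbar (cx u) z (stdVec j) = 0 := by
      rw [← delbar_eq_sum, ← conj_del_cx, e1, map_zero]
    have h3 : leviForm u z v v = ∑ j, (∑ i, v i * hess u z i j) * conj (v j) := by
      rw [leviForm, Finset.sum_comm]
      refine Finset.sum_congr rfl fun j _ => ?_
      rw [Finset.sum_mul]
      exact Finset.sum_congr rfl fun i _ => by ring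
    simp only [add_mul, Finset.sum_add_distrib] at h1
    have h4 : ∑ j, w (Sum.inl ()) * delbar (cx u) z (stdVec j) * conj (v j) =
        w (Sum.inl ()) * ∑ j, conj (v j) * delbar (cx u) z (stdVec j) := by
      rw [Finset.mul_sum]
      exact Finset.sum_congr rfl fun j _ => by ring
    rw [h4, h2, mul_zero, zero_add] at h1
    exact h3.trans h1
  have e4 : v = 0 := by
    by_contra h
    exact absurd (hL v h e1) (by simp [e3])
  obtain ⟨j, hj⟩ := del_cx_ne_zero hu hdu
  have e5 : w (Sum.inl ()) = 0 := by
    have := e2 j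
    simp only [e4, Pi.zero_apply, zero_mul, Finset.sum_const_zero, add_zero, mul_eq_zero] at this
    refine this.resolve_right ?_
    rw [← conj_del_cx]
    simpa using hj
  refine hw (funext fun a => ?_)
  rcases a with _ | i
  · exact e5
  · exact congrFun e4 i

/-- The transversal vector field `ξ`. -/
noncomputable def xi (u : Cn n → ℝ) (z : Cn n) : Cn n :=
  fun j => conj ((cornerless u z)⁻¹ (Sum.inr j) (Sum.inl ()))

/-- The first column of the inverse is (-r, conj ξ). The zero corner makes its top equation exactly
∂u(ξ) = 1, also where u ≠ 0; the other rows are the orthogonality relation, and contracting them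
with ξ identifies the scalar with r. -/
theorem xi_spec (hdet : IsUnit (cornerless u z).det) : del (cx u) z (xi u z) = 1 ∧
    ∀ i, ∑ j, hess u z i j * conj (xi u z j) =
      leviForm u z (xi u z) (xi u z) * del (cx u) z (stdVec i) := by
  have h := Matrix.mul_nonsing_inv _ hdet
  have e1 : del (cx u) z (xi u z) = 1 := by
    have h1 := congrArg conj (congrFun (congrFun h (Sum.inl ())) (Sum.inl ()))
    rw [Matrix.mul_apply, Fintype.sum_sum_type] at h1
    have h2 : ∀ j, cornerless u z (Sum.inl ()) (Sum.inr j) = conj (del (cx u) z (stdVec j)) :=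
      fun _ => (conj_del_cx u z _).symm
    have h3 : ∀ j, cornerless u z (Sum.inl ()) (Sum.inl j) = 0 := fun _ => rfl
    simp only [h2, h3, zero_mul, Finset.sum_const_zero, zero_add, map_sum, map_mul,
      Matrix.one_apply_eq, map_one, Complex.conj_conj] at h1
    rw [del_eq_sum, ← h1]
    exact Finset.sum_congr rfl fun j _ => mul_comm _ _
  have e2 : ∀ i, ∑ j, hess u z i j * conj (xi u z j) =
      -(cornerless u z)⁻¹ (Sum.inl ()) (Sum.inl ()) * del (cx u) z (stdVec i) := fun i => by
    have h1 := congrFun (congrFun h (Sum.inr i)) (Sum.inl ())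
    rw [Matrix.mul_apply, Fintype.sum_sum_type, Matrix.one_apply_ne (by simp)] at h1
    simp only [xi, Complex.conj_conj]
    have h2 : ∀ j, cornerless u z (Sum.inr i) (Sum.inr j) = hess u z i j := fun _ => rfl
    have h3 : ∀ j, cornerless u z (Sum.inr i) (Sum.inl j) = del (cx u) z (stdVec i) := fun _ => rfl
    simp only [h2, h3, Finset.univ_unique, Finset.sum_singleton] at h1
    linear_combination h1
  refine ⟨e1, fun i => ?_⟩
  have e3 : leviForm u z (xi u z) (xi u z) = -(cornerless u z)⁻¹ (Sum.inl ()) (Sum.inl ()) := by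
    rw [leviForm_eq_sum]
    simp only [e2]
    generalize -(cornerless u z)⁻¹ (Sum.inl ()) (Sum.inl ()) = c
    refine Eq.trans ?_ ((congrArg (c * ·) ((del_eq_sum _ _ _).symm.trans e1)).trans (mul_one c))
    rw [Finset.mul_sum]
    exact Finset.sum_congr rfl fun j _ => by ring
  rw [e2, e3]

theorem smooth_xi (hu : ContDiffAt ℝ ∞ u z) (hdet : IsUnit (cornerless u z).det) :
    ContDiffAt ℝ ∞ (xi u) z :=
  contDiffAt_pi.2 fun _ => smooth_conj ((smooth_cornerless hu).inv hdet _ _)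

theorem exists_basis_ker (p : Cn n →ₗ[ℂ] ℂ) (hp : p ≠ 0) :
    ∃ e : Fin n → Cn n, LinearIndependent ℂ e ∧ ∀ α, p (e α) = 0 := by
  have h1 : Module.finrank ℂ (LinearMap.ker p) = n := by
    have := p.finrank_range_add_finrank_ker
    rw [LinearMap.range_eq_top.2 (LinearMap.surjective hp)] at this
    simp at this
    omega
  let b := Module.finBasisOfFinrankEq ℂ (LinearMap.ker p) h1
  exact ⟨fun α => b α, b.linearIndependent.map' (Submodule.subtype _) (Submodule.ker_subtype _),
    fun α => (b α).2⟩

/-- The frame `ξ, e_α - ∂u(e_α) ξ`. -/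
noncomputable def kerFrame (u : Cn n → ℝ) (e : Fin n → Cn n) (a : Fin (n + 1)) (z : Cn n) : Cn n :=
  Fin.cases (xi u z) (fun α => e α - del (cx u) z (e α) • xi u z) a

theorem smooth_kerFrame (hu : ContDiffAt ℝ ∞ u z) (hdet : IsUnit (cornerless u z).det)
    (e : Fin n → Cn n) (a : Fin (n + 1)) : ContDiffAt ℝ ∞ (kerFrame u e a) z := by
  refine Fin.cases (smooth_xi hu hdet) (fun α => ?_) a
  exact contDiffAt_const.sub
    ((contDiffAt_del (contDiffAt_cx hu) _).smul (smooth_xi hu hdet))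

theorem exists_isAdmissibleFrame {T : Set (Cn n)} (hT : IsOpen T) (hz : z ∈ T)
    (hu : ∀ y ∈ T, ContDiffAt ℝ ∞ u y) (hdu : fderiv ℝ u z ≠ 0)
    (hL : ∀ v : Cn n, v ≠ 0 → del (cx u) z v = 0 → 0 < (leviForm u z v v).re) :
    ∃ V ⊆ T, z ∈ V ∧ ∃ W, IsAdmissibleFrame u V W := by
  have hu0 := hu z hz
  have hdet : IsUnit (cornerless u z).det := (det_cornerless_ne_zero hu0 hdu hL).isUnit
  obtain ⟨i, hi⟩ := del_cx_ne_zero hu0 hdu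
  obtain ⟨e, he, hek⟩ := exists_basis_ker (isLinearMap_del (cx u) z).mk'
    (fun h => hi (LinearMap.congr_fun h (stdVec i)))
  replace hek : ∀ α, del (cx u) z (e α) = 0 := hek
  have hxi := xi_spec hdet
  have hW : ∀ a, ContDiffAt ℝ ∞ (kerFrame u e a) z := smooth_kerFrame hu0 hdet e
  have hli : LinearIndependent ℂ (fun a => kerFrame u e a z) := by
    -- The correction -∂u(e_α) ξ vanishes at z itself, so independence is checked for (ξ, e) there
    -- and spreads by continuity.
    have h1 : (fun a => kerFrame u e a z) = Fin.cons (xi u z) e := by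
      funext a
      refine Fin.cases rfl (fun α => ?_) a
      simp [kerFrame, hek]
    rw [h1, linearIndependent_finCons]
    refine ⟨he, fun hmem => ?_⟩
    have h2 : Submodule.span ℂ (Set.range e) ≤ LinearMap.ker (isLinearMap_del (cx u) z).mk' :=
      Submodule.span_le.2 (by rintro _ ⟨α, rfl⟩; exact hek α)
    have h3 : del (cx u) z (xi u z) = 0 := h2 hmem
    exact one_ne_zero (hxi.1.symm.trans h3)
  have hFs : EntrySmoothAt (frameMatrix (kerFrame u e)) z := fun a j => contDiffAt_pi.1 (hW a) j
  have hFdet : (frameMatrix (kerFrame u e) z).det ≠ 0 := by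
    have := Matrix.linearIndependent_rows_iff_isUnit.1
      (show LinearIndependent ℂ (frameMatrix (kerFrame u e) z).row from hli)
    exact ((Matrix.isUnit_iff_isUnit_det _).1 this).ne_zero
  have hev : ∀ᶠ y in 𝓝 z, y ∈ T ∧ (cornerless u y).det ≠ 0 ∧
      (frameMatrix (kerFrame u e) y).det ≠ 0 :=
    Filter.Eventually.and (hT.mem_nhds hz) (((smooth_cornerless hu0).det.continuousAt.eventually_ne hdet.ne_zero).and
      (hFs.det.continuousAt.eventually_ne hFdet))
  obtain ⟨V, hV, hVo, hzV⟩ := eventually_nhds_iff.1 hev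
  refine ⟨V, fun y hy => (hV y hy).1, hzV, kerFrame u e, hVo, fun a y hy =>
    (smooth_kerFrame (hu y (hV y hy).1) (hV y hy).2.1.isUnit e a).contDiffWithinAt,
    fun y hy => ?_, fun y hy => (xi_spec (hV y hy).2.1.isUnit).1,
    fun y hy => (xi_spec (hV y hy).2.1.isUnit).2, fun y hy α => ?_⟩
  · exact Matrix.linearIndependent_rows_iff_isUnit.2
      ((Matrix.isUnit_iff_isUnit_det (frameMatrix (kerFrame u e) y)).2 (hV y hy).2.2.isUnit)
  · have hlin := isLinearMap_del (cx u) y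
    change del (cx u) y (e α - del (cx u) y (e α) • xi u y) = 0
    rw [hlin.map_sub, hlin.map_smul, (xi_spec (hV y hy).2.1.isUnit).1, smul_eq_mul, mul_one, sub_self]

end

/-! ### Admissible frames and boundary data on the manifold -/

section Manifold

variable {N : Type*} [TopologicalSpace N] [ChartedSpace (Cn n) N] [IsManifold 𝓘(ℂ, Cn n) ω N]
  {φ : OpenPartialHomeomorph N (Cn n)} {ρ : N → ℝ} {z : Cn n}

theorem IsStrictlyPseudoconvex.exists_isAdmissibleFrame (hM : IsStrictlyPseudoconvex (n := n) ρ)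
    (hρ : IsDefiningFunction (n := n) ρ) (hφ : IsHolChart φ) (hz : z ∈ φ.target)
    (hb : φ.symm z ∈ bdry ρ) :
    ∃ V ⊆ φ.target, z ∈ V ∧ ∃ W, IsAdmissibleFrame (ρ ∘ φ.symm) V W :=
  RenormBoundary.exists_isAdmissibleFrame φ.open_target hz
    (fun _ hy => hφ.contDiffAt_comp_symm hρ.smooth hy)
    (hφ.fderiv_ne_zero hρ.smooth hz (hρ.deriv_ne_zero _ hb)) (hM φ hφ z hz hb)

theorem IsStrictlyPseudoconvex.mongeAmpere_ne_zero (hM : IsStrictlyPseudoconvex (n := n) ρ)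
    (hρ : IsDefiningFunction (n := n) ρ) (hφ : IsHolChart φ) (hz : z ∈ φ.target)
    (hb : φ.symm z ∈ bdry ρ) : mongeAmpere (ρ ∘ φ.symm) z ≠ 0 := by
  rw [mongeAmpere_eq_det, ← cornerless_eq_bordered (hρ.eq_zero hb)]
  exact det_cornerless_ne_zero (hφ.contDiffAt_comp_symm hρ.smooth hz)
    (hφ.fderiv_ne_zero hρ.smooth hz (hρ.deriv_ne_zero _ hb)) (hM φ hφ z hz hb)

/-- The part of `V` where the bordered Hessian of `u` is nonsingular. -/
def regularSet (u : Cn n → ℝ) (V : Set (Cn n)) : Set (Cn n) := {z ∈ V | mongeAmpere u z ≠ 0}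

theorem IsAdmissibleFrame.isRegularFrame {u : Cn n → ℝ} {V : Set (Cn n)}
    {W : Fin (n + 1) → Cn n → Cn n} (hW : IsAdmissibleFrame u V W)
    (hu : ∀ y ∈ V, ContDiffAt ℝ ∞ u y) : IsRegularFrame u (regularSet u V) W where
  isOpen := by
    refine isOpen_iff_mem_nhds.2 fun z hz => ?_
    filter_upwards [hW.isOpen.mem_nhds hz.1,
      (smooth_bordered (hu z hz.1)).det.continuousAt.eventually_ne hz.2] with y h1 h2
    exact ⟨h1, h2⟩
  smooth a := (hW.smooth a).mono fun _ h => h.1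
  linearIndependent z hz := hW.linearIndependent z hz.1
  xi_normalized z hz := hW.xi_normalized z hz.1
  xi_orthogonal z hz := hW.xi_orthogonal z hz.1
  ker z hz := hW.ker z hz.1
  smooth_fun z hz := hu z hz.1
  det_ne_zero z hz := hz.2

variable {V : Set (Cn n)} {W : Fin (n + 1) → Cn n → Cn n}

theorem isBoundaryData (hn : 0 < n) (hρ : IsDefiningFunction (n := n) ρ)
    (hM : IsStrictlyPseudoconvex (n := n) ρ) (hMA : IsGlobalApproxSolution (n := n) ρ)
    (hφ : IsHolChart φ) (hV : V ⊆ φ.target) (hW : IsAdmissibleFrame (ρ ∘ φ.symm) V W)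
    {om : Fin n → Fin n → Cn n → (Cn n →L[ℝ] ℂ)} {A : Fin n → Fin n → Cn n → ℂ}
    (hTW : IsTanakaWebster (ρ ∘ φ.symm) (V ∩ φ.symm ⁻¹' bdry ρ) W om A) :
    IsBoundaryData (ρ ∘ φ.symm) (regularSet (ρ ∘ φ.symm) V) (V ∩ φ.symm ⁻¹' bdry ρ) W om A where
  pos := hn
  frame := hW.isRegularFrame fun _ hy => hφ.contDiffAt_comp_symm hρ.smooth (hV hy)
  mem z hz := ⟨⟨hz.1, hM.mongeAmpere_ne_zero hρ hφ (hV hz.1) hz.2⟩, hρ.eq_zero hz.2⟩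
  -- dρ stays nonzero near z, and zeros of ρ with dρ ≠ 0 are boundary points of X.
  locally_all z hz := by
    have hs := hφ.contDiffAt_comp_symm hρ.smooth (hV hz.1)
    filter_upwards [hW.isOpen.mem_nhds hz.1, (hs.fderiv_right (m := ∞) (by simp)).continuousAt.eventually_ne
      (hφ.fderiv_ne_zero hρ.smooth (hV hz.1) (hρ.deriv_ne_zero _ hz.2))] with y hy hdy hyu
    exact ⟨hy, mem_bdry_of_fderiv_ne_zero hρ (hV hy)
      ((hφ.contDiffAt_comp_symm hρ.smooth (hV hy)).differentiableAt (by simp)) hdy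
      (hyu.trans (hρ.eq_zero hz.2))⟩
  mongeAmpere_eq z hz _ _ hy := hMA.mongeAmpere_mul_eq hρ hφ (hV hz.1) hz.2 hy
  tanakaWebster := hTW

end Manifold

/-! ### The renormalized connection near the boundary -/

theorem IsDer.inv {z : Cn n} {δ : (Cn n → ℂ) → ℂ} (h : IsDer z δ) {f : Cn n → ℂ}
    (hf : DifferentiableAt ℝ f z) (h0 : f z ≠ 0) :
    δ (fun y => (f y)⁻¹) = -((f z)⁻¹ * (f z)⁻¹ * δ f) := by
  have h1 : δ (fun y => f y * (f y)⁻¹) = 0 := by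
    rw [h.congr _ (fun _ => 1) ((hf.continuousAt.eventually_ne h0).mono
      fun y hy => mul_inv_cancel₀ hy), h.const]
  rw [h.mul f _ hf (hf.fun_inv h0)] at h1
  have h2 := congrArg (fun c => (f z)⁻¹ * c) h1
  simp only [mul_add, ← mul_assoc, inv_mul_cancel₀ h0, one_mul, mul_zero] at h2
  linear_combination h2

section Potential

variable {u : Cn n → ℝ} {z : Cn n}

theorem cx_ne_zero (h0 : u z ≠ 0) : cx u z ≠ 0 := by
  simpa [cx] using h0

theorem smooth_log (hu : ContDiffAt ℝ ∞ u z) (h0 : u z ≠ 0) :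
    ContDiffAt ℝ ∞ (fun y => Real.log (-1 / u y)) z :=
  (contDiffAt_const.div hu h0).log (div_ne_zero (by norm_num) h0)

theorem fderiv_log (hu : ContDiffAt ℝ ∞ u z) (h0 : u z ≠ 0) (v : Cn n) :
    fderiv ℝ (cx fun y => Real.log (-1 / u y)) z v = -(cx u z)⁻¹ * fderiv ℝ (cx u) z v := by
  -- `Real.log` is even and vanishes at 0, so this holds for either sign of u and even at u = 0.
  have h1 : (fun y => Real.log (-1 / u y)) = fun y => -Real.log (u y) := by
    ext y
    rw [neg_div, Real.log_neg_eq_log, one_div, Real.log_inv]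
  rw [fderiv_cx (smooth_log hu h0), h1, fderiv_cx hu, fderiv_fun_neg,
    fderiv.log (hu.differentiableAt (by simp)) h0]
  simp [cx]

theorem delbar_log (hu : ContDiffAt ℝ ∞ u z) (h0 : u z ≠ 0) (v : Cn n) :
    delbar (cx fun y => Real.log (-1 / u y)) z v = -(cx u z)⁻¹ * delbar (cx u) z v := by
  simp only [delbar, eval01, fderiv_log hu h0]
  ring

theorem hess_log (hu : ∀ᶠ y in 𝓝 z, ContDiffAt ℝ ∞ u y) (h0 : u z ≠ 0) (i j : Fin (n + 1)) :
    hess (fun y => Real.log (-1 / u y)) z i j = -(cx u z)⁻¹ * hess u z i j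
      + (cx u z)⁻¹ * (cx u z)⁻¹ * (del (cx u) z (stdVec i) * delbar (cx u) z (stdVec j)) := by
  have hu0 := hu.self_of_nhds
  have hc := (contDiffAt_cx hu0).diffAt
  have hci := (hc.fun_inv (cx_ne_zero h0)).fun_neg
  have hd := (contDiffAt_delbar (contDiffAt_cx hu0) (stdVec j)).diffAt
  change del (fun y => delbar (cx fun y => Real.log (-1 / u y)) y (stdVec j)) z (stdVec i) = _
  rw [(isDer_del z _).congr _ (fun y => -(cx u y)⁻¹ * delbar (cx u) y (stdVec j))
    ((hu.and (hu0.continuousAt.eventually_ne h0)).mono fun y hy => delbar_log hy.1 hy.2 _),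
    (isDer_del z _).mul _ _ hci hd, (isDer_del z _).neg (hc.fun_inv (cx_ne_zero h0)),
    (isDer_del z _).inv hc (cx_ne_zero h0)]
  change _ + -(cx u z)⁻¹ * hess u z i j = _
  ring

theorem del_hess_log (hu : ∀ᶠ y in 𝓝 z, ContDiffAt ℝ ∞ u y) (h0 : u z ≠ 0) (i j : Fin (n + 1))
    (v : Cn n) : del (fun y => hess (fun y => Real.log (-1 / u y)) y i j) z v =
      (cx u z)⁻¹ * (cx u z)⁻¹ * del (cx u) z v * hess u z i j
      - (cx u z)⁻¹ * delH u z v (Sum.inr i) (Sum.inr j)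
      - 2 * (cx u z)⁻¹ * (cx u z)⁻¹ * (cx u z)⁻¹ * del (cx u) z v
        * (del (cx u) z (stdVec i) * delbar (cx u) z (stdVec j))
      + (cx u z)⁻¹ * (cx u z)⁻¹ * (delH u z v (Sum.inr i) (Sum.inl ()) * delbar (cx u) z (stdVec j)
        + del (cx u) z (stdVec i) * delH u z v (Sum.inl ()) (Sum.inr j)) := by
  have hu0 := hu.self_of_nhds
  have hs := (smooth_bordered hu0).diffAt
  have hc := (contDiffAt_cx hu0).diffAt
  have hci := hc.fun_inv (cx_ne_zero h0)
  have hd := isDer_del z v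
  have hij := hs (Sum.inr i) (Sum.inr j)
  have hi := hs (Sum.inr i) (Sum.inl ())
  have hj := hs (Sum.inl ()) (Sum.inr j)
  have e1 : (fun y => hess (fun y => Real.log (-1 / u y)) y i j) =ᶠ[𝓝 z] fun y =>
      -(cx u y)⁻¹ * bordered u y (Sum.inr i) (Sum.inr j) + (cx u y)⁻¹ * (cx u y)⁻¹ *
        (bordered u y (Sum.inr i) (Sum.inl ()) * bordered u y (Sum.inl ()) (Sum.inr j)) := by
    filter_upwards [hu.eventually_nhds, hu0.continuousAt.eventually_ne h0] with y hy hy0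
    exact hess_log hy hy0 i j
  rw [hd.congr _ _ e1, hd.add _ _ (hci.fun_neg.fun_mul hij)
    ((hci.fun_mul hci).fun_mul (hi.fun_mul hj)), hd.mul _ _ hci.fun_neg hij, hd.neg hci,
    hd.mul _ _ (hci.fun_mul hci) (hi.fun_mul hj), hd.mul _ _ hci hci, hd.mul _ _ hi hj,
    hd.inv hc (cx_ne_zero h0)]
  change -_ * hess u z i j + -_ * delH u z v (Sum.inr i) (Sum.inr j) +
    (_ * (del (cx u) z (stdVec i) * delbar (cx u) z (stdVec j)) +
      _ * (delH u z v (Sum.inr i) (Sum.inl ()) * delbar (cx u) z (stdVec j) +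
        del (cx u) z (stdVec i) * delH u z v (Sum.inl ()) (Sum.inr j))) = _
  ring

/-- The matrix of the singular part in the coordinate frame. -/
noncomputable def singularMatrix (u : Cn n → ℝ) (z v : Cn n) :
    Matrix (Fin (n + 1)) (Fin (n + 1)) ℂ :=
  -(cx u z)⁻¹ • (del (cx u) z v • (1 : Matrix (Fin (n + 1)) (Fin (n + 1)) ℂ)
    + Matrix.vecMulVec (fun i => del (cx u) z (stdVec i)) v)

/-- The Chern connection of the metric with potential `log (-1/u)` in the coordinate frame. -/
theorem mapDer_del_hess_log (hu : ∀ᶠ y in 𝓝 z, ContDiffAt ℝ ∞ u y) (h0 : u z ≠ 0)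
    (hdet : IsUnit (bordered u z).det) (v : Cn n) :
    mapDer (fun f => del f z v) (fun y => hess (fun y => Real.log (-1 / u y)) y) =
      ((connH u z v).toBlocks₂₂ + singularMatrix u z v) *
        hess (fun y => Real.log (-1 / u y)) z := by
  have hK : connH u z v * bordered u z = delH u z v := by
    rw [connH, Matrix.mul_assoc, Matrix.nonsing_inv_mul _ hdet, Matrix.mul_one]
  have hne := cx_ne_zero h0
  ext i j
  set K := connH u z v
  -- Here `e1` and `e2` are the entries of K H = ∂H in row i, and `e3` is row 0 of ∂H. They replace
  -- all derivatives of the Hessian, after which the K-terms into the trivial line cancel.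
  have e1 : K (Sum.inr i) (Sum.inl ()) * cx u z
      + ∑ k, K (Sum.inr i) (Sum.inr k) * del (cx u) z (stdVec k) =
      delH u z v (Sum.inr i) (Sum.inl ()) := by
    rw [← hK, Matrix.mul_apply, sum_idx]; rfl
  have e2 : K (Sum.inr i) (Sum.inl ()) * delbar (cx u) z (stdVec j)
      + ∑ k, K (Sum.inr i) (Sum.inr k) * hess u z k j = delH u z v (Sum.inr i) (Sum.inr j) := by
    rw [← hK, Matrix.mul_apply, sum_idx]; rfl
  have e3 : ∑ k, v k * hess u z k j = delH u z v (Sum.inl ()) (Sum.inr j) := by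
    rw [delH_inl, Matrix.vecMul, dotProduct, sum_idx]
    simp [emb, bordered]
  have e4 : ∑ k, v k * del (cx u) z (stdVec k) = del (cx u) z v := (del_eq_sum _ _ _).symm
  have e5 : ∑ k, K (Sum.inr i) (Sum.inr k) * hess (fun y => Real.log (-1 / u y)) z k j =
      -(cx u z)⁻¹ * ∑ k, K (Sum.inr i) (Sum.inr k) * hess u z k j
      + (cx u z)⁻¹ * (cx u z)⁻¹ * (∑ k, K (Sum.inr i) (Sum.inr k) * del (cx u) z (stdVec k))
        * delbar (cx u) z (stdVec j) := by
    simp only [hess_log hu h0, Finset.mul_sum, Finset.sum_mul, ← Finset.sum_add_distrib]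
    exact Finset.sum_congr rfl fun k _ => by ring
  have e6 : ∑ k, v k * hess (fun y => Real.log (-1 / u y)) z k j =
      -(cx u z)⁻¹ * ∑ k, v k * hess u z k j
      + (cx u z)⁻¹ * (cx u z)⁻¹ * (∑ k, v k * del (cx u) z (stdVec k))
        * delbar (cx u) z (stdVec j) := by
    simp only [hess_log hu h0, Finset.mul_sum, Finset.sum_mul, ← Finset.sum_add_distrib]
    exact Finset.sum_congr rfl fun k _ => by ring
  have e7 : (((K.toBlocks₂₂ + singularMatrix u z v) *
      hess (fun y => Real.log (-1 / u y)) z) i j) =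
      ∑ k, K (Sum.inr i) (Sum.inr k) * hess (fun y => Real.log (-1 / u y)) z k j
      - (cx u z)⁻¹ * (del (cx u) z v * hess (fun y => Real.log (-1 / u y)) z i j
        + del (cx u) z (stdVec i) * ∑ k, v k * hess (fun y => Real.log (-1 / u y)) z k j) := by
    rw [Matrix.add_mul, Matrix.add_apply, singularMatrix, Matrix.smul_mul, Matrix.smul_apply,
      Matrix.add_mul, Matrix.add_apply, Matrix.smul_mul, Matrix.one_mul, Matrix.smul_apply]
    simp only [Matrix.mul_apply, Matrix.toBlocks₂₂, Matrix.of_apply, Matrix.vecMulVec_apply,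
      smul_eq_mul, mul_assoc, ← Finset.mul_sum]
    ring
  rw [e7, e5, e6, e3, e4, hess_log hu h0]
  change del (fun y => hess (fun y => Real.log (-1 / u y)) y i j) z v = _
  rw [del_hess_log hu h0, ← e1, ← e2]
  field_simp
  ring

end Potential

/-! ### The renormalized connection and its curvature as smooth objects -/

section Connection

variable {u : Cn n → ℝ} {U : Set (Cn n)} {W : Fin (n + 1) → Cn n → Cn n} {z : Cn n}
  {G : Cn n → Matrix (Fin (n + 1)) (Fin (n + 1)) ℂ}

/-- Y is tensorial: its coordinate matrix -(1/u)(∂u(v) · 1 + (u_i v^j)) is merely conjugated by the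
frame, with no derivative of the frame. -/
theorem IsRegularFrame.singularPart_eq (h : IsRegularFrame u U W) (hz : z ∈ U)
    (a b : Fin (n + 1)) (v : Cn n) : singularPart u W a b z v =
      (frameMatrix W z * singularMatrix u z v * (frameMatrix W z)⁻¹) a b := by
  have h1 : ∑ k, del (cx u) z (W k z) * coframe W k z v = del (cx u) z v := by
    conv_rhs => rw [← h.sum_coframe_smul hz v]
    have hl := isLinearMap_del (cx u) z
    refine Eq.trans ?_ (map_sum hl.mk' (fun a => coframe W a z v • W a z) Finset.univ).symm
    exact Finset.sum_congr rfl fun k _ => (mul_comm _ _).trans (hl.map_smul _ _).symm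
  have h2 : frameMatrix W z * singularMatrix u z v * (frameMatrix W z)⁻¹ =
      -(cx u z)⁻¹ • (del (cx u) z v • (1 : Matrix (Fin (n + 1)) (Fin (n + 1)) ℂ)
        + Matrix.vecMulVec (frameMatrix W z *ᵥ fun i => del (cx u) z (stdVec i))
          (v ᵥ* (frameMatrix W z)⁻¹)) := by
    rw [singularMatrix, Matrix.mul_smul, Matrix.smul_mul, Matrix.mul_add, Matrix.add_mul,
      Matrix.mul_vecMulVec, Matrix.vecMulVec_mul, Matrix.mul_smul, Matrix.smul_mul, Matrix.mul_one,
      Matrix.mul_nonsing_inv _ (h.isUnit_det_frame hz)]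
  have h3 : (frameMatrix W z *ᵥ fun i => del (cx u) z (stdVec i)) a = del (cx u) z (W a z) :=
    (del_eq_sum _ _ _).symm
  have h4 : (v ᵥ* (frameMatrix W z)⁻¹) b = coframe W b z v := rfl
  have h5 : ∑ k, ((if a = b then 1 else 0) * del (cx u) z (W k z)
      + (if k = b then 1 else 0) * del (cx u) z (W a z)) * coframe W k z v =
      (if a = b then 1 else 0) * del (cx u) z v + del (cx u) z (W a z) * coframe W b z v := by
    simp only [add_mul, Finset.sum_add_distrib, mul_assoc]
    rw [← Finset.mul_sum, h1]
    simp only [ite_mul, one_mul, zero_mul, Finset.sum_ite_eq', Finset.mem_univ, if_true]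
  rw [h2, Matrix.smul_apply, Matrix.add_apply, Matrix.vecMulVec_apply, h3, h4, Matrix.smul_apply,
    singularPart, h5, Matrix.one_apply, smul_eq_mul, smul_eq_mul]
  ring

/-- Near the boundary the renormalized connection is the connection of the bordered Hessian. -/
theorem IsRegularFrame.renormConnection_eq (h : IsRegularFrame u U W) (hz : z ∈ U) (h0 : u z ≠ 0)
    (hG : G =ᶠ[𝓝 z] fun y => hess (fun x => Real.log (-1 / u x)) y) (hdet : IsUnit (G z).det)
    (a b : Fin (n + 1)) (v : Cn n) : renormConnection u G W a b z v = conn u W a b z v := by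
  have hGz : G z = hess (fun x => Real.log (-1 / u x)) z := hG.self_of_nhds
  have h1 : mapDer (fun f => del f z v) G * (G z)⁻¹ =
      (connH u z v).toBlocks₂₂ + singularMatrix u z v := by
    rw [mapDer_congr (isDer_del z v) hG,
      mapDer_del_hess_log (h.eventually_smooth hz) h0 (h.isUnit_det_bordered hz), ← hGz,
      Matrix.mul_assoc, Matrix.mul_nonsing_inv _ hdet, Matrix.mul_one]
  have h2 : chernConnection G W a b z v = ((mapDer (fd z v) (frameMatrix W) +
      frameMatrix W z * (mapDer (fun f => del f z v) G * (G z)⁻¹)) * (frameMatrix W z)⁻¹) a b := rfl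
  rw [renormConnection, h2, h1, h.singularPart_eq hz, h.conn_eq hz, ← Matrix.sub_apply]
  rw [Matrix.mul_add, ← add_assoc, Matrix.add_mul _ _ (frameMatrix W z)⁻¹, add_sub_cancel_right]

theorem renormCurvature_eq_of_eventually
    (hev : ∀ᶠ y in 𝓝 z, ∀ a b v, renormConnection u G W a b y v = conn u W a b y v)
    (a b : Fin (n + 1)) (v w : Cn n) : renormCurvature u G W a b z v w =
      extD (conn u W a b) z v w - ∑ c, wedge (conn u W a c) (conn u W c b) z v w := by
  have h1 : ∀ v w, fderiv ℝ (fun y => renormConnection u G W a b y w) z v =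
      fderiv ℝ (fun y => conn u W a b y w) z v := fun v w => by
    rw [Filter.EventuallyEq.fderiv_eq (hev.mono fun y hy => hy a b w)]
  simp only [renormCurvature, extD, wedge, h1, hev.self_of_nhds]

variable {V : Set (Cn n)}

/-- Needed at interior points of V, where g need not have the logarithmic potential and `conn` is
not available. -/
theorem IsAdmissibleFrame.smooth_renormConnection (h : IsAdmissibleFrame u V W) (hz : z ∈ V)
    (hu : ContDiffAt ℝ ∞ u z) (h0 : u z ≠ 0) (hG : EntrySmoothAt G z) (hdet : IsUnit (G z).det)
    (a b : Fin (n + 1)) (v : Cn n) :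
    ContDiffAt ℝ ∞ (fun y => renormConnection u G W a b y v) z := by
  have hF := h.smooth_frame hz
  have hFi := hF.inv (h.isUnit_det_frame hz)
  have hW : ∀ k i, ContDiffAt ℝ ∞ (fun y => W k y i) z := hF
  have hc := contDiffAt_cx hu
  have hdel : ∀ k, ContDiffAt ℝ ∞ (fun y => del (cx u) y (W k y)) z := fun k => by
    simp only [del_eq_sum (cx u) _ (W k _)]
    exact ContDiffAt.sum fun i _ => (hW k i).mul (contDiffAt_del hc _)
  have hcof : ∀ k, ContDiffAt ℝ ∞ (fun y => coframe W k y v) z := fun k =>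
    ContDiffAt.sum fun i _ => contDiffAt_const.mul (hFi i k)
  refine ContDiffAt.sub ?_ ?_
  · exact (((hF.fderiv v).add (hF.mul ((hG.del v).mul (hG.inv hdet)))).mul hFi) a b
  · refine ContDiffAt.mul ?_ (ContDiffAt.sum fun k _ => ((contDiffAt_const.mul (hdel k)).add
      (contDiffAt_const.mul (hdel a))).mul (hcof k))
    simp only [one_div]
    exact hc.neg.inv (neg_ne_zero.2 (cx_ne_zero h0))

theorem smooth_curvature {α : Fin (n + 1) → Fin (n + 1) → Cn n → Cn n → ℂ}
    (hα : ∀ a b v, ContDiffAt ℝ ∞ (fun y => α a b y v) z) (a b : Fin (n + 1)) (v w : Cn n) :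
    ContDiffAt ℝ ∞ (fun y => extD (α a b) y v w - ∑ c, wedge (α a c) (α c b) y v w) z :=
  ((contDiffAt_fderiv_apply (hα a b w) v).sub (contDiffAt_fderiv_apply (hα a b v) w)).sub
    (ContDiffAt.sum fun c _ => ((hα a c v).mul (hα c b w)).sub ((hα a c w).mul (hα c b v)))

end Connection

/-! ### Extension to the boundary -/

/-- Near a point of B the two formulas agree on S, so the glued function coincides there with h on a
full neighbourhood. -/
theorem continuousOn_ite {S B V : Set (Cn n)} [DecidablePred (· ∈ S)] {f h : Cn n → ℂ}
    (hS : ∀ z ∈ V ∩ S, S ∈ 𝓝 z) (hf : ∀ z ∈ V ∩ S, ContinuousAt f z)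
    (hh : ∀ z ∈ V ∩ B, ContinuousAt h z) (hfh : ∀ z ∈ V ∩ B, ∀ᶠ y in 𝓝 z, y ∈ S → f y = h y) :
    ContinuousOn (fun z => if z ∈ S then f z else h z) (V ∩ (S ∪ B)) := by
  rintro z ⟨hzV, hz⟩
  refine ContinuousAt.continuousWithinAt ?_
  rcases hz with hz | hz
  · refine (hf z ⟨hzV, hz⟩).congr ?_
    filter_upwards [hS z ⟨hzV, hz⟩] with y hy
    exact (if_pos hy).symm
  · refine (hh z ⟨hzV, hz⟩).congr ?_
    filter_upwards [hfh z ⟨hzV, hz⟩] with y hy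
    split_ifs with h1
    · exact (hy h1).symm
    · rfl

theorem eventually_mem_target {N : Type*} [TopologicalSpace N]
    {φ : OpenPartialHomeomorph N (Cn n)} {z : Cn n} (hz : z ∈ φ.target) {O : Set N} (hO : IsOpen O)
    (hzO : φ.symm z ∈ O) : ∀ᶠ y in 𝓝 z, y ∈ φ.target ∧ φ.symm y ∈ O :=
  Filter.Eventually.and (φ.open_target.mem_nhds hz)
    ((φ.symm.continuousAt hz).eventually (hO.mem_nhds hzO))

section Metric

variable {N : Type*} [TopologicalSpace N] [ChartedSpace (Cn n) N]
  {φ : OpenPartialHomeomorph N (Cn n)} {ρ : N → ℝ} {z : Cn n}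
  {g : ∀ x : N, TangentSpace 𝓘(ℂ, Cn n) x →ₗ[ℂ] TangentSpace 𝓘(ℂ, Cn n) x →ₗ⋆[ℂ] ℂ}

theorem IsHolChart.mfderiv_symm_ne_zero (hφ : IsHolChart φ) (hz : z ∈ φ.target) {v : Cn n}
    (hv : v ≠ 0) : mfderiv 𝓘(ℂ, Cn n) 𝓘(ℂ, Cn n) φ.symm z v ≠ 0 := by
  have hd : φ.MDifferentiable 𝓘(ℂ, Cn n) 𝓘(ℂ, Cn n) :=
    ⟨(contMDiffOn_of_mem_maximalAtlas hφ).mdifferentiableOn (by simp),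
      (contMDiffOn_symm_of_mem_maximalAtlas hφ).mdifferentiableOn (by simp)⟩
  intro h0
  have h1 := DFunLike.congr_fun (hd.comp_symm_deriv hz) v
  exact hv (h1.symm.trans
    ((congrArg (mfderiv 𝓘(ℂ, Cn n) 𝓘(ℂ, Cn n) φ (φ.symm z)) h0).trans (map_zero _)))

/-- A left null vector w of the matrix would give g(L w, L w) = 0 for the injective chart derivative
L, against positivity. -/
theorem IsAdaptedMetric.isUnit_det (hg : IsAdaptedMetric ρ g) (hφ : IsHolChart φ)
    (hz : z ∈ φ.target) (hi : φ.symm z ∈ inside ρ) : IsUnit (chartMetric g φ z).det := by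
  rw [isUnit_iff_ne_zero]
  intro hdet
  obtain ⟨w, hw, hw0⟩ := Matrix.exists_vecMul_eq_zero_iff.2 hdet
  set L := mfderiv 𝓘(ℂ, Cn n) 𝓘(ℂ, Cn n) φ.symm z
  have h1 : L w = ∑ i, w i • L (stdVec i) := by
    have hv : w = ∑ i, w i • stdVec i := by
      ext j; simp [stdVec, Pi.single_apply]
    conv_lhs => rw [hv]
    refine (map_sum L (fun i => w i • stdVec i) Finset.univ).trans ?_
    exact Finset.sum_congr rfl fun i _ => map_smul L _ _
  have h2 : ∀ j, g (φ.symm z) (L w) (L (stdVec j)) = 0 := fun j => by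
    have h3 : ∑ i, w i * g (φ.symm z) (L (stdVec i)) (L (stdVec j)) = 0 := congrFun hw0 j
    rw [h1, map_sum, LinearMap.sum_apply, ← h3]
    exact Finset.sum_congr rfl fun i _ => by rw [map_smul, LinearMap.smul_apply, smul_eq_mul]
  have h4 : g (φ.symm z) (L w) (L w) = 0 := by
    conv_lhs => rw [h1, map_sum]
    refine Finset.sum_eq_zero fun j _ => ?_
    rw [LinearMap.map_smulₛₗ, ← h1, h2, smul_zero]
  have := hg.pos _ hi (L w) (hφ.mfderiv_symm_ne_zero hz hw)
  simp [h4] at this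

variable {V : Set (Cn n)} {W : Fin (n + 1) → Cn n → Cn n}

theorem IsAdaptedMetric.eventually_renormConnection_eq (hg : IsAdaptedMetric ρ g)
    (hρ : IsDefiningFunction (n := n) ρ) (hφ : IsHolChart φ) (hV : V ⊆ φ.target)
    (hR : IsRegularFrame (ρ ∘ φ.symm) (regularSet (ρ ∘ φ.symm) V) W)
    (hz : z ∈ regularSet (ρ ∘ φ.symm) V) (hb : φ.symm z ∈ bdry ρ) :
    ∀ᶠ y in 𝓝 z, φ.symm y ∈ inside ρ → ∀ a b v,
      renormConnection (ρ ∘ φ.symm) (chartMetric g φ) W a b y v =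
        conn (ρ ∘ φ.symm) W a b y v := by
  obtain ⟨O, hO, hbO, hgO⟩ := hg.near_bdry
  filter_upwards [eventually_mem_target (hV hz.1) hO (hbO hb), hR.eventually_mem hz]
    with y hy hyU hi a b v
  refine hR.renormConnection_eq hyU (ne_of_lt hi) ?_ (hg.isUnit_det hφ hy.1 hi) a b v
  filter_upwards [eventually_mem_target hy.1 (hO.inter hρ.isOpen_inside) ⟨hy.2, hi⟩] with x hx
  exact hgO φ hφ x hx.1 hx.2

theorem IsAdaptedMetric.eventually_renormCurvature_eq (hg : IsAdaptedMetric ρ g)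
    (hρ : IsDefiningFunction (n := n) ρ) (hφ : IsHolChart φ) (hV : V ⊆ φ.target)
    (hR : IsRegularFrame (ρ ∘ φ.symm) (regularSet (ρ ∘ φ.symm) V) W)
    (hz : z ∈ regularSet (ρ ∘ φ.symm) V) (hb : φ.symm z ∈ bdry ρ) :
    ∀ᶠ y in 𝓝 z, φ.symm y ∈ inside ρ → ∀ a b v w,
      renormCurvature (ρ ∘ φ.symm) (chartMetric g φ) W a b y v w =
        extD (conn (ρ ∘ φ.symm) W a b) y v w
          - ∑ c, wedge (conn (ρ ∘ φ.symm) W a c) (conn (ρ ∘ φ.symm) W c b) y v w := by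
  filter_upwards [(hg.eventually_renormConnection_eq hρ hφ hV hR hz hb).eventually_nhds,
    φ.open_target.mem_nhds (hV hz.1)] with y hy hyt hi a b v w
  refine renormCurvature_eq_of_eventually ?_ a b v w
  filter_upwards [hy, eventually_mem_target hyt hρ.isOpen_inside hi] with x hx hxi
  exact hx hxi.2

variable [IsManifold 𝓘(ℂ, Cn n) ω N]

/-- The renormalized connection and its curvature extend continuously to the boundary, by the
connection of the bordered Hessian and its curvature. -/
theorem IsAdaptedMetric.exists_extension (hg : IsAdaptedMetric ρ g)
    (hρ : IsDefiningFunction (n := n) ρ) (hM : IsStrictlyPseudoconvex (n := n) ρ)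
    (hφ : IsHolChart φ) (hV : V ⊆ φ.target) (hW : IsAdmissibleFrame (ρ ∘ φ.symm) V W) :
    ∃ (θ : Fin (n + 1) → Fin (n + 1) → Cn n → Cn n → ℂ)
      (Θ : Fin (n + 1) → Fin (n + 1) → Cn n → Cn n → Cn n → ℂ),
      (∀ a b v, ContinuousOn (fun z => θ a b z v) (V ∩ φ.symm ⁻¹' closure (inside ρ))) ∧
      (∀ a b v w, ContinuousOn (fun z => Θ a b z v w) (V ∩ φ.symm ⁻¹' closure (inside ρ))) ∧
      (∀ a b, ∀ z ∈ V ∩ φ.symm ⁻¹' inside ρ, ∀ v,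
        θ a b z v = renormConnection (ρ ∘ φ.symm) (chartMetric g φ) W a b z v) ∧
      (∀ a b, ∀ z ∈ V ∩ φ.symm ⁻¹' inside ρ, ∀ v w,
        Θ a b z v w = renormCurvature (ρ ∘ φ.symm) (chartMetric g φ) W a b z v w) ∧
      (∀ a b, ∀ z ∈ V ∩ φ.symm ⁻¹' bdry ρ, ∀ v, θ a b z v = conn (ρ ∘ φ.symm) W a b z v) ∧
      (∀ a b, ∀ z ∈ V ∩ φ.symm ⁻¹' bdry ρ, ∀ v w,
        Θ a b z v w = extD (conn (ρ ∘ φ.symm) W a b) z v w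
          - ∑ c, wedge (conn (ρ ∘ φ.symm) W a c) (conn (ρ ∘ φ.symm) W c b) z v w) := by
  classical
  have hu : ∀ z ∈ V, ContDiffAt ℝ ∞ (ρ ∘ φ.symm) z := fun z hz =>
    hφ.contDiffAt_comp_symm hρ.smooth (hV hz)
  have hR := hW.isRegularFrame hu
  have hbR : ∀ z ∈ V ∩ φ.symm ⁻¹' bdry ρ, z ∈ regularSet (ρ ∘ φ.symm) V := fun z hz =>
    ⟨hz.1, hM.mongeAmpere_ne_zero hρ hφ (hV hz.1) hz.2⟩
  have hnot : ∀ z ∈ V ∩ φ.symm ⁻¹' bdry ρ, z ∉ φ.symm ⁻¹' inside ρ := fun z hz hi =>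
    (ne_of_lt (show ρ (φ.symm z) < 0 from hi)) (hρ.eq_zero hz.2)
  have hS : ∀ z ∈ V ∩ φ.symm ⁻¹' inside ρ, φ.symm ⁻¹' inside ρ ∈ 𝓝 z := fun z hz =>
    (eventually_mem_target (hV hz.1) hρ.isOpen_inside hz.2).mono fun _ h => h.2
  have hs : ∀ z ∈ V ∩ φ.symm ⁻¹' inside ρ, ∀ a b v, ContDiffAt ℝ ∞
      (fun y => renormConnection (ρ ∘ φ.symm) (chartMetric g φ) W a b y v) z := fun z hz =>
    hW.smooth_renormConnection hz.1 (hu z hz.1) (ne_of_lt hz.2)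
      (fun i j => (hg.smooth φ hφ i j).contDiffAt
        (Filter.inter_mem (φ.open_target.mem_nhds (hV hz.1)) (hS z hz)))
      (hg.isUnit_det hφ (hV hz.1) hz.2)
  have hset : φ.symm ⁻¹' closure (inside ρ) = φ.symm ⁻¹' inside ρ ∪ φ.symm ⁻¹' bdry ρ := by
    rw [closure_inside, Set.preimage_union]
  refine ⟨fun a b z v => if z ∈ φ.symm ⁻¹' inside ρ
      then renormConnection (ρ ∘ φ.symm) (chartMetric g φ) W a b z v
      else conn (ρ ∘ φ.symm) W a b z v,
    fun a b z v w => if z ∈ φ.symm ⁻¹' inside ρ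
      then renormCurvature (ρ ∘ φ.symm) (chartMetric g φ) W a b z v w
      else extD (conn (ρ ∘ φ.symm) W a b) z v w
        - ∑ c, wedge (conn (ρ ∘ φ.symm) W a c) (conn (ρ ∘ φ.symm) W c b) z v w,
    fun a b v => ?_, fun a b v w => ?_, fun a b z hz v => if_pos hz.2,
    fun a b z hz v w => if_pos hz.2, fun a b z hz v => if_neg (hnot z hz),
    fun a b z hz v w => if_neg (hnot z hz)⟩
  · rw [hset]
    exact continuousOn_ite hS (fun z hz => (hs z hz a b v).continuousAt)
      (fun z hz => (hR.smooth_conn (hbR z hz) a b v).continuousAt)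
      fun z hz => (hg.eventually_renormConnection_eq hρ hφ hV hR (hbR z hz) hz.2).mono
        fun y hy hi => hy hi a b v
  · rw [hset]
    exact continuousOn_ite hS (fun z hz => (smooth_curvature (hs z hz) a b v w).continuousAt)
      (fun z hz => (smooth_curvature (hR.smooth_conn (hbR z hz)) a b v w).continuousAt)
      fun z hz => (hg.eventually_renormCurvature_eq hρ hφ hV hR (hbR z hz) hz.2).mono
        fun y hy hi => hy hi a b v w

end Metric

/-! ### Boundary values of the connection forms -/

namespace IsBoundaryData

variable {u : Cn n → ℝ} {U M : Set (Cn n)} {W : Fin (n + 1) → Cn n → Cn n}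
  {om : Fin n → Fin n → Cn n → (Cn n →L[ℝ] ℂ)} {A : Fin n → Fin n → Cn n → ℂ} {z : Cn n}
  (d : IsBoundaryData u U M W om A) (hz : z ∈ M)
include d hz

theorem connection_succ_succ {v : Cn n} (hv : v ∈ Tangent u z) (β α : Fin n) :
    conn u W β.succ α.succ z v = om β α z v + Complex.I / ((n : ℂ) * (n + 1)) * scal u W om z *
      contactForm u z v * (if β = α then 1 else 0) := by
  rw [d.om_eq hz β α hv, twFun, ← d.scal_div hz]
  ring

theorem connection_zero_succ {v : Cn n} (hv : v ∈ Tangent u z) (α : Fin n) :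
    conn u W 0 α.succ z v = 1 / ((n : ℂ) * (n + 1)) * scal u W om z * coframe W α.succ z v
      - Complex.I * ∑ γ : Fin n, A α γ z * conjForm (coframe W γ.succ) z v
      + Complex.I / ((n : ℂ) * (n + 1)) * dScalUp u W om α z * contactForm u z v := by
  have hne := d.nat_ne
  simp only [d.frame.conn_zero_succ_tangent (d.mem_open hz) (d.fun_eq_zero hz) hv,
    ← d.torsion_up_eq hz, ← d.scal_div hz, d.dScalUp_eq hz, conjForm]
  generalize (∑ β : Fin n, leviInv u W z α β * conj (gamMat u W z 0 β.succ)) = c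
  rw [div_mul_eq_mul_div Complex.I, mul_left_comm Complex.I, mul_div_cancel_left₀ _ hne]
  ring

theorem connection_zero_zero {v : Cn n} (hv : v ∈ Tangent u z) :
    conn u W 0 0 z v = Complex.I / ((n : ℂ) * (n + 1)) * scal u W om z * contactForm u z v := by
  rw [d.frame.conn_zero_zero_tangent (d.mem_open hz) (d.fun_eq_zero hz) hv, ← d.scal_div hz]
  ring

end IsBoundaryData

end RenormBoundary

/-! ### The main theorem -/

open RenormBoundary
theorem mainTheorem6 {n : ℕ} (hn : 0 < n)
    {N : Type*} [TopologicalSpace N] [T2Space N] [ChartedSpace (Cn n) N]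
    [IsManifold 𝓘(ℂ, Cn n) ω N]
    (ρ : N → ℝ) (hρ : IsDefiningFunction (n := n) ρ) (hM : IsStrictlyPseudoconvex (n := n) ρ)
    (hMA : IsGlobalApproxSolution (n := n) ρ)
    (g : ∀ x : N, TangentSpace 𝓘(ℂ, Cn n) x →ₗ[ℂ] TangentSpace 𝓘(ℂ, Cn n) x →ₗ⋆[ℂ] ℂ)
    (hg : IsAdaptedMetric ρ g) :
    -- admissible frames exist near every boundary point
    (∀ φ : OpenPartialHomeomorph N (Cn n), IsHolChart φ →
      ∀ z ∈ φ.target, φ.symm z ∈ bdry ρ →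
        ∃ V ⊆ φ.target, z ∈ V ∧ ∃ W, IsAdmissibleFrame (ρ ∘ φ.symm) V W) ∧
    ∀ φ : OpenPartialHomeomorph N (Cn n), IsHolChart φ →
      ∀ V ⊆ φ.target, ∀ W, IsAdmissibleFrame (ρ ∘ φ.symm) V W →
      -- the Tanaka-Webster connection exists
      (∃ om A, IsTanakaWebster (ρ ∘ φ.symm) (V ∩ φ.symm ⁻¹' bdry ρ) W om A) ∧
      ∀ om A, IsTanakaWebster (ρ ∘ φ.symm) (V ∩ φ.symm ⁻¹' bdry ρ) W om A →
        -- the transverse curvature on `M`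
        (∀ z ∈ V ∩ φ.symm ⁻¹' bdry ρ,
          transverseCurvature (ρ ∘ φ.symm) W z =
            scal (ρ ∘ φ.symm) W om z / ((n : ℂ) * (n + 1))) ∧
        -- the continuous extensions to the boundary of the renormalized connection and curvature
        (∃ (θ : Fin (n + 1) → Fin (n + 1) → Cn n → Cn n → ℂ)
          (Θ : Fin (n + 1) → Fin (n + 1) → Cn n → Cn n → Cn n → ℂ),
          (∀ a b v, ContinuousOn (fun z => θ a b z v) (V ∩ φ.symm ⁻¹' closure (inside ρ))) ∧
          (∀ a b v w,
            ContinuousOn (fun z => Θ a b z v w) (V ∩ φ.symm ⁻¹' closure (inside ρ))) ∧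
          (∀ a b, ∀ z ∈ V ∩ φ.symm ⁻¹' inside ρ, ∀ v,
            θ a b z v = renormConnection (ρ ∘ φ.symm) (chartMetric g φ) W a b z v) ∧
          (∀ a b, ∀ z ∈ V ∩ φ.symm ⁻¹' inside ρ, ∀ v w,
            Θ a b z v w = renormCurvature (ρ ∘ φ.symm) (chartMetric g φ) W a b z v w) ∧
          -- the connection restricted to `M`
          (∀ z ∈ V ∩ φ.symm ⁻¹' bdry ρ, ∀ v ∈ Tangent (ρ ∘ φ.symm) z,
            (∀ β α : Fin n, θ β.succ α.succ z v =
              om β α z v + Complex.I / ((n : ℂ) * (n + 1)) * scal (ρ ∘ φ.symm) W om z *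
                contactForm (ρ ∘ φ.symm) z v * (if β = α then 1 else 0)) ∧
            (∀ α : Fin n, θ 0 α.succ z v =
              1 / ((n : ℂ) * (n + 1)) * scal (ρ ∘ φ.symm) W om z * coframe W α.succ z v
                - Complex.I * ∑ γ : Fin n, A α γ z * conjForm (coframe W γ.succ) z v
                + Complex.I / ((n : ℂ) * (n + 1)) * dScalUp (ρ ∘ φ.symm) W om α z *
                  contactForm (ρ ∘ φ.symm) z v) ∧
            (∀ β : Fin n, θ β.succ 0 z v =
              - ∑ γ : Fin n, levi (ρ ∘ φ.symm) W z β γ * conjForm (coframe W γ.succ) z v) ∧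
            θ 0 0 z v = Complex.I / ((n : ℂ) * (n + 1)) * scal (ρ ∘ φ.symm) W om z *
              contactForm (ρ ∘ φ.symm) z v) ∧
          -- the curvature restricted to `M`
          (∀ z ∈ V ∩ φ.symm ⁻¹' bdry ρ, ∀ v ∈ Tangent (ρ ∘ φ.symm) z,
            ∀ w ∈ Tangent (ρ ∘ φ.symm) z,
            (∀ β α : Fin n, Θ β.succ α.succ z v w =
              ∑ γ : Fin n, ∑ μ : Fin n, tensorSUp (ρ ∘ φ.symm) W om β α γ μ z *
                  wedge (coframe W γ.succ) (conjForm (coframe W μ.succ)) z v w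
                + ∑ γ : Fin n, tensorVUp (ρ ∘ φ.symm) W om A β α γ z *
                  wedge (coframe W γ.succ) (contactForm (ρ ∘ φ.symm)) z v w
                - ∑ γ : Fin n, tensorVUpBar (ρ ∘ φ.symm) W om A α β γ z *
                  wedge (conjForm (coframe W γ.succ)) (contactForm (ρ ∘ φ.symm)) z v w
                - Complex.I * ∑ γ : Fin n, torsion (ρ ∘ φ.symm) W A β γ z *
                  wedge (coframe W γ.succ) (coframe W α.succ) z v w
                + Complex.I / ((n : ℂ) * (n + 1)) * dScal (ρ ∘ φ.symm) W om β z *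
                  wedge (contactForm (ρ ∘ φ.symm)) (coframe W α.succ) z v w) ∧
            (∀ β : Fin n, Θ β.succ 0 z v w =
              ∑ γ : Fin n, torsion (ρ ∘ φ.symm) W A β γ z *
                wedge (coframe W γ.succ) (contactForm (ρ ∘ φ.symm)) z v w))) ∧
        -- `S` is the Chern-Moser tensor
        (∀ z ∈ V ∩ φ.symm ⁻¹' bdry ρ, ∀ β α γ μ : Fin n,
          tensorS (ρ ∘ φ.symm) W om β α γ μ z = chernMoser (ρ ∘ φ.symm) W om β α γ μ z) := by
  refine ⟨fun φ hφ z hz hb => hM.exists_isAdmissibleFrame hρ hφ hz hb,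
    fun φ hφ V hV W hW => ⟨?_, fun om A hTW => ?_⟩⟩
  · exact ⟨_, _, (hW.isRegularFrame fun _ hy =>
      hφ.contDiffAt_comp_symm hρ.smooth (hV hy)).isTanakaWebster fun z hz =>
        ⟨⟨hz.1, hM.mongeAmpere_ne_zero hρ hφ (hV hz.1) hz.2⟩, hρ.eq_zero hz.2⟩⟩
  have d := isBoundaryData hn hρ hM hMA hφ hV hW hTW
  refine ⟨fun z hz => (d.scal_div hz).symm, ?_, fun z hz => d.tensorS_eq_chernMoser hz⟩
  obtain ⟨θ, Θ, h1, h2, h3, h4, h5, h6⟩ := hg.exists_extension hρ hM hφ hV hW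
  refine ⟨θ, Θ, h1, h2, h3, h4, fun z hz v hv => ⟨fun β α => ?_, fun α => ?_, fun β => ?_, ?_⟩,
    fun z hz v hv w hw => ⟨fun β α => ?_, fun β => ?_⟩⟩
  · rw [h5 _ _ z hz, d.connection_succ_succ hz hv]
  · rw [h5 _ _ z hz, d.connection_zero_succ hz hv]
  · rw [h5 _ _ z hz, d.frame.conn_succ_zero_boundary (d.mem_open hz) (d.fun_eq_zero hz)]
    rfl
  · rw [h5 _ _ z hz, d.connection_zero_zero hz hv]
  · rw [h6 _ _ z hz, d.curvature_succ_succ hz hv hw]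
  · rw [h6 _ _ z hz, d.curvature_succ_zero hz hv hw]
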